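/- Let $G$ be an undirected graph with $n$ vertices, $m$ edges and non-negative real edge weights, let $r$ be a vertex of $G$, and let $T$ be a shortest-path tree of $G$ rooted at $r$ (a spanning tree of $G$ with $d_T(r,v)=d_G(r,v)$ for all $v$). A *path failure* is a set $F\neq\emptyset$ of consecutive edges of $T$ on a path of $T$ emanating from $r$; that is, for some vertex $v$, $F$ consists of the last $|F|$ edges of the path of $T$ from $r$ to $v$. There is a deterministic algorithm with the following properties. Given $G$, its weights, $r$, $T$, and integers $f\ge 1$ and $k\ge 1$, it builds in time $O(n(m+f^2))$ a data structure (oracle) of size $O(n\,k\,f^{1+1/k})$. For every path failure $F$ with $|F|\le f$, with deepest endpoint $v$, and every vertex $t$, the oracle, queried with $(v,|F|,t)$, is able to return - in time $O(f+k)$, a $(2k-1)(2|F|+1)$-approximate distance from $r$ to $t$ in $G-F$, i.e. a value $\tilde d\in[0,\infty]$ with $d_{G-F}(r,t)\le \tilde d\le (2k-1)(2|F|+1)\,d_{G-F}(r,t)$ (so $\tilde d=\infty$ exactly if $t$ is not reachable from $r$ in $G-F$); - in time $O(\ell+k+f)$, a corresponding path (vertices may repeat) from $r$ to $t$ in $G-F$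 of total weight exactly $\tilde d$, where $\ell$ is its number of edges; if $\tilde d=\infty$, it reports in time $O(k+f)$ that there is no path. All implied constants are absolute. The model is a random access machine with unit-cost operations: integer words have $O(\log(n+f+k))$ bits, and real numbers occupy one cell each and can only be copied, added, subtracted and compared. The size of a data structure is its number of memory cells. -/

import Mathlib

open scoped NNReal ENNReal

namespace PathOracle

/-! ### Weighted graphs, shortest-path trees and path failures -/

section Graphs

variable {V : Type*}

/-- The weighted length of a walk. -/
def walkWeight (w : Sym2 V → ℝ≥0) {G : SimpleGraph V} {u v : V} (p : G.Walk u v) : ℝ≥0 :=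
  (p.edges.map w).sum

/-- The weighted distance between two vertices; it is `⊤` if they are not connected. -/
noncomputable def wdist (G : SimpleGraph V) (w : Sym2 V → ℝ≥0) (u v : V) : ℝ≥0∞ :=
  ⨅ p : G.Walk u v, (walkWeight w p : ℝ≥0∞)

/-- `T` is a shortest-path tree of `G` rooted at `r`: a spanning tree of `G` that preserves all
distances from `r`. -/
def IsSPT (G : SimpleGraph V) (w : Sym2 V → ℝ≥0) (r : V) (T : SimpleGraph V) : Prop :=
  T ≤ G ∧ T.IsTree ∧ ∀ v, wdist T w r v = wdist G w r v

/-- `F` is a set of cascading edges of the tree `T` rooted at `r`, with deepest endpoint `v`: the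
path of `T` from `r` to `v` splits into two parts `p`, `q`, and `F` is the edge set of the last
part `q`. -/
def IsPathFailure (T : SimpleGraph V) (r v : V) (F : Finset (Sym2 V)) : Prop :=
  ∃ (x : V) (p : T.Walk r x) (q : T.Walk x v), (p.append q).IsPath ∧ ∀ e, e ∈ F ↔ e ∈ q.edges

/-- `G - F`. -/
abbrev removeEdges (G : SimpleGraph V) (F : Finset (Sym2 V)) : SimpleGraph V :=
  G.deleteEdges (F : Set (Sym2 V))

end Graphs

/-! ### A random access machine with real registers (unit cost, addition-comparison on reals)

The machine has integer registers and real registers, and three memory banks, each with integer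
cells and real cells: a read-only input bank, a work bank and an output bank. A program is
a while-program. Integers must stay below a word bound `W`, otherwise the run crashes (there is no
derivation of it). Reals can be copied, added, subtracted and compared, but not converted to
integers. -/

/-- The three memory banks. -/
inductive Bank
  | input
  | work
  | output
  deriving DecidableEq

/-- A configuration of the machine. -/
structure Store where
  reg : ℕ → ℕ
  rreg : ℕ → ℝ
  mem : Bank → ℕ → ℕ
  rmem : Bank → ℕ → ℝ

/-- Integer expressions (`sub` is truncated, `div` rounds down). -/
inductive NExp
  | const (c : ℕ)
  | reg (i : ℕ)
  | add (a b : NExp)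
  | sub (a b : NExp)
  | mul (a b : NExp)
  | div (a b : NExp)
  | load (b : Bank) (addr : NExp)

/-- The value of an integer expression. -/
def NExp.eval (s : Store) : NExp → ℕ
  | .const c => c
  | .reg i => s.reg i
  | .add a b => a.eval s + b.eval s
  | .sub a b => a.eval s - b.eval s
  | .mul a b => a.eval s * b.eval s
  | .div a b => a.eval s / b.eval s
  | .load b addr => s.mem b (addr.eval s)

/-- All values met while evaluating the expression are below `W`. -/
def NExp.Fits (W : ℕ) (s : Store) : NExp → Prop
  | .const c => c < W
  | .reg i => s.reg i < W
  | .add a b => a.Fits W s ∧ b.Fits W s ∧ a.eval s + b.eval s < W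
  | .sub a b => a.Fits W s ∧ b.Fits W s
  | .mul a b => a.Fits W s ∧ b.Fits W s ∧ a.eval s * b.eval s < W
  | .div a b => a.Fits W s ∧ b.Fits W s
  | .load b addr => addr.Fits W s ∧ s.mem b (addr.eval s) < W

/-- The number of elementary operations used for evaluating the expression. -/
def NExp.cost : NExp → ℕ
  | .const _ => 1
  | .reg _ => 1
  | .add a b => a.cost + b.cost + 1
  | .sub a b => a.cost + b.cost + 1
  | .mul a b => a.cost + b.cost + 1
  | .div a b => a.cost + b.cost + 1
  | .load _ addr => addr.cost + 1

/-- Real expressions. -/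
inductive RExp
  | zero
  | reg (i : ℕ)
  | add (a b : RExp)
  | sub (a b : RExp)
  | load (b : Bank) (addr : NExp)

/-- The value of a real expression. -/
noncomputable def RExp.eval (s : Store) : RExp → ℝ
  | .zero => 0
  | .reg i => s.rreg i
  | .add a b => a.eval s + b.eval s
  | .sub a b => a.eval s - b.eval s
  | .load b addr => s.rmem b (addr.eval s)

/-- All integers met while evaluating the real expression (the addresses) are below `W`. -/
def RExp.Fits (W : ℕ) (s : Store) : RExp → Prop
  | .zero => True
  | .reg _ => True
  | .add a b => a.Fits W s ∧ b.Fits W s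
  | .sub a b => a.Fits W s ∧ b.Fits W s
  | .load _ addr => addr.Fits W s

/-- The number of elementary operations used for evaluating the expression. -/
def RExp.cost : RExp → ℕ
  | .zero => 1
  | .reg _ => 1
  | .add a b => a.cost + b.cost + 1
  | .sub a b => a.cost + b.cost + 1
  | .load _ addr => addr.cost + 1

/-- Tests: comparisons of integers or of reals. -/
inductive Test
  | lt (a b : NExp)
  | eq (a b : NExp)
  | rlt (a b : RExp)

/-- The truth value of a test. -/
def Test.Holds (s : Store) : Test → Prop
  | .lt a b => a.eval s < b.eval s
  | .eq a b => a.eval s = b.eval s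
  | .rlt a b => a.eval s < b.eval s

/-- All integers met while evaluating the test are below `W`. -/
def Test.Fits (W : ℕ) (s : Store) : Test → Prop
  | .lt a b => a.Fits W s ∧ b.Fits W s
  | .eq a b => a.Fits W s ∧ b.Fits W s
  | .rlt a b => a.Fits W s ∧ b.Fits W s

/-- The number of elementary operations used for evaluating the test. -/
def Test.cost : Test → ℕ
  | .lt a b => a.cost + b.cost + 1
  | .eq a b => a.cost + b.cost + 1
  | .rlt a b => a.cost + b.cost + 1

/-- Programs. -/
inductive Program
  | skip
  | set (i : ℕ) (e : NExp)
  | rset (i : ℕ) (e : RExp)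
  | store (b : Bank) (addr e : NExp)
  | rstore (b : Bank) (addr : NExp) (e : RExp)
  | seq (c d : Program)
  | ite (t : Test) (c d : Program)
  | loop (t : Test) (c : Program)

/-- Set an integer register. -/
def Store.setReg (s : Store) (i x : ℕ) : Store :=
  { s with reg := Function.update s.reg i x }

/-- Set a real register. -/
noncomputable def Store.setRReg (s : Store) (i : ℕ) (x : ℝ) : Store :=
  { s with rreg := Function.update s.rreg i x }

/-- Write an integer memory cell. -/
def Store.write (s : Store) (b : Bank) (a x : ℕ) : Store :=
  { s with mem := Function.update s.mem b (Function.update (s.mem b) a x) }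

/-- Write a real memory cell. -/
noncomputable def Store.rwrite (s : Store) (b : Bank) (a : ℕ) (x : ℝ) : Store :=
  { s with rmem := Function.update s.rmem b (Function.update (s.rmem b) a x) }

/-- `Exec W c s τ s'`: with word bound `W`, the program `c` started in the configuration `s` halts
in the configuration `s'` after `τ` elementary steps. `loop t c` repeats `c` while `t` holds. -/
inductive Exec (W : ℕ) : Program → Store → ℕ → Store → Prop
  | skip (s : Store) : Exec W .skip s 1 s
  | set (s : Store) (i : ℕ) (e : NExp) (he : e.Fits W s) :
      Exec W (.set i e) s (e.cost + 1) (s.setReg i (e.eval s))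
  | rset (s : Store) (i : ℕ) (e : RExp) (he : e.Fits W s) :
      Exec W (.rset i e) s (e.cost + 1) (s.setRReg i (e.eval s))
  | store (s : Store) (b : Bank) (addr e : NExp) (hb : b ≠ Bank.input)
      (ha : addr.Fits W s) (he : e.Fits W s) :
      Exec W (.store b addr e) s (addr.cost + e.cost + 1) (s.write b (addr.eval s) (e.eval s))
  | rstore (s : Store) (b : Bank) (addr : NExp) (e : RExp) (hb : b ≠ Bank.input)
      (ha : addr.Fits W s) (he : e.Fits W s) :
      Exec W (.rstore b addr e) s (addr.cost + e.cost + 1) (s.rwrite b (addr.eval s) (e.eval s))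
  | seq (c d : Program) (s s₁ s₂ : Store) (τ₁ τ₂ : ℕ) (hc : Exec W c s τ₁ s₁)
      (hd : Exec W d s₁ τ₂ s₂) : Exec W (.seq c d) s (τ₁ + τ₂) s₂
  | iteTrue (t : Test) (c d : Program) (s s₁ : Store) (τ : ℕ) (hf : t.Fits W s)
      (ht : t.Holds s) (hc : Exec W c s τ s₁) : Exec W (.ite t c d) s (t.cost + τ) s₁
  | iteFalse (t : Test) (c d : Program) (s s₁ : Store) (τ : ℕ) (hf : t.Fits W s)
      (ht : ¬ t.Holds s) (hd : Exec W d s τ s₁) : Exec W (.ite t c d) s (t.cost + τ) s₁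
  | loopTrue (t : Test) (c : Program) (s s₁ s₂ : Store) (τ₁ τ₂ : ℕ) (hf : t.Fits W s)
      (ht : t.Holds s) (hc : Exec W c s τ₁ s₁) (hl : Exec W (.loop t c) s₁ τ₂ s₂) :
      Exec W (.loop t c) s (t.cost + τ₁ + τ₂) s₂
  | loopFalse (t : Test) (c : Program) (s : Store) (hf : t.Fits W s) (ht : ¬ t.Holds s) :
      Exec W (.loop t c) s t.cost s

/-- The initial configuration: the arguments `args` in the first integer registers, the given
contents of the input bank, and zero everywhere else. -/
noncomputable def Store.init (args : List ℕ) (inp : ℕ → ℕ) (rinp : ℕ → ℝ) : Store where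
  reg i := args.getD i 0
  rreg _ := 0
  mem
    | .input => inp
    | _ => fun _ => 0
  rmem
    | .input => rinp
    | _ => fun _ => 0

/-! ### Encoding of inputs and outputs -/

/-- The `i`-th edge of a list of pairs of endpoints. -/
def edgeAt {n m : ℕ} (ends : Fin m → Fin n × Fin n) (i : Fin m) : Sym2 (Fin n) :=
  s((ends i).1, (ends i).2)

/-- `ends` lists every edge of `G` exactly once (in any order, with any order of endpoints); in
particular `G` has `m` edges. -/
def IsEdgeListing {n m : ℕ} (G : SimpleGraph (Fin n)) (ends : Fin m → Fin n × Fin n) : Prop :=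
  Function.Injective (edgeAt ends) ∧ Set.range (edgeAt ends) = G.edgeSet

open Classical in
/-- The integer cells of the input: cells `3i`, `3i+1` hold the endpoints of the `i`-th edge, and
cell `3i+2` tells whether that edge belongs to the tree `T`. -/
noncomputable def graphInput {n m : ℕ} (T : SimpleGraph (Fin n)) (ends : Fin m → Fin n × Fin n)
    (a : ℕ) : ℕ :=
  if h : a / 3 < m then
    if a % 3 = 0 then ((ends ⟨a / 3, h⟩).1 : ℕ)
    else if a % 3 = 1 then ((ends ⟨a / 3, h⟩).2 : ℕ)
    else if edgeAt ends ⟨a / 3, h⟩ ∈ T.edgeSet then 1 else 0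
  else 0

/-- The real cells of the input: cell `i` holds the weight of the `i`-th edge. -/
noncomputable def weightInput {n m : ℕ} (w : Sym2 (Fin n) → ℝ≥0) (ends : Fin m → Fin n × Fin n)
    (a : ℕ) : ℝ :=
  if h : a < m then (w (edgeAt ends ⟨a, h⟩) : ℝ) else 0

/-- The output bank is contained in its first `S` (integer and real) cells. -/
def OutputSizeLE (s : Store) (S : ℕ) : Prop :=
  ∀ a, S ≤ a → s.mem .output a = 0 ∧ s.rmem .output a = 0

/-- The output reports the distance `d`: integer cell `0` tells whether it is finite, and if so,
real cell `0` holds it. -/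
def ReportsDist (s : Store) (d : ℝ≥0∞) : Prop :=
  (d = ⊤ ∧ s.mem .output 0 = 0) ∨
    (d ≠ ⊤ ∧ s.mem .output 0 = 1 ∧ s.rmem .output 0 = d.toReal)

/-- The output reports that there is no path. -/
def ReportsNoWalk (s : Store) : Prop := s.mem .output 0 = 0

/-- The output reports the walk `p`: integer cell `0` holds `1`, cell `1` holds the number `ℓ` of
edges, and the next `ℓ + 1` cells hold the vertices of `p` in order. -/
def ReportsWalk {n : ℕ} {G : SimpleGraph (Fin n)} {u v : Fin n} (s : Store) (p : G.Walk u v) :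
    Prop :=
  s.mem .output 0 = 1 ∧ s.mem .output 1 = p.length ∧
    ∀ i, i ≤ p.length → s.mem .output (i + 2) = (p.getVert i : ℕ)

/-- The initial configuration of a query about the failure of the last `η` edges of the tree path
ending in `v` and about the target `t`, on the oracle left in the output bank of `o`. -/
noncomputable def queryInit {n : ℕ} (o : Store) (v : Fin n) (η : ℕ) (t : Fin n) : Store :=
  Store.init [(v : ℕ), η, (t : ℕ)] (o.mem .output) (o.rmem .output)

end PathOracle

namespace PathOracle

/-! ### Syntax and array views -/

/-! Fix a vertex `v` and let `h` be the minimum of `f` and the depth of `v`. Deleting the parent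
edges of the first `h` ancestors of `v` (starting with `v`) splits the tree into classes `0, …, h`,
where class `i < h` hangs from the `i`-th ancestor and class `h` contains the root. If only the last
`η ≤ h` edges fail, the classes `η, …, h` stay connected to the root inside the tree, so one
structure per `v` serves every `η`. Give each non-tree edge `xy` the key `dist x + weight + dist y`
and store a minimum spanning forest of the classes for these keys. It has at most `h` edges, so the
oracle occupies `O(n f)` cells. The stretch obtained is `2η + 1`; the factors `2k - 1` and `k
f^(1/k)` of the statement are slack, and no spanner construction is needed.

A query re-roots the forest at the class `Q` of the target `t` and computes for every class `q` of
its tree a number `D q`, the sum of `key - 2 * dist (top of the next class)` over the links from `q`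
to `Q`. The answer is `D c + dist t` for the cheapest class `c ≥ η`. This is the exact weight of a
walk: from the root down the tree to the first link, across it, up to the top of the next class,
down to the next link, and finally down to `t`. The distances telescope, and none of these tree
paths contains a failed edge.

For the stretch, let a walk of weight `L` from the root to `t` avoid the failed edges. Tree
distances are graph distances, so both ends of each of its edges are at distance at most `L`, and
every non-tree edge used has key at most `2L`. A minimum spanning forest is optimal for bottlenecks
(`Grown.closed`), hence the classes reachable from `Q` by forest links of key at most `2L` are
closed under the steps of the walk, unless a class `≥ η` is among them; as the walk starts in class
`h`, such a class must be among them (`IsWalk.cheap`). On the way from `Q` to the first one, all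
other classes are distinct and below `η`, so there are at most `η` links, of total cost at most
`2ηL` (`Near.cheap`). Adding `dist t ≤ L` gives `(2η + 1) L`.

The forest is grown by Prim's algorithm on a matrix of cheapest edges between classes, in time `O(n
+ m + f²)` for each `v` (`blockBody_spec`); with a search of the tree and a numbering that decides
ancestry this gives `build_spec`. `locate_spec` and `Plan.emit_spec` verify the queries, and
`query_spec` combines them with the stretch bound. Programs are handled by weakest preconditions for
loop-free pieces, invariants that carry a time budget for loops, and a syntactic frame analysis for
everything left untouched. -/

instance : Add NExp := ⟨NExp.add⟩
instance : Sub NExp := ⟨NExp.sub⟩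
instance : Mul NExp := ⟨NExp.mul⟩
instance (c : ℕ) : OfNat NExp c := ⟨NExp.const c⟩
instance : Add RExp := ⟨RExp.add⟩
instance : Sub RExp := ⟨RExp.sub⟩

infixr:60 " ;; " => Program.seq

abbrev rg (i : ℕ) : NExp := NExp.reg i

/-- Cell `i` of the `k`-th of sixteen interleaved integer arrays of a bank. -/
def Store.arr (s : Store) (b : Bank) (k i : ℕ) : ℕ := s.mem b (16 * i + k)

/-- Cell `i` of the `k`-th of sixteen interleaved real arrays of a bank. -/
def Store.rarr (s : Store) (b : Bank) (k i : ℕ) : ℝ := s.rmem b (16 * i + k)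

def Store.wr (s : Store) (b : Bank) (k i x : ℕ) : Store := s.write b (16 * i + k) x

noncomputable def Store.rwr (s : Store) (b : Bank) (k i : ℕ) (x : ℝ) : Store :=
  s.rwrite b (16 * i + k) x

def ld (b : Bank) (k : ℕ) (i : NExp) : NExp :=
  .load b (.add (.mul (.const 16) i) (.const k))

def rld (b : Bank) (k : ℕ) (i : NExp) : RExp :=
  .load b (.add (.mul (.const 16) i) (.const k))

def st (b : Bank) (k : ℕ) (i e : NExp) : Program :=
  .store b (.add (.mul (.const 16) i) (.const k)) e

def rst (b : Bank) (k : ℕ) (i : NExp) (e : RExp) : Program :=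
  .rstore b (.add (.mul (.const 16) i) (.const k)) e

section simps

variable (s : Store)

@[simp] theorem eval_reg (i : ℕ) : (NExp.reg i).eval s = s.reg i := rfl
@[simp] theorem eval_add (a b : NExp) : (a + b).eval s = a.eval s + b.eval s := rfl
@[simp] theorem eval_sub (a b : NExp) : (a - b).eval s = a.eval s - b.eval s := rfl
@[simp] theorem eval_mul (a b : NExp) : (a * b).eval s = a.eval s * b.eval s := rfl
@[simp] theorem eval_ofNat (c : ℕ) :
    NExp.eval s (no_index (OfNat.ofNat c : NExp)) = (OfNat.ofNat c : ℕ) := rfl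
@[simp] theorem eval_ld (b : Bank) (k : ℕ) (i : NExp) :
    (ld b k i).eval s = s.arr b k (i.eval s) := rfl
@[simp] theorem reval_add (a b : RExp) : (a + b).eval s = a.eval s + b.eval s := rfl
@[simp] theorem reval_sub (a b : RExp) : (a - b).eval s = a.eval s - b.eval s := rfl
@[simp] theorem reval_rld (b : Bank) (k : ℕ) (i : NExp) :
    (rld b k i).eval s = s.rarr b k (i.eval s) := rfl
@[simp] theorem holds_lt (a b : NExp) : (Test.lt a b).Holds s ↔ a.eval s < b.eval s := Iff.rfl
@[simp] theorem holds_eq (a b : NExp) : (Test.eq a b).Holds s ↔ a.eval s = b.eval s := Iff.rfl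
@[simp] theorem holds_rlt (a b : RExp) : (Test.rlt a b).Holds s ↔ a.eval s < b.eval s := Iff.rfl

@[simp] theorem reg_setReg (i j x : ℕ) :
    (s.setReg i x).reg j = if j = i then x else s.reg j := by
  simp [Store.setReg, Function.update_apply]
@[simp] theorem mem_setReg (i x : ℕ) : (s.setReg i x).mem = s.mem := rfl
@[simp] theorem rmem_setReg (i x : ℕ) : (s.setReg i x).rmem = s.rmem := rfl
@[simp] theorem arr_setReg (i x : ℕ) : (s.setReg i x).arr = s.arr := rfl
@[simp] theorem rarr_setReg (i x : ℕ) : (s.setReg i x).rarr = s.rarr := rfl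

@[simp] theorem rreg_setRReg (i j : ℕ) (x : ℝ) :
    (s.setRReg i x).rreg j = if j = i then x else s.rreg j := by
  simp [Store.setRReg, Function.update_apply]

@[simp] theorem reg_wr (b : Bank) (k i x : ℕ) : (s.wr b k i x).reg = s.reg := rfl
@[simp] theorem rmem_wr (b : Bank) (k i x : ℕ) : (s.wr b k i x).rmem = s.rmem := rfl
@[simp] theorem rarr_wr (b : Bank) (k i x : ℕ) : (s.wr b k i x).rarr = s.rarr := rfl

@[simp] theorem reg_rwr (b : Bank) (k i : ℕ) (x : ℝ) : (s.rwr b k i x).reg = s.reg := rfl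
@[simp] theorem mem_rwr (b : Bank) (k i : ℕ) (x : ℝ) : (s.rwr b k i x).mem = s.mem := rfl
@[simp] theorem arr_rwr (b : Bank) (k i : ℕ) (x : ℝ) : (s.rwr b k i x).arr = s.arr := rfl

@[simp] theorem reg_write (b : Bank) (i x : ℕ) : (s.write b i x).reg = s.reg := rfl
@[simp] theorem rarr_write (b : Bank) (i x : ℕ) : (s.write b i x).rarr = s.rarr := rfl
theorem mem_write (b b' : Bank) (i j x : ℕ) :
    (s.write b i x).mem b' j = if b' = b ∧ j = i then x else s.mem b' j := by
  by_cases h : b' = b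
  · subst h; simp [Store.write, Function.update_apply]
  · simp [Store.write, h]
@[simp] theorem mem_write_same (b : Bank) (i j x : ℕ) :
    (s.write b i x).mem b j = if j = i then x else s.mem b j := by
  simp [mem_write]
theorem arr_write_ne (b b' : Bank) (k i x : ℕ) (h : b' ≠ b) :
    (s.write b i x).arr b' k = s.arr b' k := by
  funext j; simp [Store.arr, mem_write, h]
@[simp] theorem arr_write_output_input (k i x : ℕ) :
    (s.write .output i x).arr .input k = s.arr .input k := arr_write_ne _ _ _ _ _ _ (by simp)
@[simp] theorem mem_rwrite (b : Bank) (i : ℕ) (x : ℝ) : (s.rwrite b i x).mem = s.mem := rfl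
@[simp] theorem rmem_rwrite_same (b : Bank) (i j : ℕ) (x : ℝ) :
    (s.rwrite b i x).rmem b j = if j = i then x else s.rmem b j := by
  simp [Store.rwrite, Function.update_apply]

theorem arr_wr_ne (b b' : Bank) (k k' i x : ℕ) (hk : k < 16) (hk' : k' < 16)
    (h : b' ≠ b ∨ k' ≠ k) : (s.wr b k i x).arr b' k' = s.arr b' k' := by
  funext j
  unfold Store.arr Store.wr
  rw [mem_write, if_neg]
  rintro ⟨h1, h2⟩
  rcases h with h | h
  · exact h h1
  · omega

@[simp] theorem arr_wr_bank (b b' : Bank) (k k' i x : ℕ) (hk : k < 16) (hk' : k' < 16)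
    (h : b' ≠ b) : (s.wr b k i x).arr b' k' = s.arr b' k' :=
  arr_wr_ne _ _ _ _ _ _ _ hk hk' (.inl h)

@[simp] theorem arr_wr_idx (b : Bank) (k k' i x : ℕ) (hk : k < 16) (hk' : k' < 16)
    (h : k' ≠ k) : (s.wr b k i x).arr b k' = s.arr b k' :=
  arr_wr_ne _ _ _ _ _ _ _ hk hk' (.inr h)

@[simp] theorem arr_wr_same (b : Bank) (k i x j : ℕ) :
    (s.wr b k i x).arr b k j = if j = i then x else s.arr b k j := by
  unfold Store.arr Store.wr
  rw [mem_write]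
  simp only [true_and, Nat.add_right_cancel_iff]
  congr 1
  simp

@[simp] theorem rarr_rwr_same (b : Bank) (k i j : ℕ) (x : ℝ) :
    (s.rwr b k i x).rarr b k j = if j = i then x else s.rarr b k j := by
  unfold Store.rarr Store.rwr Store.rwrite
  simp [Function.update_apply]

end simps

/-! ### Boundedness of integers and well-formed expressions -/

/-- A uniform bound on all stored integers. Only stored values are tracked; intermediate values of
expressions are controlled by a fixed power of `B`. -/
def Bdd (B : ℕ) (s : Store) : Prop := (∀ i, s.reg i ≤ B) ∧ ∀ b a, s.mem b a ≤ B

theorem Bdd.reg {B : ℕ} {s : Store} (h : Bdd B s) (i : ℕ) : s.reg i ≤ B := h.1 i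
theorem Bdd.arr {B : ℕ} {s : Store} (h : Bdd B s) (b : Bank) (k i : ℕ) : s.arr b k i ≤ B :=
  h.2 b _

/-- A degree such that the value of an expression is below `(B + 100) ^ deg` whenever the
integers of the configuration are at most `B`. -/
def NExp.deg : NExp → ℕ
  | .const c => if c < 100 then 1 else c
  | .reg _ => 1
  | .add a b => max a.deg b.deg + 1
  | .sub a b => max a.deg b.deg
  | .mul a b => a.deg + b.deg
  | .div a b => max a.deg b.deg
  | .load _ a => a.deg

def RExp.deg : RExp → ℕ
  | .zero => 1
  | .reg _ => 1
  | .add a b => max a.deg b.deg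
  | .sub a b => max a.deg b.deg
  | .load _ a => a.deg

def Test.deg : Test → ℕ
  | .lt a b => max a.deg b.deg
  | .eq a b => max a.deg b.deg
  | .rlt a b => max a.deg b.deg

theorem NExp.one_le_deg (e : NExp) : 1 ≤ e.deg := by
  induction e <;> simp only [NExp.deg] <;> try split_ifs
  all_goals omega

theorem NExp.eval_lt {B : ℕ} {s : Store} (h : Bdd B s) (e : NExp) :
    e.eval s < (B + 100) ^ e.deg := by
  have mono : ∀ {x a b : ℕ}, a ≤ b → x < (B + 100) ^ a → x < (B + 100) ^ b :=
    fun hab hx => hx.trans_le (Nat.pow_le_pow_right (by omega) hab)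
  induction e with
  | const c =>
    simp only [NExp.eval, NExp.deg]
    split_ifs with hc
    · simp; omega
    -- A constant `c ≥ 100` was given degree `c`, and `c < 2 ^ c`.
    · exact lt_of_lt_of_le (Nat.lt_two_pow_self) (Nat.pow_le_pow_left (by omega) c)
  | reg i => have := h.1 i; simp only [NExp.eval, NExp.deg, pow_one]; omega
  | add a b iha ihb =>
    simp only [NExp.eval, NExp.deg]
    have h1 := mono (le_max_left a.deg b.deg) iha
    have h2 := mono (le_max_right a.deg b.deg) ihb
    rw [pow_succ]
    generalize (B + 100) ^ max a.deg b.deg = M at *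
    nlinarith
  | sub a b iha ihb =>
    simp only [NExp.eval, NExp.deg]
    have h1 := mono (le_max_left a.deg b.deg) iha
    omega
  | mul a b iha ihb =>
    simp only [NExp.eval, NExp.deg]
    rw [pow_add]
    exact Nat.mul_lt_mul'' iha ihb
  | div a b iha ihb =>
    simp only [NExp.eval, NExp.deg]
    have h1 := mono (le_max_left a.deg b.deg) iha
    exact (Nat.div_le_self _ _).trans_lt h1
  | load b a iha =>
    simp only [NExp.eval, NExp.deg]
    have := h.2 b (a.eval s)
    exact mono a.one_le_deg (by simp; omega)

/-- A single inequality between `B` and the word bound excludes overflow in every expression of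
degree at most 8, which covers all expressions occurring in the programs. -/
theorem NExp.fits {B W : ℕ} {s : Store} (h : Bdd B s) (hW : (B + 100) ^ 8 ≤ W) (e : NExp)
    (he : e.deg ≤ 8) : e.Fits W s := by
  have key : ∀ e : NExp, e.deg ≤ 8 → e.eval s < W := fun e he =>
    (e.eval_lt h).trans_le ((Nat.pow_le_pow_right (by omega) he).trans hW)
  induction e with
  | const c => exact key _ he
  | reg i => exact key _ he
  | add a b iha ihb =>
    have h0 := key _ he
    simp only [NExp.deg] at he
    exact ⟨iha (by omega), ihb (by omega), h0⟩
  | sub a b iha ihb =>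
    simp only [NExp.deg] at he
    exact ⟨iha (by omega), ihb (by omega)⟩
  | mul a b iha ihb =>
    have h0 := key _ he
    simp only [NExp.deg] at he
    exact ⟨iha (by omega), ihb (by omega), h0⟩
  | div a b iha ihb =>
    simp only [NExp.deg] at he
    exact ⟨iha (by omega), ihb (by omega)⟩
  | load b a iha => exact ⟨iha he, key _ he⟩

theorem RExp.fits {B W : ℕ} {s : Store} (h : Bdd B s) (hW : (B + 100) ^ 8 ≤ W) (e : RExp)
    (he : e.deg ≤ 8) : e.Fits W s := by
  induction e with
  | zero => trivial
  | reg i => trivial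
  | add a b iha ihb =>
    simp only [RExp.deg] at he
    exact ⟨iha (by omega), ihb (by omega)⟩
  | sub a b iha ihb =>
    simp only [RExp.deg] at he
    exact ⟨iha (by omega), ihb (by omega)⟩
  | load b a => exact NExp.fits h hW a he

theorem Test.fits {B W : ℕ} {s : Store} (h : Bdd B s) (hW : (B + 100) ^ 8 ≤ W) (t : Test)
    (he : t.deg ≤ 8) : t.Fits W s := by
  cases t <;> simp only [Test.deg] at he
  · exact ⟨NExp.fits h hW _ (by omega), NExp.fits h hW _ (by omega)⟩
  · exact ⟨NExp.fits h hW _ (by omega), NExp.fits h hW _ (by omega)⟩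
  · exact ⟨RExp.fits h hW _ (by omega), RExp.fits h hW _ (by omega)⟩

/-! ### Loop-free programs -/

/-- Loop-free programs with expressions of small degree that do not write the input bank. -/
def Program.straight : Program → Bool
  | .skip => true
  | .set _ e => decide (e.deg ≤ 8)
  | .rset _ e => decide (e.deg ≤ 8)
  | .store b a e => decide (b ≠ .input) && (decide (a.deg ≤ 8) && decide (e.deg ≤ 8))
  | .rstore b a e => decide (b ≠ .input) && (decide (a.deg ≤ 8) && decide (e.deg ≤ 8))
  | .seq c d => c.straight && d.straight
  | .ite t c d => decide (t.deg ≤ 8) && (c.straight && d.straight)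
  | .loop _ _ => false

def Program.maxCost : Program → ℕ
  | .skip => 1
  | .set _ e => e.cost + 1
  | .rset _ e => e.cost + 1
  | .store _ a e => a.cost + e.cost + 1
  | .rstore _ a e => a.cost + e.cost + 1
  | .seq c d => c.maxCost + d.maxCost
  | .ite t c d => t.cost + max c.maxCost d.maxCost
  | .loop _ _ => 0

/-- Weakest preconditions of loop-free programs; all integers written must be at most `B`. -/
def Program.wp (B : ℕ) : Program → (Store → Prop) → Store → Prop
  | .skip, Q, s => Q s
  | .set i e, Q, s => e.eval s ≤ B ∧ Q (s.setReg i (e.eval s))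
  | .rset i e, Q, s => Q (s.setRReg i (e.eval s))
  | .store b a e, Q, s => e.eval s ≤ B ∧ Q (s.write b (a.eval s) (e.eval s))
  | .rstore b a e, Q, s => Q (s.rwrite b (a.eval s) (e.eval s))
  | .seq c d, Q, s => c.wp B (d.wp B Q) s
  | .ite t c d, Q, s => (t.Holds s → c.wp B Q s) ∧ (¬ t.Holds s → d.wp B Q s)
  | .loop _ _, _, _ => False

section wp

variable (B : ℕ) (Q : Store → Prop) (s : Store)

@[simp] theorem wp_skip : Program.skip.wp B Q s ↔ Q s := Iff.rfl
@[simp] theorem wp_set (i : ℕ) (e : NExp) :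
    (Program.set i e).wp B Q s ↔ e.eval s ≤ B ∧ Q (s.setReg i (e.eval s)) := Iff.rfl
@[simp] theorem wp_store (b : Bank) (a e : NExp) :
    (Program.store b a e).wp B Q s ↔
      e.eval s ≤ B ∧ Q (s.write b (a.eval s) (e.eval s)) := Iff.rfl
@[simp] theorem wp_rstore (b : Bank) (a : NExp) (e : RExp) :
    (Program.rstore b a e).wp B Q s ↔ Q (s.rwrite b (a.eval s) (e.eval s)) := Iff.rfl
@[simp] theorem wp_st (b : Bank) (k : ℕ) (i e : NExp) :
    (st b k i e).wp B Q s ↔ e.eval s ≤ B ∧ Q (s.wr b k (i.eval s) (e.eval s)) := Iff.rfl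
@[simp] theorem wp_rst (b : Bank) (k : ℕ) (i : NExp) (e : RExp) :
    (rst b k i e).wp B Q s ↔ Q (s.rwr b k (i.eval s) (e.eval s)) := Iff.rfl
@[simp] theorem wp_seq (c d : Program) : (c ;; d).wp B Q s ↔ c.wp B (d.wp B Q) s := Iff.rfl
@[simp] theorem wp_ite (t : Test) (c d : Program) :
    (Program.ite t c d).wp B Q s ↔
      (t.Holds s → c.wp B Q s) ∧ (¬ t.Holds s → d.wp B Q s) := Iff.rfl

end wp

theorem Bdd.setReg {B : ℕ} {s : Store} (h : Bdd B s) {i x : ℕ} (hx : x ≤ B) :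
    Bdd B (s.setReg i x) :=
  ⟨fun j => by rw [reg_setReg]; split_ifs; exacts [hx, h.1 j], h.2⟩

theorem Bdd.write {B : ℕ} {s : Store} (h : Bdd B s) {b : Bank} {i x : ℕ} (hx : x ≤ B) :
    Bdd B (s.write b i x) :=
  ⟨h.1, fun b' j => by rw [mem_write]; split_ifs; exacts [hx, h.2 b' j]⟩

/-- Started in `s`, the program halts within time `T` in a configuration satisfying `Q`, and all
integers remain at most `B`, for all sufficiently large word bounds. -/
def Runs (B : ℕ) (c : Program) (s : Store) (T : ℕ) (Q : Store → Prop) : Prop :=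
  ∀ W, (B + 100) ^ 8 ≤ W → Bdd B s → ∃ τ s', Exec W c s τ s' ∧ τ ≤ T ∧ Bdd B s' ∧ Q s'

/-- The integer obligations left by `Program.wp` concern only the values that are written;
evaluation itself is safe because `Program.straight` limits degrees. -/
theorem exec_of_wp {B W : ℕ} (hW : (B + 100) ^ 8 ≤ W) (c : Program) (hc : c.straight = true)
    (s : Store) (hs : Bdd B s) (Q : Store → Prop) (hQ : c.wp B Q s) :
    ∃ τ s', Exec W c s τ s' ∧ τ ≤ c.maxCost ∧ Bdd B s' ∧ Q s' := by
  induction c generalizing s Q with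
  | skip => exact ⟨_, _, .skip s, le_rfl, hs, hQ⟩
  | set i e =>
    simp only [Program.straight, decide_eq_true_eq] at hc
    exact ⟨_, _, .set s i e (e.fits hs hW hc), le_rfl, hs.setReg hQ.1, hQ.2⟩
  | rset i e =>
    simp only [Program.straight, decide_eq_true_eq] at hc
    exact ⟨_, _, .rset s i e (e.fits hs hW hc), le_rfl, ⟨hs.1, hs.2⟩, hQ⟩
  | store b a e =>
    simp only [Program.straight, Bool.and_eq_true, decide_eq_true_eq] at hc
    exact ⟨_, _, .store s b a e hc.1 (a.fits hs hW hc.2.1) (e.fits hs hW hc.2.2), le_rfl,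
      hs.write hQ.1, hQ.2⟩
  | rstore b a e =>
    simp only [Program.straight, Bool.and_eq_true, decide_eq_true_eq] at hc
    exact ⟨_, _, .rstore s b a e hc.1 (a.fits hs hW hc.2.1) (e.fits hs hW hc.2.2), le_rfl,
      ⟨hs.1, hs.2⟩, hQ⟩
  | seq c d ihc ihd =>
    simp only [Program.straight, Bool.and_eq_true] at hc
    obtain ⟨τ₁, s₁, h1, h2, h3, h4⟩ := ihc hc.1 s hs _ hQ
    obtain ⟨τ₂, s₂, k1, k2, k3, k4⟩ := ihd hc.2 s₁ h3 _ h4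
    exact ⟨_, _, .seq _ _ _ _ _ _ _ h1 k1, by simp only [Program.maxCost]; omega, k3, k4⟩
  | ite t c d ihc ihd =>
    simp only [Program.straight, Bool.and_eq_true, decide_eq_true_eq] at hc
    by_cases ht : t.Holds s
    · obtain ⟨τ, s', h1, h2, h3, h4⟩ := ihc hc.2.1 s hs _ (hQ.1 ht)
      exact ⟨_, _, .iteTrue t c d s s' τ (t.fits hs hW hc.1) ht h1,
        by simp only [Program.maxCost]; omega, h3, h4⟩
    · obtain ⟨τ, s', h1, h2, h3, h4⟩ := ihd hc.2.2 s hs _ (hQ.2 ht)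
      exact ⟨_, _, .iteFalse t c d s s' τ (t.fits hs hW hc.1) ht h1,
        by simp only [Program.maxCost]; omega, h3, h4⟩
  | loop t c => exact hQ.elim

/-! ### Frames -/

def Program.modReg : Program → ℕ → Bool
  | .set i _, j => i == j
  | .seq c d, j => c.modReg j || d.modReg j
  | .ite _ c d, j => c.modReg j || d.modReg j
  | .loop _ c, j => c.modReg j
  | _, _ => false

def Program.modRReg : Program → ℕ → Bool
  | .rset i _, j => i == j
  | .seq c d, j => c.modRReg j || d.modRReg j
  | .ite _ c d, j => c.modRReg j || d.modRReg j
  | .loop _ c, j => c.modRReg j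
  | _, _ => false

/-- Whether an address may belong to the `k`-th of the sixteen interleaved arrays. -/
def NExp.mayHit : NExp → ℕ → Bool
  | .add (.mul (.const 16) _) (.const k), k' => k % 16 == k'
  | _, _ => true

def Program.modArr : Program → Bank → ℕ → Bool
  | .store b a _, b', k => (b == b') && a.mayHit k
  | .seq c d, b', k => c.modArr b' k || d.modArr b' k
  | .ite _ c d, b', k => c.modArr b' k || d.modArr b' k
  | .loop _ c, b', k => c.modArr b' k
  | _, _, _ => false

def Program.modRArr : Program → Bank → ℕ → Bool
  | .rstore b a _, b', k => (b == b') && a.mayHit k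
  | .seq c d, b', k => c.modRArr b' k || d.modRArr b' k
  | .ite _ c d, b', k => c.modRArr b' k || d.modRArr b' k
  | .loop _ c, b', k => c.modRArr b' k
  | _, _, _ => false

/-- An address `16 * i + k` determines its array by its residue modulo 16; an address of any other
shape counts as hitting every array. -/
theorem NExp.mayHit_of_eq (a : NExp) (s : Store) (k i : ℕ) (hk : k < 16)
    (h : a.eval s = 16 * i + k) : a.mayHit k = true := by
  unfold NExp.mayHit
  split
  · simp only [NExp.eval] at h
    simp only [beq_iff_eq]
    omega
  · rfl

structure Frame (c : Program) (s s' : Store) : Prop where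
  reg' : ∀ i, c.modReg i = false → s'.reg i = s.reg i
  rreg' : ∀ i, c.modRReg i = false → s'.rreg i = s.rreg i
  arr' : ∀ b k i, k < 16 → c.modArr b k = false → s'.arr b k i = s.arr b k i
  rarr' : ∀ b k i, k < 16 → c.modRArr b k = false → s'.rarr b k i = s.rarr b k i

namespace Frame

variable {c d : Program} {s s' s'' : Store}

theorem reg (h : Frame c s s') (i : ℕ) (hc : c.modReg i = false := by rfl) :
    s'.reg i = s.reg i := h.reg' i hc
theorem arr (h : Frame c s s') (b : Bank) (k : ℕ) (hc : c.modArr b k = false := by rfl)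
    (hk : k < 16 := by norm_num) : s'.arr b k = s.arr b k := funext fun i => h.arr' b k i hk hc
theorem rarr (h : Frame c s s') (b : Bank) (k : ℕ) (hc : c.modRArr b k = false := by rfl)
    (hk : k < 16 := by norm_num) : s'.rarr b k = s.rarr b k :=
  funext fun i => h.rarr' b k i hk hc

theorem refl (c : Program) (s : Store) : Frame c s s :=
  ⟨fun _ _ => rfl, fun _ _ => rfl, fun _ _ _ _ _ => rfl, fun _ _ _ _ _ => rfl⟩

theorem trans (h : Frame c s s') (h' : Frame c s' s'') : Frame c s s'' :=
  ⟨fun i hi => (h'.1 i hi).trans (h.1 i hi), fun i hi => (h'.2 i hi).trans (h.2 i hi),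
    fun b k i hk hi => (h'.3 b k i hk hi).trans (h.3 b k i hk hi),
    fun b k i hk hi => (h'.4 b k i hk hi).trans (h.4 b k i hk hi)⟩

theorem mono (h : Frame c s s') (h1 : ∀ i, d.modReg i = false → c.modReg i = false)
    (h2 : ∀ i, d.modRReg i = false → c.modRReg i = false)
    (h3 : ∀ b i, d.modArr b i = false → c.modArr b i = false)
    (h4 : ∀ b i, d.modRArr b i = false → c.modRArr b i = false) : Frame d s s' :=
  ⟨fun i hi => h.1 i (h1 i hi), fun i hi => h.2 i (h2 i hi),
    fun b k i hk hi => h.3 b k i hk (h3 b k hi), fun b k i hk hi => h.4 b k i hk (h4 b k hi)⟩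

theorem seq_left (h : Frame c s s') (d : Program) : Frame (c ;; d) s s' := by
  refine h.mono ?_ ?_ ?_ ?_ <;>
    simp +contextual [Program.modReg, Program.modRReg, Program.modArr, Program.modRArr]

theorem seq_right (h : Frame d s s') (c : Program) : Frame (c ;; d) s s' := by
  refine h.mono ?_ ?_ ?_ ?_ <;>
    simp +contextual [Program.modReg, Program.modRReg, Program.modArr, Program.modRArr]

theorem loop (h : Frame c s s') (t : Test) : Frame (.loop t c) s s' := by
  refine h.mono ?_ ?_ ?_ ?_ <;>
    simp +contextual [Program.modReg, Program.modRReg, Program.modArr, Program.modRArr]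

end Frame

theorem Exec.frame {W : ℕ} {c : Program} {s s' : Store} {τ : ℕ} (h : Exec W c s τ s') :
    Frame c s s' := by
  induction h with
  | skip s => exact Frame.refl _ _
  | set s i e he =>
    refine ⟨fun j hj => ?_, fun _ _ => rfl, fun _ _ _ _ _ => rfl, fun _ _ _ _ _ => rfl⟩
    simp only [Program.modReg, beq_eq_false_iff_ne] at hj
    simp [Ne.symm hj]
  | rset s i e he =>
    refine ⟨fun _ _ => rfl, fun j hj => ?_, fun _ _ _ _ _ => rfl, fun _ _ _ _ _ => rfl⟩
    simp only [Program.modRReg, beq_eq_false_iff_ne] at hj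
    simp [Ne.symm hj]
  | store s b a e hb ha he =>
    refine ⟨fun _ _ => rfl, fun _ _ => rfl, fun b' k i hk h => ?_, fun _ _ _ _ _ => rfl⟩
    unfold Store.arr
    rw [mem_write, if_neg]
    rintro ⟨rfl, h2⟩
    simp [Program.modArr, NExp.mayHit_of_eq a s k i hk h2.symm] at h
  | rstore s b a e hb ha he =>
    refine ⟨fun _ _ => rfl, fun _ _ => rfl, fun _ _ _ _ _ => rfl, fun b' k i hk h => ?_⟩
    unfold Store.rarr Store.rwrite
    by_cases hbb : b' = b
    · subst hbb
      simp only [Function.update_self]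
      rw [Function.update_of_ne]
      intro h2
      simp [Program.modRArr, NExp.mayHit_of_eq a s k i hk h2.symm] at h
    · simp [hbb]
  | seq c d s s₁ s₂ τ₁ τ₂ hc hd ihc ihd => exact (ihc.seq_left d).trans (ihd.seq_right c)
  | iteTrue t c d s s₁ τ hf ht hc ih =>
    refine ih.mono ?_ ?_ ?_ ?_ <;>
      simp +contextual [Program.modReg, Program.modRReg, Program.modArr, Program.modRArr]
  | iteFalse t c d s s₁ τ hf ht hc ih =>
    refine ih.mono ?_ ?_ ?_ ?_ <;>
      simp +contextual [Program.modReg, Program.modRReg, Program.modArr, Program.modRArr]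
  | loopTrue t c s s₁ s₂ τ₁ τ₂ hf ht hc hl ihc ihl => exact (ihc.loop t).trans ihl
  | loopFalse t c s hf ht => exact Frame.refl _ _

/-! ### Rules -/

namespace Runs

variable {B T : ℕ} {c d : Program} {s : Store} {Q : Store → Prop}

theorem straight (hc : c.straight = true) (hT : c.maxCost ≤ T) (h : c.wp B Q s) :
    Runs B c s T Q := fun _ hW hs =>
  let ⟨τ, s', h1, h2, h3⟩ := exec_of_wp hW c hc s hs Q h
  ⟨τ, s', h1, h2.trans hT, h3⟩

theorem mono {T' : ℕ} {Q' : Store → Prop} (h : Runs B c s T Q) (hT : T ≤ T')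
    (hQ : ∀ s', Frame c s s' → Bdd B s' → Q s' → Q' s') : Runs B c s T' Q' := fun W hW hs =>
  let ⟨τ, s', h1, h2, h3, h4⟩ := h W hW hs
  ⟨τ, s', h1, h2.trans hT, h3, hQ s' h1.frame h3 h4⟩

theorem bdd (h : Bdd B s → Runs B c s T Q) : Runs B c s T Q := fun W hW hs => h hs W hW hs

theorem seq (T₁ T₂ : ℕ) (Q₁ : Store → Prop) (h : Runs B c s T₁ Q₁) (hT : T₁ + T₂ ≤ T)
    (h' : ∀ s₁, Frame c s s₁ → Bdd B s₁ → Q₁ s₁ → Runs B d s₁ T₂ Q) :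
    Runs B (c ;; d) s T Q := fun W hW hs =>
  let ⟨_, s₁, h1, h2, h3, h4⟩ := h W hW hs
  let ⟨_, s₂, k1, k2, k3, k4⟩ := h' s₁ h1.frame h3 h4 W hW h3
  ⟨_, s₂, .seq _ _ _ _ _ _ _ h1 k1, by omega, k3, k4⟩

theorem loop {t : Test} (Inv : ℕ → Store → Prop) (ht : t.deg ≤ 8) (h0 : Inv T s)
    (step : ∀ T' s', Frame c s s' → Bdd B s' → Inv T' s' →
      (t.Holds s' → ∃ T₁ T₂, t.cost + T₁ + T₂ ≤ T' ∧ Runs B c s' T₁ (Inv T₂)) ∧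
      (¬ t.Holds s' → t.cost ≤ T' ∧ Q s')) :
    Runs B (.loop t c) s T Q := by
  intro W hW hs
  have main : ∀ T' s', Frame c s s' → Bdd B s' → Inv T' s' →
      ∃ τ s'', Exec W (.loop t c) s' τ s'' ∧ τ ≤ T' ∧ Bdd B s'' ∧ Q s'' := by
    intro T'
    induction T' using Nat.strong_induction_on with
    | _ T' ih =>
      intro s' hf hb hI
      obtain ⟨h1, h2⟩ := step T' s' hf hb hI
      by_cases hts : t.Holds s'
      · obtain ⟨T₁, T₂, hT, hr⟩ := h1 hts
        obtain ⟨τ₁, s₁, a1, a2, a3, a4⟩ := hr W hW hb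
        have hpos : 0 < t.cost := by cases t <;> simp [Test.cost]
        obtain ⟨τ₂, s₂, b1, b2, b3⟩ := ih T₂ (by omega) s₁ (hf.trans a1.frame) a3 a4
        exact ⟨_, s₂, .loopTrue _ _ _ _ _ _ _ (t.fits hb hW ht) hts a1 b1, by omega, b3⟩
      · obtain ⟨k1, k2⟩ := h2 hts
        exact ⟨_, s', .loopFalse _ _ _ (t.fits hb hW ht) hts, k1, hb, k2⟩
  exact main T s (Frame.refl _ _) hs h0

end Runs

/-- Run the body with register `i` equal to `0, …, reg j - 1`. -/
def forTo (i j : ℕ) (c : Program) : Program :=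
  .set i 0 ;; .loop (.lt (.reg i) (.reg j)) (c ;; .set i (.reg i + 1))

/-- A round costs `T` for the body, 3 for the test and 4 for the increment; the remaining slack in
`T + 8` and `+ 8` absorbs initialization and the last test. The invariant is required after the
increment, which is why the counter is set in the postcondition of the body. -/
theorem Runs.forTo {B : ℕ} {c : Program} {s : Store} {Q : Store → Prop} {i j : ℕ}
    (N T T' : ℕ) (Inv : ℕ → Store → Prop) (hN : s.reg j = N)
    (hij : (i == j) = false) (hi : c.modReg i = false) (hj : c.modReg j = false)
    (hT' : N * (T + 8) + 8 ≤ T')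
    (h0 : Inv 0 (s.setReg i 0))
    (step : ∀ a s', a < N → s'.reg i = a → s'.reg j = N → Frame (forTo i j c) s s' → Bdd B s' →
      Inv a s' → Runs B c s' T (fun s'' => Inv (a + 1) (s''.setReg i (a + 1))))
    (hQ : ∀ s', s'.reg i = N → Inv N s' → Q s') :
    Runs B (PathOracle.forTo i j c) s T' Q := by
  have hij' : i ≠ j := by simpa using hij
  apply Runs.bdd
  intro hs
  have hNB : N ≤ B := hN ▸ hs.1 j
  have hf0 : Frame (PathOracle.forTo i j c) s (s.setReg i 0) := by
    refine ⟨fun l hl => ?_, fun _ _ => rfl, fun _ _ _ _ _ => rfl, fun _ _ _ _ _ => rfl⟩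
    simp only [PathOracle.forTo, Program.modReg, Bool.or_eq_false_iff, beq_eq_false_iff_ne] at hl
    simp [Ne.symm hl.1]
  refine Runs.seq 2 (N * (T + 7) + 3)
    (fun s' => s' = s.setReg i 0) (.straight rfl le_rfl ?_) ?_ ?_
  · simp
  · nlinarith
  rintro _ - hb0 rfl
  refine Runs.loop (fun T' s' => ∃ a, a ≤ N ∧ s'.reg i = a ∧ (N - a) * (T + 7) + 3 ≤ T' ∧
    Inv a s') (by simp [Test.deg, NExp.deg]) ⟨0, by omega, by simp, by simp, h0⟩ ?_
  rintro T'' s' hf hb ⟨a, ha, hia, hTa, hI⟩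
  have hf' : Frame (PathOracle.forTo i j c) s s' :=
    hf0.trans ((hf.loop _).seq_right _)
  have hjN : s'.reg j = N := by
    have := hf.reg j (by simp [Program.modReg, hj, hij'])
    rw [this]; simp [Ne.symm hij', hN]
  constructor
  · intro ht
    simp only [holds_lt, eval_reg, hia, hjN] at ht
    refine ⟨T + 4, (N - (a + 1)) * (T + 7) + 3, ?_, ?_⟩
    · have : N - a = (N - (a + 1)) + 1 := by omega
      rw [this] at hTa
      simp only [Test.cost, NExp.cost]
      nlinarith
    · refine Runs.seq T 4 _ (step a s' ht hia hjN hf' hb hI) le_rfl ?_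
      intro s₁ hf1 hb1 hI1
      have : s₁.reg i = a := (hf1.reg i hi).trans hia
      refine .straight rfl le_rfl ?_
      simp only [wp_set, eval_add, eval_reg, this, eval_ofNat]
      exact ⟨by omega, a + 1, ht, by simp, le_rfl, hI1⟩
  · intro ht
    simp only [holds_lt, eval_reg, hia, hjN] at ht
    have : a = N := by omega
    subst this
    exact ⟨by simp only [Test.cost, NExp.cost]; omega, hQ s' hia hI⟩

/-! ### The instance as it is seen by the machine -/

/-- A graph with marked tree edges, given by arrays of endpoints, tree marks and weights. -/
structure Inst where
  n : ℕ
  m : ℕ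
  r : ℕ
  f : ℕ
  eu : ℕ → ℕ
  ev : ℕ → ℕ
  tr : ℕ → ℕ
  wt : ℕ → ℝ

namespace Inst

/-- The edge `e` joins `x` and `y`. -/
def Joins (g : Inst) (e x y : ℕ) : Prop :=
  (g.eu e = x ∧ g.ev e = y) ∨ (g.eu e = y ∧ g.ev e = x)

theorem Joins.symm {g : Inst} {e x y : ℕ} (h : g.Joins e x y) : g.Joins e y x := Or.symm h

structure Valid (g : Inst) : Prop where
  r_lt : g.r < g.n
  f_pos : 1 ≤ g.f
  eu_lt : ∀ e < g.m, g.eu e < g.n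
  ev_lt : ∀ e < g.m, g.ev e < g.n
  ne : ∀ e < g.m, g.eu e ≠ g.ev e
  wt_nonneg : ∀ e, 0 ≤ g.wt e
  n_le : g.n ≤ g.m + 1
  conn : ∀ S : ℕ → Prop, S g.r → (∀ e < g.m, g.tr e = 1 → (S (g.eu e) ↔ S (g.ev e))) →
    ∀ u < g.n, S u

theorem Valid.joins_lt {g : Inst} (hg : g.Valid) {e x y : ℕ} (he : e < g.m)
    (h : g.Joins e x y) : x < g.n ∧ y < g.n := by
  have h1 := hg.eu_lt e he
  have h2 := hg.ev_lt e he
  rcases h with ⟨rfl, rfl⟩ | ⟨rfl, rfl⟩ <;> constructor <;> assumption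

end Inst

/-- The registers and arrays that hold the instance. -/
structure Holds (g : Inst) (s : Store) : Prop where
  n : s.reg 0 = g.n
  m : s.reg 1 = g.m
  r : s.reg 2 = g.r
  f : s.reg 3 = g.f
  eu : s.arr .work 0 = g.eu
  ev : s.arr .work 1 = g.ev
  tr : s.arr .work 2 = g.tr
  wt : s.rarr .work 0 = g.wt

theorem Holds.frame {g : Inst} {s s' : Store} {c : Program} (h : Holds g s) (fr : Frame c s s')
    (h0 : c.modReg 0 = false := by rfl) (h1 : c.modReg 1 = false := by rfl)
    (h2 : c.modReg 2 = false := by rfl) (h3 : c.modReg 3 = false := by rfl)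
    (h4 : c.modArr .work 0 = false := by rfl) (h5 : c.modArr .work 1 = false := by rfl)
    (h6 : c.modArr .work 2 = false := by rfl) (h7 : c.modRArr .work 0 = false := by rfl) :
    Holds g s' :=
  ⟨(fr.reg 0 h0).trans h.n, (fr.reg 1 h1).trans h.m, (fr.reg 2 h2).trans h.r,
    (fr.reg 3 h3).trans h.f, (fr.arr .work 0 h4).trans h.eu, (fr.arr .work 1 h5).trans h.ev,
    (fr.arr .work 2 h6).trans h.tr, (fr.rarr .work 0 h7).trans h.wt⟩

/-! ### Copying the input -/

def copyBody : Program :=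
  st .work 0 (rg 5) (.load .input (3 * rg 5)) ;;
  st .work 1 (rg 5) (.load .input (3 * rg 5 + 1)) ;;
  st .work 2 (rg 5) (.load .input (3 * rg 5 + 2)) ;;
  rst .work 0 (rg 5) (.load .input (rg 5))

def copyInput : Program := forTo 5 1 copyBody

theorem copyInput_spec {B : ℕ} {g : Inst} {s : Store} (h0 : s.reg 0 = g.n) (h1 : s.reg 1 = g.m)
    (h2 : s.reg 2 = g.r) (h3 : s.reg 3 = g.f)
    (ha : ∀ k i, s.arr .work k i = 0) (hra : ∀ k i, s.rarr .work k i = 0)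
    (heu : ∀ i, g.eu i = if i < g.m then s.mem .input (3 * i) else 0)
    (hev : ∀ i, g.ev i = if i < g.m then s.mem .input (3 * i + 1) else 0)
    (htr : ∀ i, g.tr i = if i < g.m then s.mem .input (3 * i + 2) else 0)
    (hwt : ∀ i, g.wt i = if i < g.m then s.rmem .input i else 0) :
    Runs B copyInput s (g.m * 100 + 8) (Holds g) := by
  refine (Runs.forTo (Q := fun s' => s'.arr .work 0 = g.eu ∧ s'.arr .work 1 = g.ev ∧
      s'.arr .work 2 = g.tr ∧ s'.rarr .work 0 = g.wt) g.m 92 _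
    (fun a s' => s'.mem .input = s.mem .input ∧ s'.rmem .input = s.rmem .input ∧
      (∀ i, s'.arr .work 0 i = if i < a then s.mem .input (3 * i) else 0) ∧
      (∀ i, s'.arr .work 1 i = if i < a then s.mem .input (3 * i + 1) else 0) ∧
      (∀ i, s'.arr .work 2 i = if i < a then s.mem .input (3 * i + 2) else 0) ∧
      (∀ i, s'.rarr .work 0 i = if i < a then s.rmem .input i else 0))
    h1 rfl rfl rfl le_rfl ?_ ?_ ?_).mono le_rfl ?_
  · simp [ha, hra]
  · rintro a s' ha hia - - hB ⟨i1, i2, i3, i4, i5, i6⟩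
    refine .straight rfl (by decide) ?_
    have e1 : ∀ (s : Store) a, (NExp.load .input a).eval s = s.mem .input (a.eval s) :=
      fun _ _ => rfl
    have e2 : ∀ (s : Store) a, (RExp.load .input a).eval s = s.rmem .input (a.eval s) :=
      fun _ _ => rfl
    have e3 : ∀ (s : Store) k i x, (s.wr .work k i x).mem .input = s.mem .input := by
      intro s k i x; funext j; simp [Store.wr, mem_write]
    have e4 : ∀ (s : Store) k i x, (s.rwr .work k i x).rmem .input = s.rmem .input := by
      intro s k i x; simp [Store.rwr, Store.rwrite]
    simp only [copyBody, wp_seq, wp_st, wp_rst, e1, e2, e3, reg_wr, rmem_wr, eval_mul,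
      eval_add, eval_reg, eval_ofNat, hia, i1, i2]
    have b : ∀ j, s.mem .input j ≤ B := fun j => i1 ▸ hB.2 .input j
    refine ⟨b _, b _, b _, ?_⟩
    simp only [mem_setReg, rmem_setReg, arr_setReg, rarr_setReg, mem_rwr, e3, e4, rmem_wr, i1, i2,
      arr_rwr, true_and]
    refine ⟨fun i => ?_, fun i => ?_, fun i => ?_, fun i => ?_⟩
    all_goals
      simp [i3, i4, i5, i6]
      split_ifs <;> first | rfl | (exfalso; omega) | (subst_vars; rfl)
  · rintro s' - ⟨-, -, i3, i4, i5, i6⟩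
    refine ⟨funext fun i => ?_, funext fun i => ?_, funext fun i => ?_, funext fun i => ?_⟩
    · rw [i3, heu]
    · rw [i4, hev]
    · rw [i5, htr]
    · rw [i6, hwt]
  · rintro s' fr - ⟨e1, e2, e3, e4⟩
    exact ⟨(fr.reg 0).trans h0, (fr.reg 1).trans h1, (fr.reg 2).trans h2, (fr.reg 3).trans h3,
      e1, e2, e3, e4⟩

/-! ### Searching the tree from the root -/

/-- The first `cnt` vertices of `ord` are the vertices found so far; every one but the root hangs
from an earlier one by a tree edge. -/
structure Found (g : Inst) (cnt : ℕ) (ord vis par dep : ℕ → ℕ) (dist : ℕ → ℝ) : Prop where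
  pos : 0 < cnt
  lt : ∀ q < cnt, ord q < g.n
  vis_iff : ∀ u, vis u ≠ 0 ↔ ∃ q < cnt, ord q = u
  inj : ∀ q < cnt, ∀ q' < cnt, ord q = ord q' → q = q'
  ord_zero : ord 0 = g.r
  par_root : par g.r = g.r
  dep_root : dep g.r = 0
  dist_root : dist g.r = 0
  step : ∀ q < cnt, 0 < q → ∃ q' < q, par (ord q) = ord q' ∧ dep (ord q) = dep (ord q') + 1 ∧
    dep (ord q) ≤ q ∧
    ∃ e < g.m, g.tr e = 1 ∧ g.Joins e (ord q') (ord q) ∧ dist (ord q) = dist (ord q') + g.wt e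
  out : ∀ u, g.n ≤ u → par u = 0 ∧ dep u = 0 ∧ dist u = 0

namespace Found

variable {g : Inst} {cnt : ℕ} {ord vis par dep : ℕ → ℕ} {dist : ℕ → ℝ}

theorem cnt_le (h : Found g cnt ord vis par dep dist) : cnt ≤ g.n := by
  have := Finset.card_le_card_of_injOn (s := Finset.range cnt) (t := Finset.range g.n) ord
    (fun q hq => by simpa using h.lt q (by simpa using hq))
    (fun q hq q' hq' => h.inj q (by simpa using hq) q' (by simpa using hq'))
  simpa using this

theorem dep_le (h : Found g cnt ord vis par dep dist) {q : ℕ} (hq : q < cnt) :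
    dep (ord q) ≤ q := by
  rcases Nat.eq_zero_or_pos q with rfl | h0
  · rw [h.ord_zero, h.dep_root]
  · obtain ⟨_, _, _, _, h1, _⟩ := h.step q hq h0
    exact h1

/-- The new vertex `x` is unvisited, hence different from all listed ones, so updates at `x` leave
their data intact. Its depth stays below its position because the parent stands earlier. -/
theorem discover (hg : g.Valid) (h : Found g cnt ord vis par dep dist) {q e x : ℕ}
    (hq : q < cnt) (he : e < g.m) (ht : g.tr e = 1) (hj : g.Joins e (ord q) x) (hx : vis x = 0)
    {ord' vis' par' dep' : ℕ → ℕ} {dist' : ℕ → ℝ}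
    (h1 : ∀ j, ord' j = if j = cnt then x else ord j)
    (h2 : ∀ j, vis' j = if j = x then 1 else vis j)
    (h3 : ∀ j, par' j = if j = x then ord q else par j)
    (h4 : ∀ j, dep' j = if j = x then dep (ord q) + 1 else dep j)
    (h5 : ∀ j, dist' j = if j = x then dist (ord q) + g.wt e else dist j) :
    Found g (cnt + 1) ord' vis' par' dep' dist' := by
  have hne : ∀ q' < cnt, ord q' ≠ x := fun q' hq' hc => (h.vis_iff x).2 ⟨q', hq', hc⟩ hx
  have hr : g.r ≠ x := h.ord_zero ▸ hne 0 h.pos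
  have ho : ∀ q' < cnt, ord' q' = ord q' := fun q' hq' => by rw [h1, if_neg (by omega)]
  have hoc : ord' cnt = x := by rw [h1, if_pos rfl]
  have hcase : ∀ q', q' < cnt + 1 → q' = cnt ∨ q' < cnt := by omega
  refine ⟨by omega, fun q' hq' => ?_, fun u => ?_, fun a ha b hb hab => ?_, ?_, ?_, ?_, ?_,
    fun q' hq' h0 => ?_, fun u hu => ?_⟩
  · rcases hcase q' hq' with rfl | hq'
    · rw [hoc]; exact (hg.joins_lt he hj).2
    · rw [ho q' hq']; exact h.lt q' hq'
  · rw [h2]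
    split_ifs with hu
    · simp only [ne_eq, one_ne_zero, not_false_eq_true, true_iff]
      exact ⟨cnt, by omega, by rw [hoc, hu]⟩
    · rw [h.vis_iff]
      constructor
      · rintro ⟨a, ha, rfl⟩; exact ⟨a, by omega, ho a ha⟩
      · rintro ⟨a, ha, rfl⟩
        rcases hcase a ha with rfl | ha
        · exact absurd hoc hu
        · exact ⟨a, ha, (ho a ha).symm⟩
  · rcases hcase a ha with rfl | ha <;> rcases hcase b hb with rfl | hb
    · rfl
    · rw [hoc, ho b hb] at hab; exact absurd hab.symm (hne b hb)
    · rw [hoc, ho a ha] at hab; exact absurd hab (hne a ha)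
    · rw [ho a ha, ho b hb] at hab; exact h.inj a ha b hb hab
  · rw [ho 0 h.pos, h.ord_zero]
  · rw [h3, if_neg hr, h.par_root]
  · rw [h4, if_neg hr, h.dep_root]
  · rw [h5, if_neg hr, h.dist_root]
  · rcases hcase q' hq' with rfl | hq'
    · have := h.dep_le hq
      refine ⟨q, hq, ?_⟩
      rw [hoc, ho q hq, h3, h4, h4, h5, h5, if_pos rfl, if_pos rfl, if_pos rfl, if_neg (hne q hq),
        if_neg (hne q hq)]
      exact ⟨rfl, rfl, by omega, e, he, ht, hj, rfl⟩
    · obtain ⟨a, ha, k1, k2, k3, e', he', k4, k5, k6⟩ := h.step q' hq' h0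
      have hac : a < cnt := by omega
      refine ⟨a, ha, ?_⟩
      rw [ho q' hq', ho a hac, h3, h4, h4, h5, h5, if_neg (hne q' hq'), if_neg (hne q' hq'),
        if_neg (hne q' hq'), if_neg (hne a hac), if_neg (hne a hac)]
      exact ⟨k1, k2, k3, e', he', k4, k5, k6⟩
  · have := (hg.joins_lt he hj).2
    rw [h3, h4, h5, if_neg (by omega), if_neg (by omega), if_neg (by omega)]
    exact h.out u hu

end Found

/-- Parents, depths and distances live in the output bank because they are part of the oracle; the
order and the visit marks are scratch data. -/
abbrev FoundIn (g : Inst) (s : Store) (cnt : ℕ) : Prop :=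
  Found g cnt (s.arr .work 3) (s.arr .work 4) (s.arr .output 1) (s.arr .output 2)
    (s.rarr .output 0)

/-- Register 10 defaults to the scanned vertex itself. That vertex is already visited, so an
unmarked or non-incident edge has no effect. -/
def bfsBody : Program :=
  .set 10 (rg 8) ;;
  .ite (.eq (ld .work 2 (rg 9)) 1)
    (.ite (.eq (ld .work 0 (rg 9)) (rg 8)) (.set 10 (ld .work 1 (rg 9)))
      (.ite (.eq (ld .work 1 (rg 9)) (rg 8)) (.set 10 (ld .work 0 (rg 9))) .skip)) .skip ;;
  .ite (.eq (ld .work 4 (rg 10)) 0)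
    (st .work 4 (rg 10) 1 ;;
      st .work 3 (rg 6) (rg 10) ;;
      .set 6 (rg 6 + 1) ;;
      st .output 1 (rg 10) (rg 8) ;;
      st .output 2 (rg 10) (ld .output 2 (rg 8) + 1) ;;
      rst .output 0 (rg 10) (rld .output 0 (rg 8) + rld .work 0 (rg 9))) .skip

def bfsScan : Program :=
  .set 8 (ld .work 3 (rg 7)) ;; forTo 9 1 bfsBody ;; .set 7 (rg 7 + 1)

def bfsInit : Program :=
  st .work 3 0 (rg 2) ;; st .work 4 (rg 2) 1 ;; st .output 1 (rg 2) (rg 2) ;;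
  .set 6 1 ;; .set 7 0

def bfs : Program := bfsInit ;; .loop (.lt (rg 7) (rg 6)) bfsScan

structure BfsStep (g : Inst) (cnt q e : ℕ) (s s' : Store) : Prop where
  le : cnt ≤ s'.reg 6
  found : FoundIn g s' (s'.reg 6)
  ord : ∀ a < cnt, s'.arr .work 3 a = s.arr .work 3 a
  vis : ∀ u, s.arr .work 4 u ≠ 0 → s'.arr .work 4 u ≠ 0
  nbr : g.tr e = 1 → ∀ y, g.Joins e (s.arr .work 3 q) y → s'.arr .work 4 y ≠ 0

theorem bfsBody_spec {B : ℕ} {g : Inst} (hg : g.Valid) (hB : g.n + 1 ≤ B) {s : Store}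
    (hs : Holds g s) {cnt q e : ℕ} (h6 : s.reg 6 = cnt) (h8 : s.reg 8 = s.arr .work 3 q)
    (hq : q < cnt) (h9 : s.reg 9 = e) (he : e < g.m) (hf : FoundIn g s cnt) :
    Runs B bfsBody s 100 (BfsStep g cnt q e s) := by
  have hu : s.arr .work 4 (s.arr .work 3 q) ≠ 0 := (hf.vis_iff _).2 ⟨q, hq, rfl⟩
  have hn : s.arr .work 3 q < g.n := hf.lt q hq
  have hd : s.arr .output 2 (s.arr .work 3 q) ≤ q := hf.dep_le hq
  have hc := hf.cnt_le
  have h1 := hg.eu_lt e he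
  have h2 := hg.ev_lt e he
  have hnee := hg.ne e he
  have fin : ∀ x, g.tr e = 1 → g.Joins e (s.arr .work 3 q) x →
      (∀ y, g.Joins e (s.arr .work 3 q) y → y = x) →
      (Program.ite (.eq (ld .work 4 (rg 10)) 0)
        (st .work 4 (rg 10) 1 ;;
          st .work 3 (rg 6) (rg 10) ;;
          .set 6 (rg 6 + 1) ;;
          st .output 1 (rg 10) (rg 8) ;;
          st .output 2 (rg 10) (ld .output 2 (rg 8) + 1) ;;
          rst .output 0 (rg 10) (rld .output 0 (rg 8) + rld .work 0 (rg 9))) .skip).wp B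
      (BfsStep g cnt q e s)
      ((s.setReg 10 (s.arr .work 3 q)).setReg 10 x) := by
    intro x ht hj hy
    have hx := (hg.joins_lt he hj).2
    have hxe : s.arr .work 4 x = 0 → x ≠ s.arr .work 3 q := fun h h' => hu (h' ▸ h)
    simp [h6, h8, h9, hs.wt]
    constructor
    · intro hv
      have hxne := hxe hv
      refine ⟨by omega, by omega, by omega, by omega, by omega, ?_⟩
      constructor
      · simp
      · simp
        apply hf.discover hg hq he ht hj hv <;> intro j <;> simp
      · intro a ha; simp; omega
      · intro u h1; simp; split_ifs <;> simp_all
      · intro _ y hyy; simp [hy y hyy]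
    · intro hv
      exact ⟨by simp [h6], by simpa [h6, FoundIn] using hf, by simp, by simp,
        fun _ y hyy => by simp [hy y hyy, hv]⟩
  have triv : (g.tr e = 1 → ∀ y, ¬ g.Joins e (s.arr .work 3 q) y) →
      BfsStep g cnt q e s (s.setReg 10 (s.arr .work 3 q)) := fun h =>
    ⟨by simp [h6], by simpa [h6, FoundIn] using hf, by simp, by simp, fun h1 y h2 => absurd h2 (h h1 y)⟩
  refine .straight rfl (by decide) ?_
  unfold bfsBody
  simp only [wp_seq, wp_set, wp_ite (t := .eq (ld .work 2 (rg 9)) 1),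
    wp_ite (t := .eq (ld .work 0 (rg 9)) (rg 8)), wp_ite (t := .eq (ld .work 1 (rg 9)) (rg 8)),
    wp_skip, holds_eq, eval_ld, eval_reg, eval_ofNat, arr_setReg,
    reg_setReg, h8, h9, hs.tr, hs.eu, hs.ev, Nat.reduceEqDiff, if_false]
  refine ⟨by omega, fun ht => ⟨fun hx => ⟨by omega, ?_⟩, fun hx => ⟨fun hx' => ⟨by omega, ?_⟩,
    fun hx' => ?_⟩⟩, fun ht => ?_⟩
  · exact fin _ ht (.inl ⟨hx, rfl⟩) (by unfold Inst.Joins; intro y; omega)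
  · exact fin _ ht (.inr ⟨rfl, hx'⟩) (by unfold Inst.Joins; intro y; omega)
  · have := triv (fun _ y => by unfold Inst.Joins; omega)
    simpa [hu] using this
  · have := triv (fun h => absurd h ht)
    simpa [hu] using this

theorem bfsScan_spec {B : ℕ} {g : Inst} (hg : g.Valid) (hB : g.n + 1 ≤ B) {s : Store}
    (hs : Holds g s) {cnt q : ℕ} (h6 : s.reg 6 = cnt) (h7 : s.reg 7 = q)
    (hq : q < cnt) (hf : FoundIn g s cnt) 
    (hcl : ∀ a < q, ∀ e < g.m, g.tr e = 1 → ∀ y, g.Joins e (s.arr .work 3 a) y →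
      s.arr .work 4 y ≠ 0) :
    Runs B bfsScan s (g.m * 108 + 30) (fun s' => ∃ cnt', cnt ≤ cnt' ∧ s'.reg 6 = cnt' ∧
      s'.reg 7 = q + 1 ∧ FoundIn g s' cnt' ∧
      (∀ a < q + 1, ∀ e < g.m, g.tr e = 1 → ∀ y, g.Joins e (s'.arr .work 3 a) y →
      s'.arr .work 4 y ≠ 0)) := by
  have hn : s.arr .work 3 q < g.n := hf.lt q hq
  refine .seq 10 (g.m * 108 + 20) (fun s' => s' = s.setReg 8 (s.arr .work 3 q))
    (.straight rfl (by decide) (by simp [h7]; omega)) (by omega) ?_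
  rintro _ fr - rfl
  have hs1 := hs.frame fr
  refine .seq (g.m * 108 + 8) 4 _ (Runs.forTo (Q := fun s' => ∃ cnt', cnt ≤ cnt' ∧
      s'.reg 6 = cnt' ∧ s'.reg 7 = q ∧ FoundIn g s' cnt' ∧
      (∀ a < q + 1, ∀ e < g.m, g.tr e = 1 → ∀ y, g.Joins e (s'.arr .work 3 a) y →
      s'.arr .work 4 y ≠ 0)) g.m 100 _
    (fun k s' => ∃ cnt', cnt ≤ cnt' ∧ s'.reg 6 = cnt' ∧ FoundIn g s' cnt' ∧
      s'.reg 7 = q ∧ s'.reg 8 = s'.arr .work 3 q ∧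
      (∀ a ≤ q, ∀ e < g.m, a < q ∨ e < k → g.tr e = 1 → ∀ y, g.Joins e (s'.arr .work 3 a) y →
      s'.arr .work 4 y ≠ 0))
    hs1.m rfl rfl rfl le_rfl ?_ ?_ ?_) (by omega) ?_
  · refine ⟨cnt, le_rfl, by simpa using h6, hf, by simpa using h7, by simp, ?_⟩
    intro a ha e he ho
    exact hcl a (by omega) e he
  · rintro e s' he h9 - fr' hB' ⟨cnt', hc', k6, kf, k7, k8, kcl⟩
    refine (bfsBody_spec hg hB (hs1.frame fr') k6 k8 (by omega) h9 he kf).mono le_rfl ?_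
    rintro s'' fr'' - ⟨hc'', lf, lo, lv, le⟩
    refine ⟨s''.reg 6, by omega, by simp, lf, ?_, ?_, ?_⟩
    · simpa using (fr''.reg 7).trans k7
    · simp only [reg_setReg, arr_setReg, Nat.reduceEqDiff, if_false]
      rw [fr''.reg 8, k8, lo q (by omega)]
    · intro a ha e' he' ho ht y hy
      simp only [arr_setReg] at hy ⊢
      rw [lo a (by omega)] at hy
      by_cases hc : a < q ∨ e' < e
      · exact lv _ (kcl a ha e' he' hc ht y hy)
      · have : a = q ∧ e' = e := by omega
        obtain ⟨rfl, rfl⟩ := this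
        exact le ht y hy
  · rintro s' - ⟨cnt', hc', k6, kf, k7, k8, kcl⟩
    exact ⟨cnt', hc', k6, k7, kf, fun a ha e he => kcl a (by omega) e he (.inr he)⟩
  · rintro s' - - ⟨cnt', hc', k6, k7, kf, kcl⟩
    have := kf.cnt_le
    refine .straight rfl (by decide) ?_
    simp only [wp_set, eval_add, eval_reg, eval_ofNat, k7]
    exact ⟨by omega, cnt', hc', by simpa using k6, by simp, kf, kcl⟩

structure BfsStart (g : Inst) (s : Store) : Prop where
  cnt : s.reg 6 = 1
  pos : s.reg 7 = 0
  found : FoundIn g s 1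

/-- When the queue is exhausted, the visited set contains the root and is closed under tree edges,
so it is everything. Every vertex is scanned once against the whole edge list, which costs `O(n m)`
and needs no adjacency lists. -/
theorem bfs_spec {B : ℕ} {g : Inst} (hg : g.Valid) (hB : g.n + 1 ≤ B) {s : Store}
    (hs : Holds g s) (hv : ∀ u, s.arr .work 4 u = 0) (hp : ∀ u, s.arr .output 1 u = 0)
    (hd : ∀ u, s.arr .output 2 u = 0) (hdi : ∀ u, s.rarr .output 0 u = 0) :
    Runs B bfs s (g.n * (g.m * 108 + 40) + 100) (fun s' => FoundIn g s' g.n) := by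
  have hr := hg.r_lt
  have key : Runs B bfsInit s 60 (BfsStart g) := by
    refine .straight rfl (by decide) ?_
    simp only [bfsInit, wp_seq, wp_st, wp_set, eval_reg, eval_ofNat, reg_wr, hs.r]
    refine ⟨by omega, by omega, by omega, by omega, by omega, by simp, by simp, ?_⟩
    constructor
    all_goals simp [hv, hd, hdi, hp]
    all_goals first | exact hr | exact fun u => eq_comm | (intros; omega)
  refine .seq 60 (g.n * (g.m * 108 + 40) + 10) _ key (by omega) ?_
  intro s1 fr1 _ ⟨h6, h7, hf⟩
  have hs := hs.frame fr1
  refine .loop (fun T s' => ∃ q cnt, q ≤ cnt ∧ s'.reg 6 = cnt ∧ s'.reg 7 = q ∧ FoundIn g s' cnt ∧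
    (g.n - q) * (g.m * 108 + 40) + 10 ≤ T ∧
    (∀ a < q, ∀ e < g.m, g.tr e = 1 → ∀ y, g.Joins e (s'.arr .work 3 a) y →
      s'.arr .work 4 y ≠ 0)) (by decide) ⟨0, 1, by omega, h6, h7, hf, by simp, by simp⟩ ?_
  rintro T s' fr hb ⟨q, cnt, hqc, k6, k7, kf, hT, hcl⟩
  have hcn := kf.cnt_le
  simp only [holds_lt, eval_reg, k6, k7]
  refine ⟨fun hq => ⟨g.m * 108 + 30, (g.n - (q + 1)) * (g.m * 108 + 40) + 10, ?_, ?_⟩, fun hq => ?_⟩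
  · have : g.n - q = (g.n - (q + 1)) + 1 := by omega
    rw [this] at hT
    simp only [Test.cost, NExp.cost]
    nlinarith
  · refine (bfsScan_spec hg hB (hs.frame fr) k6 k7 hq kf hcl).mono le_rfl ?_
    rintro s'' - - ⟨cnt', hc, l6, l7, lf, lcl⟩
    exact ⟨q + 1, cnt', by omega, l6, l7, lf, le_rfl, lcl⟩
  · have hqc : q = cnt := by omega
    subst hqc
    refine ⟨by simp only [Test.cost, NExp.cost]; omega, ?_⟩
    have hall : ∀ u < g.n, s'.arr .work 4 u ≠ 0 := by
      have hcl' : ∀ e < g.m, g.tr e = 1 → ∀ x y, g.Joins e x y → s'.arr .work 4 x ≠ 0 →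
          s'.arr .work 4 y ≠ 0 := by
        intro e he ht x y hj hx
        obtain ⟨a, ha, rfl⟩ := (kf.vis_iff x).1 hx
        exact hcl a ha e he ht y hj
      refine hg.conn _ ((kf.vis_iff _).2 ⟨0, kf.pos, kf.ord_zero⟩) fun e he ht => ?_
      exact ⟨hcl' e he ht _ _ (.inl ⟨rfl, rfl⟩), hcl' e he ht _ _ (.inr ⟨rfl, rfl⟩)⟩
    -- The queue enumerates every vertex, so it has at least `n` entries; `cnt_le` gives the other
    -- inequality.
    have : g.n ≤ q := by
      have := Finset.card_le_card_of_surjOn (s := Finset.range q) (t := Finset.range g.n)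
        (s'.arr .work 3) (fun u hu => by
          obtain ⟨a, ha, h⟩ := (kf.vis_iff u).1 (hall u (by simpa using hu))
          exact ⟨a, by simpa using ha, h⟩)
      simpa using this
    have : q = g.n := by omega
    exact this ▸ kf

/-! ### Rooted trees given by parent arrays -/

/-- The vertices in the order `ord`, every one but the root hanging from an earlier one. -/
structure Rooted (g : Inst) (ord par dep : ℕ → ℕ) (dist : ℕ → ℝ) : Prop where
  lt : ∀ q < g.n, ord q < g.n
  inj : ∀ q < g.n, ∀ q' < g.n, ord q = ord q' → q = q'
  surj : ∀ u < g.n, ∃ q < g.n, ord q = u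
  ord_zero : ord 0 = g.r
  par_root : par g.r = g.r
  dep_root : dep g.r = 0
  dist_root : dist g.r = 0
  step : ∀ q < g.n, 0 < q → ∃ q' < q, par (ord q) = ord q' ∧ dep (ord q) = dep (ord q') + 1 ∧
    dep (ord q) ≤ q ∧
    ∃ e < g.m, g.tr e = 1 ∧ g.Joins e (ord q') (ord q) ∧ dist (ord q) = dist (ord q') + g.wt e
  out : ∀ u, g.n ≤ u → par u = 0 ∧ dep u = 0 ∧ dist u = 0

theorem Found.rooted {g : Inst} {ord vis par dep : ℕ → ℕ} {dist : ℕ → ℝ}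
    (h : Found g g.n ord vis par dep dist) : Rooted g ord par dep dist where
  lt := h.lt
  inj := h.inj
  surj u hu := by
    have := Finset.surjOn_of_injOn_of_card_le (s := Finset.range g.n) (t := Finset.range g.n) ord
      (fun q hq => by simpa using h.lt q (by simpa using hq))
      (fun q hq q' hq' => h.inj q (by simpa using hq) q' (by simpa using hq')) le_rfl
    obtain ⟨q, hq, hqu⟩ := this (by simpa using hu : u ∈ (Finset.range g.n : Set ℕ))
    exact ⟨q, by simpa using hq, hqu⟩
  ord_zero := h.ord_zero
  par_root := h.par_root
  dep_root := h.dep_root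
  dist_root := h.dist_root
  step := h.step
  out := h.out

/-- `x` is an ancestor of `y`. -/
def Anc (par : ℕ → ℕ) (x y : ℕ) : Prop := ∃ k, par^[k] y = x

theorem Anc.refl (par : ℕ → ℕ) (x : ℕ) : Anc par x x := ⟨0, rfl⟩

theorem anc_iff (par : ℕ → ℕ) (x y : ℕ) : Anc par x y ↔ x = y ∨ Anc par x (par y) := by
  constructor
  · rintro ⟨k, rfl⟩
    cases k with
    | zero => exact .inl rfl
    | succ k => exact .inr ⟨k, rfl⟩
  · rintro (rfl | ⟨k, rfl⟩)
    · exact .refl _ _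
    · exact ⟨k + 1, rfl⟩

namespace Rooted

variable {g : Inst} {ord par dep : ℕ → ℕ} {dist : ℕ → ℝ}

theorem pos_of_ne (h : Rooted g ord par dep dist) {q : ℕ} (hq : ord q ≠ g.r) :
    0 < q := by
  rcases Nat.eq_zero_or_pos q with rfl | h0
  · exact absurd h.ord_zero hq
  · exact h0

theorem ord_ne (h : Rooted g ord par dep dist) {q : ℕ} (hq : q < g.n) (h0 : 0 < q) :
    ord q ≠ g.r := fun hc => by
  have := h.inj q hq 0 (by omega) (hc.trans h.ord_zero.symm)
  omega

theorem spec (h : Rooted g ord par dep dist) {u : ℕ} (hu : u < g.n) (hr : u ≠ g.r) :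
    par u < g.n ∧ dep u = dep (par u) + 1 ∧
    ∃ e < g.m, g.tr e = 1 ∧ g.Joins e (par u) u ∧ dist u = dist (par u) + g.wt e := by
  obtain ⟨q, hq, rfl⟩ := h.surj u hu
  obtain ⟨q', hq', h1, h2, -, h3⟩ := h.step q hq (h.pos_of_ne hr)
  rw [h1]
  exact ⟨h.lt q' (by omega), h2, h3⟩

theorem par_lt (h : Rooted g ord par dep dist) {u : ℕ} (hu : u < g.n) : par u < g.n := by
  by_cases hr : u = g.r
  · rw [hr, h.par_root]; rwa [hr] at hu
  · exact (h.spec hu hr).1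

theorem iter_lt (h : Rooted g ord par dep dist) {u : ℕ} (hu : u < g.n) (k : ℕ) :
    par^[k] u < g.n := by
  induction k with
  | zero => exact hu
  | succ k ih => rw [Function.iterate_succ_apply']; exact h.par_lt ih

theorem dep_lt (h : Rooted g ord par dep dist) {u : ℕ} (hu : u < g.n) : dep u < g.n := by
  obtain ⟨q, hq, rfl⟩ := h.surj u hu
  rcases Nat.eq_zero_or_pos q with rfl | h0
  · rw [h.ord_zero, h.dep_root]; exact hq
  · obtain ⟨_, _, _, _, h1, _⟩ := h.step q hq h0
    omega

-- A parent precedes its child in `ord`, so induction along parents is strong induction on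
-- positions.
@[elab_as_elim]
theorem induct (h : Rooted g ord par dep dist) {P : ℕ → Prop} (h0 : P g.r)
    (hs : ∀ u < g.n, u ≠ g.r → P (par u) → P u) {u : ℕ} (hu : u < g.n) : P u := by
  obtain ⟨q, hq, rfl⟩ := h.surj u hu
  induction q using Nat.strong_induction_on with
  | _ q ih =>
    rcases Nat.eq_zero_or_pos q with rfl | hp
    · rwa [h.ord_zero]
    · obtain ⟨q', hq', h1, -⟩ := h.step q hq hp
      exact hs _ (h.lt q hq) (h.ord_ne hq hp)
        (h1 ▸ ih q' hq' (by omega) (h.lt q' (by omega)))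

theorem dep_eq_zero (h : Rooted g ord par dep dist) {u : ℕ} (hu : u < g.n) (hd : dep u = 0) :
    u = g.r := by
  by_contra hr
  have := (h.spec hu hr).2.1
  omega

theorem anc_root (h : Rooted g ord par dep dist) {u : ℕ} (hu : u < g.n) : Anc par g.r u :=
  h.induct (P := fun u => Anc par g.r u) (.refl _ _)
    (fun _ _ _ ih => (anc_iff _ _ _).2 (.inr ih)) hu

theorem anc_of_root (h : Rooted g ord par dep dist) {x : ℕ} (hx : Anc par x g.r) : x = g.r := by
  obtain ⟨k, rfl⟩ := hx
  exact Function.iterate_fixed h.par_root k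

theorem dep_anc (h : Rooted g ord par dep dist) {x u : ℕ} (hu : u < g.n) (hx : Anc par x u) :
    dep x ≤ dep u := by
  revert hx
  refine h.induct (P := fun u => Anc par x u → dep x ≤ dep u) ?_ ?_ hu
  · intro hx; rw [h.anc_of_root hx]
  · intro u hu hr ih hx
    rcases (anc_iff _ _ _).1 hx with rfl | hx
    · exact le_rfl
    · have := (h.spec hu hr).2.1
      have := ih hx
      omega

theorem anc_pos (h : Rooted g ord par dep dist) {a b : ℕ} (ha : a < g.n) (hb : b < g.n)
    (hab : Anc par (ord a) (ord b)) : a ≤ b := by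
  induction b using Nat.strong_induction_on with
  | _ b ih =>
    rcases (anc_iff _ _ _).1 hab with hab | hab
    · exact (h.inj a ha b hb hab).le
    · rcases Nat.eq_zero_or_pos b with rfl | hp
      · rw [h.ord_zero, h.par_root] at hab
        exact (h.inj a ha 0 hb ((h.anc_of_root hab).trans h.ord_zero.symm)).le
      · obtain ⟨q', hq', h1, -⟩ := h.step b hb hp
        rw [h1] at hab
        have := ih q' hq' (by omega) hab
        omega

theorem dist_nonneg (hg : g.Valid) (h : Rooted g ord par dep dist) {u : ℕ} (hu : u < g.n) :
    0 ≤ dist u :=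
  h.induct (P := fun u => 0 ≤ dist u) h.dist_root.ge (fun _ hu hr ih => by
    obtain ⟨-, -, e, -, -, -, h1⟩ := h.spec hu hr
    have := hg.wt_nonneg e
    linarith) hu

end Rooted

/-! ### Ancestor labels -/

def shiftBody : Program :=
  .ite (.lt (rg 10) (ld .output 3 (rg 9) + 1))
    (st .output 3 (rg 9) (ld .output 3 (rg 9) + 1)) .skip ;;
  .ite (.lt (rg 10) (ld .output 4 (rg 9) + 1))
    (st .output 4 (rg 9) (ld .output 4 (rg 9) + 1)) .skip

def labelStart : Program :=
  .set 8 (ld .work 3 (rg 7)) ;; .set 10 (ld .output 3 (ld .output 1 (rg 8)) + 1)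

def labelEnd : Program :=
  st .output 3 (rg 8) (rg 10) ;; st .output 4 (rg 8) (rg 10 + 1)

def labelBody : Program := labelStart ;; forTo 9 0 shiftBody ;; labelEnd

def labels : Program := forTo 7 0 labelBody

/-- The labels of the first `q` vertices describe the ancestor relation. -/
structure Labelled (g : Inst) (ord par : ℕ → ℕ) (q : ℕ) (lo hi : ℕ → ℕ) : Prop where
  lo_le : ∀ x < g.n, lo x ≤ q
  hi_le : ∀ x < g.n, hi x ≤ q + 1
  out : ∀ x, g.n ≤ x → lo x = 0 ∧ hi x = 0
  iff : ∀ a < q, ∀ b < q, Anc par (ord a) (ord b) ↔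
    lo (ord a) ≤ lo (ord b) ∧ lo (ord b) < hi (ord a)

/-- The test is `P ≤ z`: numbers from `P` on move up by one, which frees the number `P`. -/
def bump (P z : ℕ) : ℕ := if P < z + 1 then z + 1 else z

/-- A vertex owns the half-open interval from its label to its upper end. The newest vertex takes
the number right after its parent's. An interval containing the parent's label ends at `P` or later,
so it grows around `P`; every other interval either starts at `P` or later and is shifted, or ends
before `P` and stays. The newest vertex has no labelled proper descendants, and its proper ancestors
are the ancestors of its parent. -/
theorem Labelled.insert {g : Inst} {ord par dep : ℕ → ℕ} {dist : ℕ → ℝ}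
    (ht : Rooted g ord par dep dist) {q : ℕ} (hq : q < g.n) {lo hi : ℕ → ℕ}
    (h : Labelled g ord par q lo hi) {lo' hi' : ℕ → ℕ} {P : ℕ} (hP : P = lo (par (ord q)) + 1)
    (h1 : ∀ x < g.n, lo' x = if x = ord q then P else bump P (lo x))
    (h2 : ∀ x < g.n, hi' x = if x = ord q then P + 1 else bump P (hi x))
    (h3 : ∀ x, g.n ≤ x → lo' x = lo x ∧ hi' x = hi x) :
    Labelled g ord par (q + 1) lo' hi' := by
  have hPq := h.lo_le _ (ht.par_lt (ht.lt q hq))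
  refine ⟨fun x hx => ?_, fun x hx => ?_, fun x hx => ?_, fun a ha b hb => ?_⟩
  · have := h.lo_le x hx
    rw [h1 x hx]; unfold bump; split_ifs <;> omega
  · have := h.hi_le x hx
    rw [h2 x hx]; unfold bump; split_ifs <;> omega
  · rw [(h3 x hx).1, (h3 x hx).2]; exact h.out x hx
  have han : a < g.n := by omega
  have hbn : b < g.n := by omega
  have hne : ∀ {c}, c < q → ord c ≠ ord q := fun {c} hc hcc => by
    have := ht.inj c (by omega) q hq hcc; omega
  rw [h1 _ (ht.lt a han), h1 _ (ht.lt b hbn), h2 _ (ht.lt a han)]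
  rcases (by omega : a = q ∨ a < q) with rfl | ha'
  · rcases (by omega : b = a ∨ b < a) with rfl | hb'
    · simp [Anc.refl]
    · have : ¬ Anc par (ord a) (ord b) := fun hc => by
        have := ht.anc_pos han hbn hc; omega
      simp only [this, if_true, if_neg (hne hb'), false_iff]
      unfold bump; split_ifs <;> omega
  · rcases (by omega : b = q ∨ b < q) with rfl | hb'
    · obtain ⟨q', hq', e1, -⟩ := ht.step b hq (by omega)
      have e2 : Anc par (ord a) (ord b) ↔ Anc par (ord a) (ord q') := by
        rw [anc_iff, e1]; simp [hne ha']
      rw [e2, h.iff a ha' q' hq']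
      simp only [if_true, if_neg (hne ha')]
      rw [e1] at hP
      unfold bump; split_ifs <;> omega
    · rw [h.iff a ha' b hb', if_neg (hne ha'), if_neg (hne hb'), if_neg (hne ha')]
      unfold bump; split_ifs <;> omega

structure Shifted (x P : ℕ) (s s' : Store) : Prop where
  lo : ∀ y, s'.arr .output 3 y =
    if y = x then bump P (s.arr .output 3 y) else s.arr .output 3 y
  hi : ∀ y, s'.arr .output 4 y =
    if y = x then bump P (s.arr .output 4 y) else s.arr .output 4 y

theorem shiftBody_spec {B : ℕ} {s : Store} {x P lim : ℕ} (h9 : s.reg 9 = x) (h10 : s.reg 10 = P)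
    (hlo : s.arr .output 3 x ≤ lim) (hhi : s.arr .output 4 x ≤ lim) (hB : lim + 1 ≤ B) :
    Runs B shiftBody s 100 (Shifted x P s) := by
  refine .straight rfl (by decide) ?_
  unfold shiftBody
  simp only [wp_seq, wp_ite, holds_lt, eval_reg, eval_add, eval_ld, eval_ofNat, h9, h10, wp_st,
    wp_skip, reg_wr]
  refine ⟨fun c1 => ⟨by omega, ?_⟩, fun c1 => ?_⟩
  · simp only [arr_wr_idx, Nat.reduceLT, ne_eq, Nat.reduceEqDiff, not_false_eq_true]
    refine ⟨fun c2 => ⟨by omega, ⟨fun y => ?_, fun y => ?_⟩⟩,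
        fun c2 => ⟨fun y => ?_, fun y => ?_⟩⟩ <;>
    · simp
      try unfold bump
      split_ifs <;> subst_vars <;> first | rfl | (exfalso; omega) | (rintro rfl; omega)
  · refine ⟨fun c2 => ⟨by omega, ⟨fun y => ?_, fun y => ?_⟩⟩,
        fun c2 => ⟨fun y => ?_, fun y => ?_⟩⟩ <;>
    · simp
      try unfold bump
      try split_ifs
      all_goals intros
      all_goals subst_vars
      all_goals first | rfl | (exfalso; omega)

theorem labelBody_spec {B : ℕ} {g : Inst} (hB : g.n + 2 ≤ B) {s : Store}
    (hs : Holds g s) {dep : ℕ → ℕ} {dist : ℕ → ℝ}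
    (ht : Rooted g (s.arr .work 3) (s.arr .output 1) dep dist) {q : ℕ} (hq : q < g.n)
    (h7 : s.reg 7 = q)
    (hl : Labelled g (s.arr .work 3) (s.arr .output 1) q (s.arr .output 3) (s.arr .output 4)) :
    Runs B labelBody s (g.n * 108 + 100) (fun s' =>
      Labelled g (s.arr .work 3) (s.arr .output 1) (q + 1)
        (s'.arr .output 3) (s'.arr .output 4)) := by
  set u := s.arr .work 3 q with hu
  have hun : u < g.n := ht.lt q hq
  have hpn := ht.par_lt hun
  set P := s.arr .output 3 (s.arr .output 1 u) + 1 with hP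
  have hPq := hl.lo_le _ hpn
  refine .seq 40 (g.n * 108 + 60) (fun s' => s' = (s.setReg 8 u).setReg 10 P)
    (.straight rfl (by decide) ?_) (by omega) ?_
  · simp [labelStart, h7, ← hu, ← hP]; omega
  rintro _ fr - rfl
  have hs1 := hs.frame fr
  refine .seq (g.n * 108 + 8) 40 _ (Runs.forTo (Q := fun s' =>
      s'.reg 8 = u ∧ s'.reg 10 = P ∧
      (∀ y, s'.arr .output 3 y =
        if y < g.n then bump P (s.arr .output 3 y) else s.arr .output 3 y) ∧
      (∀ y, s'.arr .output 4 y =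
        if y < g.n then bump P (s.arr .output 4 y) else s.arr .output 4 y)) g.n 100 _
    (fun k s' => s'.reg 8 = u ∧ s'.reg 10 = P ∧
      (∀ y, s'.arr .output 3 y =
        if y < k then bump P (s.arr .output 3 y) else s.arr .output 3 y) ∧
      (∀ y, s'.arr .output 4 y =
        if y < k then bump P (s.arr .output 4 y) else s.arr .output 4 y))
    hs1.n rfl rfl rfl le_rfl ?_ ?_ ?_) (by omega) ?_
  · simp
  · rintro x s' hx h9 - fr' - ⟨k8, k10, kl, kh⟩
    have e1 := kl x
    have e2 := kh x
    simp only [lt_irrefl, if_false] at e1 e2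
    have b1 := hl.lo_le x hx
    have b2 := hl.hi_le x hx
    refine (shiftBody_spec (lim := g.n + 1) h9 k10 (by omega) (by omega) (by omega)).mono le_rfl ?_
    rintro s'' fr'' - ⟨l1, l2⟩
    refine ⟨?_, ?_, fun y => ?_, fun y => ?_⟩
    · simpa using (fr''.reg 8).trans k8
    · simpa using (fr''.reg 10).trans k10
    · simp only [arr_setReg, l1, kl y]
      split_ifs <;> first | rfl | (exfalso; omega)
    · simp only [arr_setReg, l2, kh y]
      split_ifs <;> first | rfl | (exfalso; omega)
  · rintro s' - ⟨k8, k10, kl, kh⟩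
    exact ⟨k8, k10, kl, kh⟩
  · rintro s' - - ⟨k8, k10, kl, kh⟩
    refine .straight rfl (by decide) ?_
    simp only [labelEnd, wp_seq, wp_st, eval_reg, eval_add, eval_ofNat, reg_wr, k8, k10]
    refine ⟨by omega, by omega, hl.insert ht hq hP (fun x hx => ?_) (fun x hx => ?_)
      (fun x hx => ?_)⟩
    · simp [kl x, hu, hx]
    · simp [kh x, hu, hx]
    · have h1 : x ≠ u := by omega
      simp [kl x, kh x, h1, hx.not_gt]

theorem labels_spec {B : ℕ} {g : Inst} (hB : g.n + 2 ≤ B) {s : Store}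
    (hs : Holds g s) {dep : ℕ → ℕ} {dist : ℕ → ℝ}
    (ht : Rooted g (s.arr .work 3) (s.arr .output 1) dep dist)
    (h3 : ∀ x, s.arr .output 3 x = 0) (h4 : ∀ x, s.arr .output 4 x = 0) :
    Runs B labels s (g.n * (g.n * 108 + 108) + 8) (fun s' =>
      (∀ x, g.n ≤ x → s'.arr .output 3 x = 0 ∧ s'.arr .output 4 x = 0) ∧
      ∀ x < g.n, ∀ y < g.n,
      (Anc (s.arr .output 1) x y ↔
        s'.arr .output 3 x ≤ s'.arr .output 3 y ∧ s'.arr .output 3 y < s'.arr .output 4 x)) := by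
  refine Runs.forTo g.n (g.n * 108 + 100) _
    (fun q s' => Labelled g (s.arr .work 3) (s.arr .output 1) q (s'.arr .output 3)
      (s'.arr .output 4)) hs.n rfl rfl rfl (by nlinarith) ?_ ?_ ?_
  · constructor <;> simp [h3, h4]
  · rintro q s' hq h7 - fr - hl
    have e1 := fr.arr .work 3
    have e2 := fr.arr .output 1
    rw [← e1, ← e2] at hl ht
    refine (labelBody_spec hB (hs.frame fr) ht hq h7 hl).mono le_rfl ?_
    rintro s'' - - h
    rw [e1, e2] at h
    simpa using h
  · rintro s' - hl
    refine ⟨hl.out, fun x hx y hy => ?_⟩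
    obtain ⟨a, ha, rfl⟩ := ht.surj x hx
    obtain ⟨b, hb, rfl⟩ := ht.surj y hy
    exact hl.iff a ha b hb

/-! ### Components after the failure of the last edges above a vertex -/

open Classical in
/-- The component of `t` when the parent edges of the first `h` ancestors of `v` (starting with
`v` itself) fail; the component of the root has number `h`. -/
noncomputable def cmp (par : ℕ → ℕ) (v h t : ℕ) : ℕ :=
  if H : ∃ i, i < h ∧ Anc par (par^[i] v) t then Nat.find H else h

/-- The topmost vertex of the component `i`. -/
def top (par : ℕ → ℕ) (r v h i : ℕ) : ℕ := if i < h then par^[i] v else r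

open Classical in
theorem cmp_le (par : ℕ → ℕ) (v h t : ℕ) : cmp par v h t ≤ h := by
  unfold cmp
  split_ifs with H
  · exact (Nat.find_spec H).1.le
  · exact le_rfl

open Classical in
theorem anc_cmp {par : ℕ → ℕ} {v h t : ℕ} (hc : cmp par v h t < h) :
    Anc par (par^[cmp par v h t] v) t := by
  unfold cmp at hc ⊢
  split_ifs at hc ⊢ with H
  · exact (Nat.find_spec H).2
  · omega

open Classical in
theorem cmp_le_of_anc {par : ℕ → ℕ} {v h t i : ℕ} (hi : i < h) (ha : Anc par (par^[i] v) t) :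
    cmp par v h t ≤ i := by
  unfold cmp
  rw [dif_pos ⟨i, hi, ha⟩]
  exact Nat.find_le ⟨hi, ha⟩

theorem cmp_congr {par : ℕ → ℕ} {v h t t' : ℕ}
    (H : ∀ i < h, Anc par (par^[i] v) t ↔ Anc par (par^[i] v) t') :
    cmp par v h t = cmp par v h t' := by
  apply le_antisymm
  · rcases (cmp_le par v h t').lt_or_eq with hc | hc
    · exact cmp_le_of_anc hc ((H _ hc).2 (anc_cmp hc))
    · rw [hc]; exact cmp_le _ _ _ _
  · rcases (cmp_le par v h t).lt_or_eq with hc | hc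
    · exact cmp_le_of_anc hc ((H _ hc).1 (anc_cmp hc))
    · rw [hc]; exact cmp_le _ _ _ _

/-! ### Classes of ancestors, of parents and of the root -/

namespace Rooted

variable {g : Inst} {ord par dep : ℕ → ℕ} {dist : ℕ → ℝ}

theorem iter_ne_root (ht : Rooted g ord par dep dist) {v : ℕ} (hv : v < g.n) {i : ℕ}
    (hi : i < dep v) : par^[i] v ≠ g.r ∧ dep (par^[i] v) + i = dep v := by
  induction i with
  | zero =>
    refine ⟨fun hc => ?_, rfl⟩
    have : v = g.r := hc
    rw [this, ht.dep_root] at hi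
    omega
  | succ i ih =>
    obtain ⟨h1, h2⟩ := ih (by omega)
    have h3 := (ht.spec (ht.iter_lt hv i) h1).2.1
    have h4 : par^[i + 1] v = par (par^[i] v) := Function.iterate_succ_apply' par i v
    rw [← h4] at h3
    refine ⟨fun hc => ?_, by omega⟩
    rw [hc, ht.dep_root] at h3
    omega

theorem cmp_root (ht : Rooted g ord par dep dist) {v h : ℕ} (hv : v < g.n) (hh : h ≤ dep v) :
    cmp par v h g.r = h := by
  refine le_antisymm (cmp_le _ _ _ _) (not_lt.1 fun hc => ?_)
  exact (ht.iter_ne_root hv (hc.trans_le hh)).1 (ht.anc_of_root (anc_cmp hc))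

theorem cmp_iter (ht : Rooted g ord par dep dist) {v h i : ℕ} (hv : v < g.n) (hh : h ≤ dep v)
    (hi : i < h) : cmp par v h (par^[i] v) = i := by
  refine le_antisymm (cmp_le_of_anc hi (.refl _ _)) (not_lt.1 fun hc => ?_)
  have h1 := ht.dep_anc (ht.iter_lt hv i) (anc_cmp (hc.trans hi))
  have h2 := (ht.iter_ne_root hv (hi.trans_le hh)).2
  have h3 := (ht.iter_ne_root hv ((hc.trans hi).trans_le hh)).2
  omega

/-- The parent edge of `u` is not deleted, so its two ends have the same relevant ancestors. -/
theorem cmp_par {v h u : ℕ} (hn : ∀ i < h, u ≠ par^[i] v) :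
    cmp par v h u = cmp par v h (par u) := by
  refine cmp_congr fun i hi => ?_
  rw [anc_iff]
  simp [(hn i hi).symm]

theorem top_lt (hg : g.Valid) (ht : Rooted g ord par dep dist) {v : ℕ} (hv : v < g.n)
    (h i : ℕ) : top par g.r v h i < g.n := by
  unfold top
  split_ifs
  · exact ht.iter_lt hv i
  · exact hg.r_lt

theorem anc_top_cmp (ht : Rooted g ord par dep dist) {v h t : ℕ} (htn : t < g.n) :
    Anc par (top par g.r v h (cmp par v h t)) t := by
  unfold top
  split_ifs with hc
  · exact anc_cmp hc
  · exact ht.anc_root htn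

/-- With `anc_top_cmp`, this identifies the class of `t` as the least class whose top is an ancestor
of `t`. A query can thus find it from ancestor labels alone. -/
theorem cmp_le_of_anc_top {v h t i : ℕ} (ha : Anc par (top par g.r v h i) t) :
    cmp par v h t ≤ i := by
  unfold top at ha
  split_ifs at ha with hc
  · exact cmp_le_of_anc hc ha
  · exact (cmp_le _ _ _ _).trans (not_lt.1 hc)

end Rooted

/-! ### Computing the components -/

/-- From here on register 11 holds `h`, register 12 holds `h + 1`, and register 15 holds the start
`v * (f + 1)` of the block of `v`. -/
def setH : Program :=
  .ite (.lt (ld .output 2 (rg 7)) (rg 3)) (.set 11 (ld .output 2 (rg 7))) (.set 11 (rg 3)) ;;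
  st .output 5 (rg 7) (rg 11) ;; .set 12 (rg 11 + 1) ;; .set 15 (rg 7 * rg 13) ;; .set 8 (rg 7)

def topsBody : Program := st .work 9 (rg 9) (rg 8) ;; .set 8 (ld .output 1 (rg 8))

def tops : Program := forTo 9 11 topsBody ;; st .work 9 (rg 11) (rg 2)

def unsetComps : Program := forTo 9 0 (st .work 10 (rg 9) (rg 12)) ;; st .work 10 (rg 2) (rg 11)

def seedComps : Program := forTo 9 11 (st .work 10 (ld .work 9 (rg 9)) (rg 9))

def spreadBody : Program :=
  .set 8 (ld .work 3 (rg 9)) ;;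
  .ite (.eq (ld .work 10 (rg 8)) (rg 12))
    (st .work 10 (rg 8) (ld .work 10 (ld .output 1 (rg 8)))) .skip

def comps : Program := unsetComps ;; seedComps ;; forTo 9 0 spreadBody

theorem tops_spec {B : ℕ} {g : Inst} {s : Store} (hs : Holds g s) {v h : ℕ}
    (h8 : s.reg 8 = v) (h11 : s.reg 11 = h) :
    Runs B tops s (h * 30 + 20) (fun s' =>
      ∀ i ≤ h, s'.arr .work 9 i = top (s.arr .output 1) g.r v h i) := by
  refine .seq (h * 30 + 8) 12 _ (Runs.forTo (Q := fun s' =>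
      ∀ i < h, s'.arr .work 9 i = (s.arr .output 1)^[i] v) h 22 _
    (fun k s' => s'.reg 8 = (s.arr .output 1)^[k] v ∧
      ∀ i < k, s'.arr .work 9 i = (s.arr .output 1)^[i] v) h11 rfl rfl rfl le_rfl ?_ ?_ ?_)
      (by omega) ?_
  · simpa using h8
  · rintro k s' hk h9 - fr hb ⟨i1, i2⟩
    have e := fr.arr .output 1
    have b1 := hb.reg 8
    have b2 := hb.arr .output 1 (s'.reg 8)
    refine .straight rfl (by decide) ?_
    simp only [topsBody, wp_seq, wp_st, wp_set, eval_reg, eval_ld, reg_wr, h9, e] at b2 ⊢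
    refine ⟨b1, ?_, ?_, fun i hi => ?_⟩
    · simpa [e] using b2
    · simp [i1, e, Function.iterate_succ_apply']
    · simp only [arr_setReg, arr_wr_same, i1]
      split_ifs with hik
      · rw [hik]
      · exact i2 i (by omega)
  · rintro s' - ⟨-, i2⟩
    exact i2
  · rintro s' fr hb i2
    have hr := (fr.reg 2).trans hs.r
    have h11 := (fr.reg 11).trans h11
    have b1 := hb.reg 2
    refine .straight rfl (by decide) ?_
    simp only [wp_st, eval_reg, h11]
    refine ⟨b1, fun i hi => ?_⟩
    simp only [arr_wr_same, hr, top]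
    rcases hi.lt_or_eq with hi | rfl
    · rw [if_neg (by omega), if_pos hi, i2 i hi]
    · simp

/-- The number `h + 1` means "not yet known". After seeding, only the tops have a class; every other
vertex is joined to its parent by an undeleted edge and inherits its class, and the search order
guarantees that the parent has been treated before. -/
theorem comps_spec {B : ℕ} {g : Inst} {s : Store} (hs : Holds g s)
    {dep : ℕ → ℕ} {dist : ℕ → ℝ} (ht : Rooted g (s.arr .work 3) (s.arr .output 1) dep dist)
    {v h : ℕ} (hv : v < g.n) (hh : h ≤ dep v) (h11 : s.reg 11 = h) (h12 : s.reg 12 = h + 1)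
    (hx : ∀ i ≤ h, s.arr .work 9 i = top (s.arr .output 1) g.r v h i) :
    Runs B comps s (g.n * 100 + h * 20 + 50) (fun s' =>
      ∀ u < g.n, s'.arr .work 10 u = cmp (s.arr .output 1) v h u) := by
  set par := s.arr .output 1 with hpar
  set ord := s.arr .work 3 with hord
  refine .seq (g.n * 20 + 20) (g.n * 80 + h * 20 + 30) (fun s' =>
      ∀ u < g.n, s'.arr .work 10 u = if u = g.r then h else h + 1) ?_ (by omega) ?_
  · refine .seq (g.n * 20 + 8) 12 _ (Runs.forTo (Q := fun s' =>
      ∀ u < g.n, s'.arr .work 10 u = h + 1) g.n 12 _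
      (fun k s' => ∀ u < k, s'.arr .work 10 u = h + 1) hs.n rfl rfl rfl le_rfl ?_ ?_ ?_)
      (by omega) ?_
    · simp
    · rintro k s' hk h9 - fr hb i1
      have h12 := (fr.reg 12).trans h12
      have b := hb.reg 12
      refine .straight rfl (by decide) ?_
      simp only [wp_st, eval_reg]
      refine ⟨b, fun u hu => ?_⟩
      simp only [arr_setReg, arr_wr_same, h9, h12]
      split_ifs with hik
      · rfl
      · exact i1 u (by omega)
    · rintro s' - h1; exact h1
    · rintro s' fr hb h1
      have h11 := (fr.reg 11).trans h11
      have h2 := (fr.reg 2).trans hs.r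
      have b := hb.reg 11
      refine .straight rfl (by decide) ?_
      simp only [wp_st, eval_reg]
      refine ⟨b, fun u hu => ?_⟩
      simp only [arr_wr_same, h2, h11, h1 u hu]
  intro s1 fr1 hb1 h1
  have hs1 := hs.frame fr1
  have hx1 := fr1.arr .work 9
  have h11' := (fr1.reg 11).trans h11
  refine .seq (h * 20 + 8) (g.n * 80 + 20) (fun s' => ∀ u < g.n,
      s'.arr .work 10 u = cmp par v h u ∨
        (s'.arr .work 10 u = h + 1 ∧ u ≠ g.r ∧ ∀ i < h, u ≠ par^[i] v)) ?_ (by omega) ?_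
  · refine Runs.forTo h 12 _
      (fun k s' => ∀ u < g.n, s'.arr .work 10 u = cmp par v h u ∨
        (s'.arr .work 10 u = h + 1 ∧ u ≠ g.r ∧ ∀ i < k, u ≠ par^[i] v)) h11' rfl rfl rfl
        le_rfl ?_ ?_ ?_
    · intro u hu
      simp only [arr_setReg, h1 u hu]
      split_ifs with hr
      · left; rw [hr, ht.cmp_root hv hh]
      · exact .inr ⟨rfl, hr, by simp⟩
    · rintro k s' hk h9 - fr hb i1
      have b := hb.reg 9
      have e : s'.arr .work 9 k = par^[k] v := by
        rw [fr.arr .work 9, hx1, hx k hk.le, top, if_pos hk]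
      refine .straight rfl (by decide) ?_
      simp only [wp_st, eval_reg, eval_ld, h9, e]
      refine ⟨by omega, fun u hu => ?_⟩
      simp only [arr_setReg, arr_wr_same]
      split_ifs with hik
      · left; rw [hik, ht.cmp_iter hv hh hk]
      · rcases i1 u hu with i1 | ⟨i1, i2, i3⟩
        · exact .inl i1
        · refine .inr ⟨i1, i2, fun i hi => ?_⟩
          rcases (by omega : i = k ∨ i < k) with rfl | hi
          · exact hik
          · exact i3 i hi
    · rintro s' - i1; exact i1
  intro s2 fr2 hb2 h2
  have hs2 := hs1.frame fr2
  have h12' := (fr2.reg 12).trans ((fr1.reg 12).trans h12)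
  have ep := (fr2.arr .output 1).trans (fr1.arr .output 1)
  have eo := (fr2.arr .work 3).trans (fr1.arr .work 3)
  refine Runs.forTo g.n 60 _
      (fun k s' => (∀ u < g.n, s'.arr .work 10 u = cmp par v h u ∨
        (s'.arr .work 10 u = h + 1 ∧ u ≠ g.r ∧ ∀ i < h, u ≠ par^[i] v)) ∧
        ∀ b < k, s'.arr .work 10 (ord b) = cmp par v h (ord b)) hs2.n rfl rfl rfl
        (by omega) ?_ ?_ ?_
  · simpa using h2
  · rintro k s' hk h9 - fr hb ⟨i1, i2⟩
    have ep := (fr.arr .output 1).trans ep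
    have eo := (fr.arr .work 3).trans eo
    have h12 := (fr.reg 12).trans h12'
    have b1 := hb.arr .work 3 k
    have b2 := hb.arr .work 10 (par (ord k))
    refine .straight rfl (by decide) ?_
    simp only [spreadBody, wp_seq, wp_set, wp_ite, wp_st, wp_skip, holds_eq, eval_reg, eval_ld,
      arr_setReg, reg_setReg, if_true, h9, h12, ep, eo, ← hpar, ← hord,
      if_neg (show ¬ (12 : ℕ) = 8 by omega)] at b1 ⊢
    have hk' := ht.lt k hk
    refine ⟨b1, fun hc => ⟨b2, ?_⟩, fun hc => ⟨i1, fun b hb => ?_⟩⟩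
    · obtain ⟨hr, hn⟩ : ord k ≠ g.r ∧ ∀ i < h, ord k ≠ par^[i] v := by
        rcases i1 _ hk' with i1 | ⟨-, i1⟩
        · have := cmp_le par v h (ord k); omega
        · exact i1
      obtain ⟨q', hq', hpq, -⟩ := ht.step k hk (ht.pos_of_ne hr)
      have hnew : s'.arr .work 10 (par (ord k)) = cmp par v h (ord k) := by
        rw [Rooted.cmp_par hn, hpq, i2 q' hq']
      rw [hnew]
      refine ⟨fun u hu => ?_, fun b hb => ?_⟩
      · simp only [arr_setReg, arr_wr_same]
        split_ifs with huk
        · left; rw [huk]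
        · exact i1 u hu
      · simp only [arr_setReg, arr_wr_same]
        split_ifs with huk
        · rw [huk]
        · refine i2 b ?_
          rcases (by omega : b = k ∨ b < k) with rfl | hb
          · exact absurd rfl huk
          · exact hb
    · rcases (by omega : b = k ∨ b < k) with rfl | hb
      · rcases i1 _ hk' with i1 | ⟨i1, -⟩
        · exact i1
        · exact absurd i1 hc
      · exact i2 b hb
  · rintro s' - ⟨-, i2⟩ u hu
    obtain ⟨q, hq, rfl⟩ := ht.surj u hu
    exact i2 q hq

/-! ### Cheapest edges between components -/

/-- The key of an edge: the length of the walk from the root along the edge back to the root. -/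
def Inst.key (g : Inst) (dist : ℕ → ℝ) (e : ℕ) : ℝ := dist (g.eu e) + g.wt e + dist (g.ev e)

/-- The non-tree edge `e` joins the classes `i` and `j` of `cm`. -/
def Inst.Links (g : Inst) (cm : ℕ → ℕ) (e i j : ℕ) : Prop :=
  g.tr e ≠ 1 ∧ ((cm (g.eu e) = i ∧ cm (g.ev e) = j) ∨ (cm (g.eu e) = j ∧ cm (g.ev e) = i))

theorem Inst.Links.symm {g : Inst} {cm : ℕ → ℕ} {e i j : ℕ} (h : g.Links cm e i j) :
    g.Links cm e j i := ⟨h.1, h.2.symm⟩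

/-- `x` encodes a cheapest edge in `P`: it is `0` if there is none, and the number of the edge
plus one otherwise. -/
def Cheapest (key : ℕ → ℝ) (P : ℕ → Prop) (x : ℕ) : Prop :=
  (x = 0 ∧ ∀ e, ¬ P e) ∨ (x ≠ 0 ∧ P (x - 1) ∧ ∀ e, P e → key (x - 1) ≤ key e)

open Classical in
noncomputable def cheaper (key : ℕ → ℝ) (x e : ℕ) : ℕ :=
  if x = 0 ∨ key e < key (x - 1) then e + 1 else x

theorem Cheapest.congr {key : ℕ → ℝ} {P P' : ℕ → Prop} {x : ℕ} (h : Cheapest key P x)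
    (hP : ∀ e, P e ↔ P' e) : Cheapest key P' x := by
  have : P = P' := funext fun e => propext (hP e)
  exact this ▸ h

theorem Cheapest.insert {key : ℕ → ℝ} {P : ℕ → Prop} {x : ℕ} (h : Cheapest key P x) (e : ℕ) :
    Cheapest key (fun e' => P e' ∨ e' = e) (cheaper key x e) := by
  unfold cheaper
  rcases h with ⟨h0, h1⟩ | ⟨h0, h1, h2⟩
  · rw [if_pos (.inl h0)]
    exact .inr ⟨by omega, .inr rfl, by rintro e' (h | rfl); exacts [absurd h (h1 e'), le_rfl]⟩
  · split_ifs with hc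
    · have hc : key e < key (x - 1) := by tauto
      exact .inr ⟨by omega, .inr rfl, by
        rintro e' (h | rfl); exacts [hc.le.trans (h2 e' h), le_rfl]⟩
    · push Not at hc
      exact .inr ⟨h0, .inl h1, by rintro e' (h | rfl); exacts [h2 e' h, hc.2]⟩

def offer (a : NExp) : Program :=
  .ite (.eq (ld .work 11 a) 0) (st .work 11 a (rg 9 + 1))
    (.ite (.rlt (rld .work 2 (rg 9)) (rld .work 2 (ld .work 11 a - 1)))
      (st .work 11 a (rg 9 + 1)) .skip)

/-- Each non-tree edge is offered to both symmetric matrix cells. Register 13 holds the row length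
`f + 1`, which is the same for all `v`. -/
def scanBody : Program :=
  .ite (.eq (ld .work 2 (rg 9)) 1) .skip
    (.set 16 (ld .work 10 (ld .work 0 (rg 9))) ;;
      .set 17 (ld .work 10 (ld .work 1 (rg 9))) ;;
      .set 18 (rg 16 * rg 13 + rg 17) ;; offer (rg 18) ;;
      .set 18 (rg 17 * rg 13 + rg 16) ;; offer (rg 18))

def matrix : Program := forTo 9 14 (st .work 11 (rg 9) 0) ;; forTo 9 1 scanBody

theorem wp_offer {B : ℕ} {s : Store} {key : ℕ → ℝ} {e a : ℕ} {Q : Store → Prop}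
    (h9 : s.reg 9 = e) (h18 : s.reg 18 = a) (hk : s.rarr .work 2 = key) (he : e + 1 ≤ B)
    (hQ : ∀ x, x = cheaper key (s.arr .work 11 a) e →
      (x = s.arr .work 11 a → Q s) ∧ Q (s.wr .work 11 a x)) :
    (offer (rg 18)).wp B Q s := by
  simp only [offer, wp_ite, wp_st, wp_skip, holds_eq, holds_rlt, reval_rld, eval_ld, eval_reg,
    eval_sub, eval_add, eval_ofNat, h9, h18, hk]
  refine ⟨fun h0 => ⟨he, (hQ _ ?_).2⟩, fun h0 => ⟨fun h1 => ⟨he, (hQ _ ?_).2⟩,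
    fun h1 => (hQ _ rfl).1 ?_⟩⟩
  · simp [cheaper, h0]
  · simp [cheaper, h1]
  · simp [cheaper, h0, h1]

/-- The matrix of cheapest edges in `P` between the classes. -/
def IsMatrix (g : Inst) (key : ℕ → ℝ) (cm : ℕ → ℕ) (h f : ℕ) (P : ℕ → Prop) (mx : ℕ → ℕ) :
    Prop :=
  ∀ i ≤ h, ∀ j ≤ h, Cheapest key (fun e => P e ∧ g.Links cm e i j) (mx (i * (f + 1) + j))

theorem encode_inj {f i j i' j' : ℕ} (hj : j ≤ f) (hj' : j' ≤ f)
    (h : i * (f + 1) + j = i' * (f + 1) + j') : i = i' ∧ j = j' := by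
  have h1 : (i * (f + 1) + j) / (f + 1) = (i' * (f + 1) + j') / (f + 1) := by rw [h]
  rw [mul_comm i, mul_comm i', Nat.mul_add_div (by omega), Nat.mul_add_div (by omega),
    Nat.div_eq_of_lt (by omega), Nat.div_eq_of_lt (by omega)] at h1
  have : i = i' := by omega
  subst this
  exact ⟨rfl, by omega⟩

/-- The two updated cells coincide when both ends lie in one class; the edge is then offered twice
to the same cell, which is harmless since inserting it again does not change the set of candidates.
-/
theorem IsMatrix.insert {g : Inst} {key : ℕ → ℝ} {cm : ℕ → ℕ} {h f : ℕ} {P : ℕ → Prop}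
    {mx : ℕ → ℕ} (hm : IsMatrix g key cm h f P mx) (hf : h ≤ f) (e i₀ j₀ : ℕ)
    (hi : cm (g.eu e) = i₀) (hj : cm (g.ev e) = j₀) (hi₀ : i₀ ≤ h) (hj₀ : j₀ ≤ h)
    (ht : g.tr e ≠ 1) {mx₁ mx₂ : ℕ → ℕ}
    (h1 : ∀ y, mx₁ y = if y = i₀ * (f + 1) + j₀ then cheaper key (mx y) e else mx y)
    (h2 : ∀ y, mx₂ y = if y = j₀ * (f + 1) + i₀ then cheaper key (mx₁ y) e else mx₁ y) :
    IsMatrix g key cm h f (fun e' => P e' ∨ e' = e) mx₂ := by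
  intro i hi' j hj'
  have c1 : i * (f + 1) + j = i₀ * (f + 1) + j₀ ↔ i = i₀ ∧ j = j₀ :=
    ⟨fun h => encode_inj (by omega) (by omega) h, by rintro ⟨rfl, rfl⟩; rfl⟩
  have c2 : i * (f + 1) + j = j₀ * (f + 1) + i₀ ↔ i = j₀ ∧ j = i₀ :=
    ⟨fun h => encode_inj (by omega) (by omega) h, by rintro ⟨rfl, rfl⟩; rfl⟩
  have h0 := hm i hi' j hj'
  have hl : g.Links cm e i j ↔ (i = i₀ ∧ j = j₀) ∨ (i = j₀ ∧ j = i₀) := by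
    unfold Inst.Links; rw [hi, hj]
    have t1 : (i₀ = i ∧ j₀ = j) ↔ (i = i₀ ∧ j = j₀) := by omega
    have t2 : (i₀ = j ∧ j₀ = i) ↔ (i = j₀ ∧ j = i₀) := by omega
    rw [t1, t2]
    exact and_iff_right ht
  by_cases a1 : i = i₀ ∧ j = j₀ <;> by_cases a2 : i = j₀ ∧ j = i₀
  · rw [h2, if_pos (c2.2 a2), h1, if_pos (c1.2 a1)]
    refine ((h0.insert e).insert e).congr fun e' => ?_
    by_cases he : e' = e
    · subst he; simp [hl.2 (.inl a1)]
    · simp [he]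
  · rw [h2, if_neg (mt c2.1 a2), h1, if_pos (c1.2 a1)]
    refine (h0.insert e).congr fun e' => ?_
    by_cases he : e' = e
    · subst he; simp [hl.2 (.inl a1)]
    · simp [he]
  · rw [h2, if_pos (c2.2 a2), h1, if_neg (mt c1.1 a1)]
    refine (h0.insert e).congr fun e' => ?_
    by_cases he : e' = e
    · subst he; simp [hl.2 (.inr a2)]
    · simp [he]
  · rw [h2, if_neg (mt c2.1 a2), h1, if_neg (mt c1.1 a1)]
    refine h0.congr fun e' => ?_
    by_cases he : e' = e
    · subst he; simp [show ¬ g.Links cm e' i j from fun hc => (hl.1 hc).elim a1 a2]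
    · simp [he]

theorem matrix_spec {B : ℕ} {g : Inst} (hg : g.Valid) {s : Store} (hs : Holds g s)
    (hB : g.m ≤ B) (hBf : (g.f + 1) * (g.f + 1) ≤ B) {key : ℕ → ℝ} {cm : ℕ → ℕ} {h : ℕ}
    (hf : h ≤ g.f) (hk : s.rarr .work 2 = key) (h13 : s.reg 13 = g.f + 1)
    (h14 : s.reg 14 = (g.f + 1) * (g.f + 1))
    (hcm : ∀ u < g.n, s.arr .work 10 u = cm u) (hch : ∀ u, cm u ≤ h) :
    Runs B matrix s ((g.f + 1) * (g.f + 1) * 20 + g.m * 158 + 20) (fun s' =>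
      IsMatrix g key cm h g.f (· < g.m) (s'.arr .work 11)) := by
  set F := g.f + 1 with hF
  refine .seq (F * F * 20 + 8) (g.m * 158 + 8) _ (Runs.forTo (Q := fun s' =>
      ∀ y < F * F, s'.arr .work 11 y = 0) (F * F) 12 _
      (fun k s' => ∀ y < k, s'.arr .work 11 y = 0) h14 rfl rfl rfl le_rfl ?_ ?_ ?_)
      (by omega) ?_
  · simp
  · rintro k s' hk h9 - fr hb i1
    refine .straight rfl (by decide) ?_
    simp only [wp_st, eval_reg, eval_ofNat, h9]
    refine ⟨by omega, fun y hy => ?_⟩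
    simp only [arr_setReg, arr_wr_same]
    split_ifs with hik
    · rfl
    · exact i1 y (by omega)
  · rintro s' - h1; exact h1
  rintro s1 fr1 hb1 h1
  have hs1 := hs.frame fr1
  have enc : ∀ i ≤ h, ∀ j ≤ h, i * F + j < F * F := by
    intro i hi j hj
    have : i + 1 ≤ F := by omega
    nlinarith
  refine Runs.forTo g.m 150 _
      (fun k s' => IsMatrix g key cm h g.f (· < k) (s'.arr .work 11)) hs1.m rfl rfl rfl
        (by omega) ?_ ?_ ?_
  · intro i hi j hj
    rw [arr_setReg, h1 _ (enc i hi j hj)]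
    exact .inl ⟨rfl, by simp⟩
  · rintro e s' he h9 - fr hb hm
    have hs' := hs1.frame fr
    have h13 := (fr.reg 13).trans ((fr1.reg 13).trans h13)
    have hk := (fr.rarr .work 2).trans ((fr1.rarr .work 2).trans hk)
    have ecm := (fr.arr .work 10).trans (fr1.arr .work 10)
    have eu := hcm _ (hg.eu_lt e he)
    have ev := hcm _ (hg.ev_lt e he)
    have cu := hch (g.eu e)
    have cv := hch (g.ev e)
    have e1 := enc _ cu _ cv
    have e2 := enc _ cv _ cu
    have hle : h ≤ B := by nlinarith
    refine .straight rfl (by decide) ?_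
    simp only [scanBody, wp_ite, wp_seq, wp_skip, wp_set, holds_eq, eval_ld, eval_reg, eval_ofNat,
      reg_setReg, arr_setReg, eval_mul, eval_add, h9, hs'.tr, hs'.eu, hs'.ev, ecm, eu, ev, h13,
      if_true, Nat.reduceEqDiff, if_false]
    refine ⟨fun ht => ?_, fun ht => ⟨by omega, by omega, by omega, ?_⟩⟩
    · intro i hi j hj
      refine (hm i hi j hj).congr fun e' => ?_
      constructor
      · rintro ⟨a, b⟩; exact ⟨by omega, b⟩
      · rintro ⟨a, b⟩
        refine ⟨?_, b⟩
        rcases (by omega : e' = e ∨ e' < e) with rfl | h'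
        · exact absurd ht b.1
        · exact h'
    have fin : ∀ s₁ s₂ : Store, (∀ y, s₁.arr .work 11 y =
        if y = cm (g.eu e) * F + cm (g.ev e) then cheaper key (s'.arr .work 11 y) e
        else s'.arr .work 11 y) → (∀ y, s₂.arr .work 11 y =
        if y = cm (g.ev e) * F + cm (g.eu e) then cheaper key (s₁.arr .work 11 y) e
        else s₁.arr .work 11 y) →
        IsMatrix g key cm h g.f (· < e + 1) ((s₂.setReg 9 (e + 1)).arr .work 11) := by
      intro s₁ s₂ q1 q2
      have := hm.insert hf e _ _ rfl rfl cu cv ht q1 q2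
      intro i hi j hj
      refine (this i hi j hj).congr fun e' => ?_
      have : e' < e ∨ e' = e ↔ e' < e + 1 := by omega
      exact and_congr_left' this
    refine wp_offer (e := e) (a := cm (g.eu e) * F + cm (g.ev e)) (key := key) (by simp [h9])
      (by simp) (by simpa using hk) (by omega) ?_
    intro x hx
    have second : ∀ s₁ : Store, s₁.reg 9 = e → s₁.reg 13 = F → s₁.reg 16 = cm (g.eu e) →
        s₁.reg 17 = cm (g.ev e) → s₁.rarr .work 2 = key → (∀ y, s₁.arr .work 11 y =
        if y = cm (g.eu e) * F + cm (g.ev e) then cheaper key (s'.arr .work 11 y) e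
        else s'.arr .work 11 y) →
        ((Program.set 18 (rg 17 * rg 13 + rg 16)).wp B ((offer (rg 18)).wp B fun s₂ =>
          IsMatrix g key cm h g.f (· < e + 1) ((s₂.setReg 9 (e + 1)).arr .work 11))) s₁ := by
      intro s₁ r9 r13 r16 r17 rk hmx
      simp only [wp_set, eval_add, eval_mul, eval_reg, r13, r16, r17]
      refine ⟨by omega, ?_⟩
      refine wp_offer (e := e) (a := cm (g.ev e) * F + cm (g.eu e)) (key := key) (by simp [r9])
        (by simp) (by simpa using rk) (by omega) ?_
      intro x hx
      refine ⟨fun hxe => fin s₁ _ hmx fun y => ?_, fin s₁ _ hmx fun y => ?_⟩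
      · simp only [arr_setReg] at hx hxe ⊢
        split_ifs with hy
        · rw [hy, ← hx, ← hxe]
        · rfl
      · simp only [arr_setReg, arr_wr_same] at hx ⊢
        split_ifs with hy
        · rw [hy, ← hx]
        · rfl
    refine ⟨fun hxe => ?_, ?_⟩
    · refine second _ (by simp [h9]) (by simp [h13]) (by simp) (by simp) (by simpa using hk) ?_
      intro y
      simp only [arr_setReg] at hx hxe ⊢
      split_ifs with hy
      · rw [hy, ← hx, ← hxe]
      · rfl
    · refine second _ (by simp [h9]) (by simp [h13]) (by simp) (by simp) (by simpa using hk) ?_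
      intro y
      simp only [arr_setReg, arr_wr_same] at hx ⊢
      split_ifs with hy
      · rw [hy, ← hx]
      · rfl
  · rintro s' - h; exact h

/-! ### A minimum spanning forest on the components -/

/-- The first `cnt` positions of a forest grown greedily: position `q` holds the class `N q`, and
it is attached to the earlier position `PR q - 1` (unless `PR q = 0`) by an edge from `EA q` to
`EB q` of key `K q` which is no more expensive than any edge that leaves the earlier positions. -/
structure Grown (g : Inst) (key : ℕ → ℝ) (cm : ℕ → ℕ) (h cnt : ℕ) (N PR EA EB : ℕ → ℕ)
    (K : ℕ → ℝ) : Prop where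
  le : ∀ q < cnt, N q ≤ h
  inj : ∀ q < cnt, ∀ q' < cnt, N q = N q' → q = q'
  edge : ∀ q < cnt, PR q ≠ 0 → PR q ≤ q ∧ ∃ e < g.m, g.tr e ≠ 1 ∧ g.Joins e (EA q) (EB q) ∧
    cm (EB q) = N q ∧ cm (EA q) = N (PR q - 1) ∧ K q = key e
  greedy : ∀ q' < cnt, ∀ u < q', ∀ i ≤ h, (∀ b < q', N b ≠ i) → ∀ e < g.m,
    g.Links cm e (N u) i → PR q' ≠ 0 ∧ K q' ≤ key e

/-- The best known attachment of the class `i` to the first `cnt` positions. -/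
def Fringe (g : Inst) (key : ℕ → ℝ) (cm : ℕ → ℕ) (cnt : ℕ) (N : ℕ → ℕ) (i bp be : ℕ) : Prop :=
  (bp = 0 ∧ ∀ u < cnt, ∀ e < g.m, ¬ g.Links cm e (N u) i) ∨
  (bp ≠ 0 ∧ bp ≤ cnt ∧ be < g.m ∧ g.Links cm be (N (bp - 1)) i ∧
    ∀ u < cnt, ∀ e < g.m, g.Links cm e (N u) i → key be ≤ key e)

/-- The attachment of `i` is at least as good as that of `i'`. -/
def Better (key : ℕ → ℝ) (bp be : ℕ → ℕ) (i i' : ℕ) : Prop :=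
  bp i' ≠ 0 → bp i ≠ 0 ∧ key (be i) ≤ key (be i')

theorem Better.trans {key : ℕ → ℝ} {bp be : ℕ → ℕ} {i j k : ℕ} (h : Better key bp be i j)
    (h' : Better key bp be j k) : Better key bp be i k := fun hk =>
  ⟨(h (h' hk).1).1, (h (h' hk).1).2.trans (h' hk).2⟩

theorem Better.refl (key : ℕ → ℝ) (bp be : ℕ → ℕ) (i : ℕ) : Better key bp be i i :=
  fun h => ⟨h, le_rfl⟩

/-- Prim's step. The fringe knows the cheapest link to each missing class, and `i` is at least as
good as every missing class; hence its attaching edge costs no more than any edge leaving the listed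
positions. A new tree (`bp i = 0`) is started only when no such edge exists. -/
theorem Grown.push {g : Inst} {key : ℕ → ℝ} {cm : ℕ → ℕ} {h cnt : ℕ} {N PR EA EB : ℕ → ℕ}
    {K : ℕ → ℝ} (hG : Grown g key cm h cnt N PR EA EB K) {bp be : ℕ → ℕ} {i : ℕ} (hi : i ≤ h)
    (hnew : ∀ q < cnt, N q ≠ i)
    (hfr : ∀ i ≤ h, (∀ q < cnt, N q ≠ i) → Fringe g key cm cnt N i (bp i) (be i))
    (hbest : ∀ i' ≤ h, (∀ q < cnt, N q ≠ i') → Better key bp be i i')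
    {N' PR' EA' EB' : ℕ → ℕ} {K' : ℕ → ℝ}
    (hN : ∀ q, N' q = if q = cnt then i else N q)
    (hPR : ∀ q, PR' q = if q = cnt then bp i else PR q)
    (hEA : ∀ q ≠ cnt, EA' q = EA q) (hEB : ∀ q ≠ cnt, EB' q = EB q) (hK : ∀ q ≠ cnt, K' q = K q)
    (hlast : bp i ≠ 0 → g.Joins (be i) (EA' cnt) (EB' cnt) ∧ cm (EB' cnt) = i ∧
      cm (EA' cnt) = N (bp i - 1) ∧ K' cnt = key (be i)) :
    Grown g key cm h (cnt + 1) N' PR' EA' EB' K' := by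
  have oldN : ∀ q < cnt, N' q = N q := fun q hq => by rw [hN, if_neg (by omega)]
  have oldPR : ∀ q < cnt, PR' q = PR q := fun q hq => by rw [hPR, if_neg (by omega)]
  have newN : N' cnt = i := by rw [hN, if_pos rfl]
  have newPR : PR' cnt = bp i := by rw [hPR, if_pos rfl]
  have hcase : ∀ q', q' < cnt + 1 → q' = cnt ∨ q' < cnt := by omega
  refine ⟨fun q hq => ?_, fun q hq q' hq' heq => ?_, fun q hq h0 => ?_, fun q' hq' u hu j hj hb
    e he hl => ?_⟩
  · rcases hcase q hq with rfl | hq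
    · rw [newN]; exact hi
    · rw [oldN q hq]; exact hG.le q hq
  · rcases hcase q hq with rfl | hq <;> rcases hcase q' hq' with rfl | hq'
    · rfl
    · rw [newN, oldN q' hq'] at heq; exact absurd heq.symm (hnew q' hq')
    · rw [newN, oldN q hq] at heq; exact absurd heq (hnew q hq)
    · rw [oldN q hq, oldN q' hq'] at heq; exact hG.inj q hq q' hq' heq
  · rcases hcase q hq with rfl | hq
    · rw [newPR] at h0 ⊢
      rcases hfr i hi hnew with ⟨h1, -⟩ | ⟨-, h1, h2, h3, -⟩
      · exact absurd h1 h0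
      · obtain ⟨k1, k2, k3, k4⟩ := hlast h0
        exact ⟨h1, be i, h2, h3.1, k1, by rw [newN, k2], by rw [oldN _ (by omega), k3], k4⟩
    · rw [oldPR q hq] at h0 ⊢
      obtain ⟨h1, e, he, h2, h3, h4, h5, h6⟩ := hG.edge q hq h0
      refine ⟨h1, e, he, h2, ?_⟩
      rw [hEA q (by omega), hEB q (by omega), hK q (by omega), oldN q hq, oldN _ (by omega)]
      exact ⟨h3, h4, h5, h6⟩
  · rcases hcase q' hq' with rfl | hq'
    · have hb' : ∀ q < q', N q ≠ j := fun b hbb => by rw [← oldN b hbb]; exact hb b hbb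
      rw [oldN u hu] at hl
      rw [newPR]
      rcases hfr j hj hb' with ⟨-, h1⟩ | ⟨h0, -, -, -, h1⟩
      · exact absurd hl (h1 u hu e he)
      · obtain ⟨k1, k2⟩ := hbest j hj hb' h0
        exact ⟨k1, (hlast k1).2.2.2.trans_le (k2.trans (h1 u hu e he hl))⟩
    · rw [oldN u (by omega)] at hl
      rw [oldPR q' hq', hK q' (by omega)]
      exact hG.greedy q' hq' u hu j hj
        (fun b hbb => by rw [← oldN b (by omega)]; exact hb b hbb) e he hl

/-- The only new candidates for class `i` are its edges to the position just added, and the matrix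
entry `x` already holds the cheapest of them; one comparison updates the fringe. -/
theorem Fringe.push {g : Inst} {key : ℕ → ℝ} {cm : ℕ → ℕ} {cnt : ℕ} {N : ℕ → ℕ} {i bp be : ℕ}
    (hf : Fringe g key cm cnt N i bp be) {x : ℕ} {N' : ℕ → ℕ} (hN : ∀ q < cnt, N' q = N q)
    (hx : Cheapest key (fun e => e < g.m ∧ g.Links cm e (N' cnt) i) x) {bp' be' : ℕ}
    (h' : (x ≠ 0 ∧ (bp = 0 ∨ key (x - 1) < key be) ∧ bp' = cnt + 1 ∧ be' = x - 1) ∨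
      (¬ (x ≠ 0 ∧ (bp = 0 ∨ key (x - 1) < key be)) ∧ bp' = bp ∧ be' = be)) :
    Fringe g key cm (cnt + 1) N' i bp' be' := by
  have hcase : ∀ q', q' < cnt + 1 → q' = cnt ∨ q' < cnt := by omega
  rcases h' with ⟨hx0, hc, rfl, rfl⟩ | ⟨hc, rfl, rfl⟩
  · rcases hx with ⟨h, -⟩ | ⟨-, ⟨h1, h2⟩, h3⟩
    · exact absurd h hx0
    · refine .inr ⟨by omega, le_rfl, h1, by simpa using h2, fun u hu e he hl => ?_⟩
      rcases hcase u hu with rfl | hu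
      · exact h3 e ⟨he, hl⟩
      · rw [hN u hu] at hl
        rcases hf with ⟨-, k⟩ | ⟨k0, -, -, -, k⟩
        · exact absurd hl (k u hu e he)
        · rcases hc with hc | hc
          · exact absurd hc k0
          · exact hc.le.trans (k u hu e he hl)
  · rcases hf with ⟨rfl, k⟩ | ⟨k0, k1, k2, k3, k⟩
    · refine .inl ⟨rfl, fun u hu e he hl => ?_⟩
      rcases hcase u hu with rfl | hu
      · rcases hx with ⟨h, h'⟩ | ⟨h, -⟩
        · exact h' e ⟨he, hl⟩
        · exact hc ⟨h, .inl rfl⟩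
      · rw [hN u hu] at hl
        exact k u hu e he hl
    · refine .inr ⟨k0, by omega, k2, by rwa [hN _ (by omega)], fun u hu e he hl => ?_⟩
      rcases hcase u hu with rfl | hu
      · rcases hx with ⟨h, h'⟩ | ⟨h, -, h'⟩
        · exact absurd ⟨he, hl⟩ (h' e)
        · refine le_trans (not_lt.1 fun hlt => hc ⟨h, .inr hlt⟩) (h' e ⟨he, hl⟩)
      · rw [hN u hu] at hl
        exact k u hu e he hl

/-! ### The greedy algorithm -/

def primInit : Program := st .work 12 (rg 9) 0 ;; st .work 13 (rg 9) 0

/-- Register 17 starts at `h + 1`, meaning that nothing is selected. A class without link (`work 13`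
equal to 0) is kept only until a linked one appears. -/
def selBody : Program :=
  .ite (.eq (ld .work 12 (rg 9)) 0)
    (.ite (.eq (rg 17) (rg 12)) (.set 17 (rg 9))
      (.ite (.eq (ld .work 13 (rg 9)) 0) .skip
        (.ite (.eq (ld .work 13 (rg 17)) 0) (.set 17 (rg 9))
          (.ite (.rlt (rld .work 2 (ld .work 14 (rg 9))) (rld .work 2 (ld .work 14 (rg 17))))
            (.set 17 (rg 9)) .skip)))) .skip

/-- The endpoints are stored with an orientation: output array 10 holds the end in the new class,
output array 9 the end in the earlier one. Register 20 is left at the start of the matrix row of the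
new class. -/
def emitNode : Program :=
  st .work 12 (rg 17) 1 ;; .set 18 (rg 15 + rg 16) ;;
  st .output 6 (rg 18) (rg 17) ;; st .output 7 (rg 18) (ld .work 9 (rg 17)) ;;
  st .output 8 (rg 18) (ld .work 13 (rg 17)) ;;
  .set 19 (ld .work 14 (rg 17)) ;; .set 20 (rg 17 * rg 13) ;;
  .ite (.eq (ld .work 13 (rg 17)) 0) .skip
    (rst .output 1 (rg 18) (rld .work 2 (rg 19)) ;;
      .ite (.eq (ld .work 10 (ld .work 0 (rg 19))) (rg 17))
        (st .output 9 (rg 18) (ld .work 1 (rg 19)) ;; st .output 10 (rg 18) (ld .work 0 (rg 19)))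
        (st .output 9 (rg 18) (ld .work 0 (rg 19)) ;; st .output 10 (rg 18) (ld .work 1 (rg 19))))

def relaxBody : Program :=
  .ite (.eq (ld .work 12 (rg 9)) 0)
    (.set 19 (ld .work 11 (rg 20 + rg 9)) ;;
      .ite (.eq (rg 19) 0) .skip
        (.ite (.eq (ld .work 13 (rg 9)) 0)
          (st .work 13 (rg 9) (rg 16 + 1) ;; st .work 14 (rg 9) (rg 19 - 1))
          (.ite (.rlt (rld .work 2 (rg 19 - 1)) (rld .work 2 (ld .work 14 (rg 9))))
            (st .work 13 (rg 9) (rg 16 + 1) ;; st .work 14 (rg 9) (rg 19 - 1)) .skip))) .skip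

def primBody : Program :=
  .set 17 (rg 12) ;; forTo 9 12 selBody ;; emitNode ;; forTo 9 12 relaxBody

def prim : Program := forTo 9 12 primInit ;; forTo 16 12 primBody

/-- The best class among the first `k` unvisited ones has been selected. -/
def Selected (key : ℕ → ℝ) (vis bp be : ℕ → ℕ) (h k x : ℕ) : Prop :=
  (x = h + 1 ∧ ∀ i < k, vis i ≠ 0) ∨
  (x ≤ h ∧ x < k ∧ vis x = 0 ∧ ∀ i < k, vis i = 0 → Better key bp be x i)

theorem selBody_spec {B : ℕ} {s : Store} {key : ℕ → ℝ} {h k x : ℕ} (h9 : s.reg 9 = k)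
    (hk : k ≤ h) (h12 : s.reg 12 = h + 1) (h17 : s.reg 17 = x) (hkey : s.rarr .work 2 = key)
    (hs : Selected key (s.arr .work 12) (s.arr .work 13) (s.arr .work 14) h k x) :
    Runs B selBody s 60 (fun s' =>
      Selected key (s.arr .work 12) (s.arr .work 13) (s.arr .work 14) h (k + 1) (s'.reg 17)) := by
  apply Runs.bdd
  intro hb
  have b9 := hb.reg 9
  have hcase : ∀ q', q' < k + 1 → q' = k ∨ q' < k := by omega
  refine .straight rfl (by decide) ?_
  simp only [selBody, wp_ite, wp_set, wp_skip, holds_eq, holds_rlt, reval_rld, eval_reg, eval_ld,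
    eval_ofNat, h9, h12, h17, hkey]
  rw [h9] at b9
  have take : s.arr .work 12 k = 0 → (∀ i < k, s.arr .work 12 i = 0 →
      Better key (s.arr .work 13) (s.arr .work 14) k i) →
      k ≤ B ∧ Selected key (s.arr .work 12) (s.arr .work 13) (s.arr .work 14) h (k + 1)
        ((s.setReg 17 k).reg 17) := by
    intro hv hbt
    refine ⟨b9, .inr ?_⟩
    simp only [reg_setReg, if_true]
    refine ⟨hk, by omega, hv, fun i hi hvi => ?_⟩
    rcases hcase i hi with rfl | hi
    · exact .refl _ _ _ _
    · exact hbt i hi hvi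
  have keep : x ≠ h + 1 → Better key (s.arr .work 13) (s.arr .work 14) x k →
      Selected key (s.arr .work 12) (s.arr .work 13) (s.arr .work 14) h (k + 1) x := by
    intro hx hbt
    rcases hs with ⟨h1, -⟩ | ⟨h0, h1, h2, h3⟩
    · exact absurd h1 hx
    · refine .inr ⟨h0, by omega, h2, fun i hi hvi => ?_⟩
      rcases hcase i hi with rfl | hi
      · exact hbt
      · exact h3 i hi hvi
  have old : x ≠ h + 1 → ∀ i < k, s.arr .work 12 i = 0 →
      Better key (s.arr .work 13) (s.arr .work 14) x i := by
    intro hx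
    rcases hs with ⟨h1, -⟩ | ⟨-, -, -, h3⟩
    · exact absurd h1 hx
    · exact h3
  refine ⟨fun hv => ⟨fun hx => ?_, fun hx => ⟨fun h0 => ?_, fun h0 => ⟨fun h1 => ?_,
    fun h1 => ⟨fun h2 => ?_, fun h2 => ?_⟩⟩⟩⟩, fun hv => ?_⟩
  · refine take hv fun i hi hvi => ?_
    rcases hs with ⟨-, h1⟩ | ⟨h0, -⟩
    · exact absurd hvi (h1 i hi)
    · omega
  · exact keep hx fun hc => absurd h0 hc
  · refine take hv fun i hi hvi hc => absurd h1 (old hx i hi hvi hc).1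
  · refine take hv fun i hi hvi => Better.trans (fun _ => ⟨h0, h2.le⟩) (old hx i hi hvi)
  · exact keep hx fun _ => ⟨h1, not_lt.1 h2⟩
  · rcases hs with ⟨h1, h2⟩ | ⟨h0, h1, h2, h3⟩
    · refine .inl ⟨h1, fun i hi => ?_⟩
      rcases hcase i hi with rfl | hi
      · exact hv
      · exact h2 i hi
    · refine .inr ⟨h0, by omega, h2, fun i hi hvi => ?_⟩
      rcases hcase i hi with rfl | hi
      · exact absurd hvi hv
      · exact h3 i hi hvi

/-- The cells of the block arrays outside of `[lo, hi)` agree. -/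
structure SameOut (lo hi : ℕ) (s s' : Store) : Prop where
  a6 : ∀ y, y < lo ∨ hi ≤ y → s'.arr .output 6 y = s.arr .output 6 y
  a7 : ∀ y, y < lo ∨ hi ≤ y → s'.arr .output 7 y = s.arr .output 7 y
  a8 : ∀ y, y < lo ∨ hi ≤ y → s'.arr .output 8 y = s.arr .output 8 y
  a9 : ∀ y, y < lo ∨ hi ≤ y → s'.arr .output 9 y = s.arr .output 9 y
  a10 : ∀ y, y < lo ∨ hi ≤ y → s'.arr .output 10 y = s.arr .output 10 y
  r1 : ∀ y, y < lo ∨ hi ≤ y → s'.rarr .output 1 y = s.rarr .output 1 y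

theorem SameOut.trans {lo hi lo' hi' lo'' hi'' : ℕ} {s s' s'' : Store} (h : SameOut lo' hi' s s')
    (h' : SameOut lo'' hi'' s' s'') (h1 : lo ≤ lo') (h2 : lo ≤ lo'') (h3 : hi' ≤ hi)
    (h4 : hi'' ≤ hi) : SameOut lo hi s s'' := by
  constructor <;> intro y hy
  · rw [h'.a6 y (by omega), h.a6 y (by omega)]
  · rw [h'.a7 y (by omega), h.a7 y (by omega)]
  · rw [h'.a8 y (by omega), h.a8 y (by omega)]
  · rw [h'.a9 y (by omega), h.a9 y (by omega)]
  · rw [h'.a10 y (by omega), h.a10 y (by omega)]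
  · rw [h'.r1 y (by omega), h.r1 y (by omega)]

theorem SameOut.frame {lo hi : ℕ} {c : Program} {s s' : Store} (fr : Frame c s s')
    (h6 : c.modArr .output 6 = false := by rfl) (h7 : c.modArr .output 7 = false := by rfl)
    (h8 : c.modArr .output 8 = false := by rfl) (h9 : c.modArr .output 9 = false := by rfl)
    (h10 : c.modArr .output 10 = false := by rfl) (h1 : c.modRArr .output 1 = false := by rfl) :
    SameOut lo hi s s' :=
  ⟨fun _ _ => congrFun (fr.arr .output 6 h6) _, fun _ _ => congrFun (fr.arr .output 7 h7) _,
    fun _ _ => congrFun (fr.arr .output 8 h8) _, fun _ _ => congrFun (fr.arr .output 9 h9) _,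
    fun _ _ => congrFun (fr.arr .output 10 h10) _, fun _ _ => congrFun (fr.rarr .output 1 h1) _⟩

/-- The orientation is found by testing the class of one endpoint only, so the claim on classes
needs `j ≠ i`; in use, `j` is visited and `i` is not. -/
structure Emitted (g : Inst) (key : ℕ → ℝ) (cm : ℕ → ℕ) (p i F : ℕ) (s s' : Store) : Prop where
  vis : ∀ y, s'.arr .work 12 y = if y = i then 1 else s.arr .work 12 y
  row : s'.reg 20 = i * F
  node : s'.arr .output 6 p = i
  top : s'.arr .output 7 p = s.arr .work 9 i
  parent : s'.arr .output 8 p = s.arr .work 13 i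
  edge : s.arr .work 13 i ≠ 0 →
    g.Joins (s.arr .work 14 i) (s'.arr .output 9 p) (s'.arr .output 10 p) ∧
      (∀ j, j ≠ i → g.Links cm (s.arr .work 14 i) j i →
        cm (s'.arr .output 10 p) = i ∧ cm (s'.arr .output 9 p) = j) ∧
      s'.rarr .output 1 p = key (s.arr .work 14 i)
  same : SameOut p (p + 1) s s'

theorem emitNode_spec {B : ℕ} {g : Inst} (hg : g.Valid) {s : Store} (hs : Holds g s)
    {key : ℕ → ℝ} {cm : ℕ → ℕ} {base cnt i F : ℕ} (hkey : s.rarr .work 2 = key)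
    (h15 : s.reg 15 = base) (h16 : s.reg 16 = cnt) (h17 : s.reg 17 = i) (h13 : s.reg 13 = F)
    (hB1 : base + cnt ≤ B) (hB2 : i * F ≤ B) (h1B : 1 ≤ B)
    (he : s.arr .work 13 i ≠ 0 → s.arr .work 14 i < g.m)
    (hcm : ∀ u < g.n, s.arr .work 10 u = cm u) :
    Runs B emitNode s 200 (Emitted g key cm (base + cnt) i F s) := by
  apply Runs.bdd
  intro hb
  have b9 := hb.arr .work 9 i
  have b13 := hb.arr .work 13 i
  have b14 := hb.arr .work 14 i
  have bi := hb.reg 17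
  have beu := hb.arr .work 0 (s.arr .work 14 i)
  have bev := hb.arr .work 1 (s.arr .work 14 i)
  rw [hs.eu] at beu
  rw [hs.ev] at bev
  rw [h17] at bi
  refine .straight rfl (by decide) ?_
  simp [emitNode, h13, h15, h16, h17, hs.eu, hs.ev, hkey]
  refine ⟨h1B, hB1, bi, b9, b13, b14, hB2, fun h0 => ?_, fun h0 => ?_⟩
  · constructor
    case edge => exact fun h => absurd h0 h
    case same => constructor <;> intro y hy <;> simp <;> omega
    all_goals simp
  · have hem := he h0
    have eu := hcm _ (hg.eu_lt _ hem)
    have ev := hcm _ (hg.ev_lt _ hem)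
    rw [eu]
    refine ⟨fun hc => ⟨bev, beu, ?_⟩, fun hc => ⟨beu, bev, ?_⟩⟩
    · constructor
      case edge =>
        refine fun _ => ⟨?_, fun j hj hl => ?_, ?_⟩
        · simp [Inst.Joins]
        · have := hl.2
          simp
          omega
        · simp
      case same => constructor <;> intro y hy <;> simp <;> omega
      all_goals simp
    · constructor
      case edge =>
        refine fun _ => ⟨?_, fun j hj hl => ?_, ?_⟩
        · simp [Inst.Joins]
        · have := hl.2
          simp
          omega
        · simp
      case same => constructor <;> intro y hy <;> simp <;> omega
      all_goals simp

/-- The two alternatives are those expected by `Fringe.push`. -/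
structure Relaxed (key : ℕ → ℝ) (cnt i' x : ℕ) (s s' : Store) : Prop where
  other : ∀ y ≠ i', s'.arr .work 13 y = s.arr .work 13 y ∧ s'.arr .work 14 y = s.arr .work 14 y
  this : s.arr .work 12 i' = 0 →
    (x ≠ 0 ∧ (s.arr .work 13 i' = 0 ∨ key (x - 1) < key (s.arr .work 14 i')) ∧
      s'.arr .work 13 i' = cnt + 1 ∧ s'.arr .work 14 i' = x - 1) ∨
    (¬ (x ≠ 0 ∧ (s.arr .work 13 i' = 0 ∨ key (x - 1) < key (s.arr .work 14 i'))) ∧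
      s'.arr .work 13 i' = s.arr .work 13 i' ∧ s'.arr .work 14 i' = s.arr .work 14 i')

theorem relaxBody_spec {B : ℕ} {s : Store} {key : ℕ → ℝ} {cnt i' row x : ℕ}
    (hkey : s.rarr .work 2 = key) (h9 : s.reg 9 = i') (h16 : s.reg 16 = cnt)
    (h20 : s.reg 20 = row) (hx : s.arr .work 11 (row + i') = x) (hB : cnt + 1 ≤ B) :
    Runs B relaxBody s 100 (Relaxed key cnt i' x s) := by
  apply Runs.bdd
  intro hb
  have bx := hb.arr .work 11 (row + i')
  rw [hx] at bx
  refine .straight rfl (by decide) ?_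
  simp only [relaxBody, wp_ite, wp_seq, wp_set, wp_skip, wp_st, holds_eq, holds_rlt, reval_rld,
    eval_reg, eval_ld, eval_add, eval_sub, eval_ofNat, reg_setReg, arr_setReg, rarr_setReg,
    reg_wr, h9, h16, h20, hx, hkey, if_true, Nat.reduceEqDiff, if_false]
  refine ⟨fun hv => ⟨bx, fun h0 => ?_, fun h0 => ⟨fun h1 => ⟨hB, by omega, ?_⟩, fun h1 =>
    ⟨fun h2 => ⟨hB, by omega, ?_⟩, fun h2 => ?_⟩⟩⟩, fun hv => ?_⟩
  · exact ⟨fun y hy => ⟨rfl, rfl⟩, fun _ => .inr ⟨fun h => h.1 h0, rfl, rfl⟩⟩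
  · refine ⟨fun y hy => by simp [hy], fun _ => .inl ⟨h0, .inl h1, by simp, by simp⟩⟩
  · refine ⟨fun y hy => by simp [hy], fun _ => .inl ⟨h0, .inr h2, by simp, by simp⟩⟩
  · exact ⟨fun y hy => ⟨rfl, rfl⟩, fun _ => .inr ⟨fun h => h.2.elim h1 h2, rfl, rfl⟩⟩
  · exact ⟨fun y hy => ⟨rfl, rfl⟩, fun h => absurd h hv⟩

structure PrimCtx (g : Inst) (key : ℕ → ℝ) (cm X : ℕ → ℕ) (h base : ℕ) (s : Store) : Prop where
  holds : Holds g s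
  r12 : s.reg 12 = h + 1
  r13 : s.reg 13 = g.f + 1
  r15 : s.reg 15 = base
  tops : ∀ i ≤ h, s.arr .work 9 i = X i
  comp : ∀ u < g.n, s.arr .work 10 u = cm u
  mx : IsMatrix g key cm h g.f (· < g.m) (s.arr .work 11)
  key : s.rarr .work 2 = key

theorem PrimCtx.frame {g : Inst} {key : ℕ → ℝ} {cm X : ℕ → ℕ} {h base : ℕ} {s s' : Store}
    {c : Program} (hc : PrimCtx g key cm X h base s) (fr : Frame c s s')
    (hh : Holds g s → Frame c s s' → Holds g s' := by exact fun h fr => h.frame fr)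
    (h12 : c.modReg 12 = false := by rfl) (h13 : c.modReg 13 = false := by rfl)
    (h15 : c.modReg 15 = false := by rfl) (h9 : c.modArr .work 9 = false := by rfl)
    (h10 : c.modArr .work 10 = false := by rfl) (h11 : c.modArr .work 11 = false := by rfl)
    (h2 : c.modRArr .work 2 = false := by rfl) : PrimCtx g key cm X h base s' :=
  ⟨hh hc.holds fr, (fr.reg 12 h12).trans hc.r12, (fr.reg 13 h13).trans hc.r13,
    (fr.reg 15 h15).trans hc.r15, (fr.arr .work 9 h9) ▸ hc.tops, (fr.arr .work 10 h10) ▸ hc.comp,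
    (fr.arr .work 11 h11) ▸ hc.mx, (fr.rarr .work 2 h2).trans hc.key⟩

abbrev GrownIn (g : Inst) (key : ℕ → ℝ) (cm : ℕ → ℕ) (h base cnt : ℕ) (s : Store) : Prop :=
  Grown g key cm h cnt (fun q => s.arr .output 6 (base + q)) (fun q => s.arr .output 8 (base + q))
    (fun q => s.arr .output 9 (base + q)) (fun q => s.arr .output 10 (base + q))
    (fun q => s.rarr .output 1 (base + q))

structure PrimInv (g : Inst) (key : ℕ → ℝ) (cm X : ℕ → ℕ) (h base cnt : ℕ) (s : Store) : Prop where
  grown : GrownIn g key cm h base cnt s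
  tops : ∀ q < cnt, s.arr .output 7 (base + q) = X (s.arr .output 6 (base + q))
  vis : ∀ i ≤ h, s.arr .work 12 i ≠ 0 ↔ ∃ q < cnt, s.arr .output 6 (base + q) = i
  fringe : ∀ i ≤ h, s.arr .work 12 i = 0 → Fringe g key cm cnt
    (fun q => s.arr .output 6 (base + q)) i (s.arr .work 13 i) (s.arr .work 14 i)

theorem PrimInv.congr {g : Inst} {key : ℕ → ℝ} {cm X : ℕ → ℕ} {h base cnt : ℕ} {s s' : Store}
    (hI : PrimInv g key cm X h base cnt s) (h6 : s'.arr .output 6 = s.arr .output 6)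
    (h7 : s'.arr .output 7 = s.arr .output 7) (h8 : s'.arr .output 8 = s.arr .output 8)
    (h9 : s'.arr .output 9 = s.arr .output 9) (h10 : s'.arr .output 10 = s.arr .output 10)
    (h1 : s'.rarr .output 1 = s.rarr .output 1) (w12 : s'.arr .work 12 = s.arr .work 12)
    (w13 : s'.arr .work 13 = s.arr .work 13) (w14 : s'.arr .work 14 = s.arr .work 14) :
    PrimInv g key cm X h base cnt s' := by
  obtain ⟨a, b, c, d⟩ := hI
  constructor
  · simpa only [GrownIn, h6, h8, h9, h10, h1] using a
  · simpa only [h6, h7] using b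
  · simpa only [h6, w12] using c
  · simpa only [h6, w12, w13, w14] using d

theorem PrimInv.exists_unvisited {g : Inst} {key : ℕ → ℝ} {cm X : ℕ → ℕ} {h base cnt : ℕ}
    {s : Store} (hI : PrimInv g key cm X h base cnt s) (hcnt : cnt ≤ h) :
    ∃ i ≤ h, s.arr .work 12 i = 0 := by
  by_contra! hc
  have := Finset.card_le_card_of_surjOn (s := Finset.range cnt) (t := Finset.range (h + 1))
    (fun q => s.arr .output 6 (base + q)) (fun i hi => by
      obtain ⟨q, hq, e⟩ := (hI.vis i (by simpa [Nat.lt_succ_iff] using hi)).1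
        (hc i (by simpa [Nat.lt_succ_iff] using hi))
      exact ⟨q, by simpa using hq, e⟩)
  simp at this
  omega

/-- A round selects a best missing class, writes it and relaxes along its matrix row, in time linear
in `h`. Writes go only into the block `[base, base + f + 1)`, so blocks of other vertices survive.
-/
theorem primBody_spec {B : ℕ} {g : Inst} (hg : g.Valid) {s : Store} {key : ℕ → ℝ}
    {cm X : ℕ → ℕ} {h base cnt : ℕ} (hf : h ≤ g.f) (hctx : PrimCtx g key cm X h base s)
    (hcnt : cnt ≤ h) (h16 : s.reg 16 = cnt) (hB : base + g.f + 1 ≤ B)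
    (hBf : (g.f + 1) * (g.f + 1) ≤ B) (hI : PrimInv g key cm X h base cnt s) :
    Runs B primBody s ((h + 1) * 200 + 300) (fun s' =>
      PrimInv g key cm X h base (cnt + 1) s' ∧ SameOut base (base + g.f + 1) s s') := by
  set F := g.f + 1 with hF
  have h12 := hctx.r12
  have hkey := hctx.key
  refine .seq 5 ((h + 1) * 200 + 295) (fun s' => s' = s.setReg 17 (h + 1))
    (.straight rfl (by decide) (by simp [h12]; omega)) (by omega) ?_
  rintro _ fr0 hb0 rfl
  have hctx0 := hctx.frame fr0
  -- selection
  refine .seq ((h + 1) * 68 + 8) ((h + 1) * 120 + 280) _ (Runs.forTo (Q := fun s' =>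
      Selected key (s.arr .work 12) (s.arr .work 13) (s.arr .work 14) h (h + 1) (s'.reg 17))
      (h + 1) 60 _
      (fun k s' => Selected key (s.arr .work 12) (s.arr .work 13) (s.arr .work 14) h k (s'.reg 17))
      hctx0.r12 rfl rfl rfl le_rfl ?_ ?_ ?_) (by omega) ?_
  · exact .inl ⟨by simp, by simp⟩
  · rintro k s' hk h9 - fr hb hsel
    have e1 := fr.arr .work 12
    have e2 := fr.arr .work 13
    have e3 := fr.arr .work 14
    simp only [arr_setReg] at e1 e2 e3
    rw [← e1, ← e2, ← e3] at hsel
    refine (selBody_spec h9 (by omega) ((fr.reg 12).trans hctx0.r12) rfl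
      ((fr.rarr .work 2).trans hctx0.key) hsel).mono le_rfl ?_
    intro s'' fr'' _ h''
    rw [e1, e2, e3] at h''
    simpa using h''
  · rintro s' - hsel; exact hsel
  rintro s1 fr1 hb1 hsel
  have hctx1 := hctx0.frame fr1
  have fr1' : ∀ (b : Bank) (k : ℕ), k < 16 → s1.arr b k = s.arr b k := fun b k hk =>
    (fr1.arr b k (by cases b <;> rfl) hk)
  have fr1r : s1.rarr .output 1 = s.rarr .output 1 := fr1.rarr .output 1
  have hI1 : PrimInv g key cm X h base cnt s1 := hI.congr (fr1' _ _ (by omega))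
    (fr1' _ _ (by omega)) (fr1' _ _ (by omega)) (fr1' _ _ (by omega)) (fr1' _ _ (by omega)) fr1r
    (fr1' _ _ (by omega)) (fr1' _ _ (by omega)) (fr1' _ _ (by omega))
  have same1 : SameOut base (base + g.f + 1) s s1 := ⟨fun _ _ => congrFun (fr1' _ _ (by omega)) _,
    fun _ _ => congrFun (fr1' _ _ (by omega)) _, fun _ _ => congrFun (fr1' _ _ (by omega)) _,
    fun _ _ => congrFun (fr1' _ _ (by omega)) _, fun _ _ => congrFun (fr1' _ _ (by omega)) _,
    fun _ _ => congrFun fr1r _⟩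
  obtain ⟨i0, hi0, hv0⟩ := hI.exists_unvisited hcnt
  generalize hi : s1.reg 17 = i at hsel
  -- Fewer than `h + 1` classes have been listed, so some class is unvisited and the sentinel cannot
  -- be the result.
  obtain ⟨hih, -, hvi, hbest⟩ := hsel.resolve_left fun hc => hc.2 i0 (by omega) hv0
  rw [← fr1' .work 12 (by omega)] at hvi hbest
  rw [← fr1' .work 13 (by omega), ← fr1' .work 14 (by omega)] at hbest
  clear hsel
  have unv : ∀ i ≤ h, s1.arr .work 12 i = 0 ↔ ∀ q < cnt, s1.arr .output 6 (base + q) ≠ i := by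
    intro i hi
    have := hI1.vis i hi
    constructor
    · intro h0 q hq hc; exact this.2 ⟨q, hq, hc⟩ h0
    · intro h0; by_contra hc; obtain ⟨q, hq, he⟩ := this.1 hc; exact h0 q hq he
  have hfr := hI1.fringe i hih hvi
  have hiF : i * F ≤ B := by nlinarith
  have h16' := (fr1.reg 16).trans ((fr0.reg 16).trans h16)
  refine .seq 200 ((h + 1) * 120 + 80) _ (emitNode_spec hg hctx1.holds hctx1.key hctx1.r15
    h16' hi hctx1.r13 (by omega) hiF (by omega) ?_ hctx1.comp) (by omega) ?_
  · intro h0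
    rcases hfr with ⟨h1, -⟩ | ⟨-, -, h1, -⟩
    · exact absurd h1 h0
    · exact h1
  rintro s2 fr2 hb2 he
  have hctx2 := hctx1.frame fr2
  have hN : ∀ q, s2.arr .output 6 (base + q) =
      if q = cnt then i else s1.arr .output 6 (base + q) := by
    intro q
    split_ifs with hq
    · rw [hq, he.node]
    · exact he.same.a6 _ (by omega)
  have hgrown : GrownIn g key cm h base (cnt + 1) s2 := by
    refine hI1.grown.push (bp := s1.arr .work 13) (be := s1.arr .work 14) (i := i) hih
      ((unv i hih).1 hvi) (fun j hj hju => hI1.fringe j hj ((unv j hj).2 hju))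
      (fun j hj hju => hbest j (by omega) ((unv j hj).2 hju)) hN (fun q => ?_)
      (fun q hq => he.same.a9 _ (by omega)) (fun q hq => he.same.a10 _ (by omega))
      (fun q hq => he.same.r1 _ (by omega)) (fun h0 => ?_)
    · split_ifs with hq
      · rw [hq, he.parent]
      · exact he.same.a8 _ (by omega)
    · rcases hfr with ⟨h1, -⟩ | ⟨-, h1, -, h2, -⟩
      · exact absurd h1 h0
      · obtain ⟨k1, k2, k3⟩ := he.edge h0
        have := k2 _ ((unv i hih).1 hvi _ (by omega)) h2
        exact ⟨k1, this.1, this.2, k3⟩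
  have htops : ∀ q < cnt + 1, s2.arr .output 7 (base + q) = X (s2.arr .output 6 (base + q)) := by
    intro q hq
    rw [hN]
    split_ifs with hqc
    · rw [hqc, he.top, hctx1.tops i hih]
    · rw [he.same.a7 _ (by omega), hI1.tops q (by omega)]
  have hvis : ∀ j ≤ h, s2.arr .work 12 j ≠ 0 ↔
      ∃ q < cnt + 1, s2.arr .output 6 (base + q) = j := by
    intro j hj
    rw [he.vis]
    constructor
    · split_ifs with hji
      · intro _; exact ⟨cnt, by omega, by rw [hN, if_pos rfl, hji]⟩
      · intro h0
        obtain ⟨q, hq, e⟩ := (hI1.vis j hj).1 h0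
        exact ⟨q, by omega, by rw [hN, if_neg (by omega), e]⟩
    · rintro ⟨q, hq, e⟩
      rw [hN] at e
      split_ifs with hji
      · exact one_ne_zero
      · split_ifs at e with hqc
        · exact absurd e.symm hji
        · exact (hI1.vis j hj).2 ⟨q, by omega, e⟩
  have e13 := fr2.arr .work 13
  have e14 := fr2.arr .work 14
  have same2 : SameOut base (base + g.f + 1) s s2 :=
    same1.trans he.same le_rfl (by omega) le_rfl (by omega)
  have h16'' := (fr2.reg 16).trans h16'
  -- relaxation
  refine Runs.mono (T := (h + 1) * 108 + 8) (Q := fun s' => ∀ j ≤ h, s2.arr .work 12 j = 0 →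
      Fringe g key cm (cnt + 1) (fun q => s2.arr .output 6 (base + q)) j
        (s'.arr .work 13 j) (s'.arr .work 14 j)) (Runs.forTo (h + 1) 100 _
      (fun k s' => ∀ j ≤ h, s2.arr .work 12 j = 0 →
        (j < k → Fringe g key cm (cnt + 1) (fun q => s2.arr .output 6 (base + q)) j
        (s'.arr .work 13 j) (s'.arr .work 14 j)) ∧
        (k ≤ j → s'.arr .work 13 j = s1.arr .work 13 j ∧ s'.arr .work 14 j = s1.arr .work 14 j))
      hctx2.r12 rfl rfl rfl le_rfl ?_ ?_ ?_) (by omega) ?_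
  · intro j hj hv
    exact ⟨by simp, fun _ => ⟨by simp [e13], by simp [e14]⟩⟩
  · rintro k s' hk h9 - fr hb inv
    have e12 := fr.arr .work 12
    have e11 := fr.arr .work 11
    have h20 : s'.reg 20 = i * F := (fr.reg 20).trans (by rw [he.row])
    refine (relaxBody_spec (x := s2.arr .work 11 (i * F + k)) ((fr.rarr .work 2).trans hctx2.key)
      h9 ((fr.reg 16).trans h16'') h20 (by rw [e11]) (by omega)).mono le_rfl ?_
    rintro s'' - - hr
    intro j hj hv
    obtain ⟨i1, i2⟩ := inv j hj hv
    simp only [arr_setReg]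
    by_cases hjk : j = k
    · subst hjk
      refine ⟨fun _ => ?_, fun hc => by omega⟩
      obtain ⟨b1, b2⟩ := i2 le_rfl
      have hv1 : s1.arr .work 12 j = 0 := by
        rw [he.vis] at hv
        split_ifs at hv
        exact hv
      have hr := hr.this (by rw [e12, hv])
      rw [b1, b2] at hr
      refine (hI1.fringe j hj hv1).push (fun q hq => ?_) ?_ hr
      · rw [hN, if_neg (by omega)]
      · have hx := hctx2.mx i hih j hj
        simp only [hN, if_true]
        exact hx
    · obtain ⟨o1, o2⟩ := hr.other j hjk
      rw [o1, o2]
      exact ⟨fun hj' => i1 (by omega), fun hj' => i2 (by omega)⟩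
  · rintro s' - inv j hj hv
    exact (inv j hj hv).1 (by omega)
  · rintro s3 fr3 hb3 hfin
    have w6 := fr3.arr .output 6
    have w7 := fr3.arr .output 7
    have w12 := fr3.arr .work 12
    refine ⟨⟨?_, ?_, ?_, ?_⟩, same2.trans (SameOut.frame (lo := base) (hi := base + g.f + 1) fr3)
      le_rfl le_rfl le_rfl le_rfl⟩
    · have w8 := fr3.arr .output 8
      have w9 := fr3.arr .output 9
      have w10 := fr3.arr .output 10
      have w1 := fr3.rarr .output 1
      simpa only [GrownIn, w6, w8, w9, w10, w1] using hgrown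
    · simpa only [w6, w7] using htops
    · simpa only [w6, w12] using hvis
    · simpa only [w6, w12] using hfin

theorem prim_spec {B : ℕ} {g : Inst} (hg : g.Valid) {s : Store} {key : ℕ → ℝ}
    {cm X : ℕ → ℕ} {h base : ℕ} (hf : h ≤ g.f) (hctx : PrimCtx g key cm X h base s)
    (hB : base + g.f + 1 ≤ B) (hBf : (g.f + 1) * (g.f + 1) ≤ B) :
    Runs B prim s ((h + 1) * ((h + 1) * 200 + 350) + 30) (fun s' =>
      GrownIn g key cm h base (h + 1) s' ∧
      (∀ q ≤ h, s'.arr .output 7 (base + q) = X (s'.arr .output 6 (base + q))) ∧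
      SameOut base (base + g.f + 1) s s') := by
  refine .seq ((h + 1) * 38 + 8) ((h + 1) * ((h + 1) * 200 + 308) + 8) _ (Runs.forTo (Q := fun s' =>
      ∀ i ≤ h, s'.arr .work 12 i = 0 ∧ s'.arr .work 13 i = 0)
      (h + 1) 30 _ (fun k s' => ∀ i < k, s'.arr .work 12 i = 0 ∧ s'.arr .work 13 i = 0)
      hctx.r12 rfl rfl rfl le_rfl ?_ ?_ ?_) (by nlinarith) ?_
  · simp
  · rintro k s' hk h9 - fr hb inv
    refine .straight rfl (by decide) ?_
    simp only [primInit, wp_seq, wp_st, eval_ofNat, eval_reg, reg_wr, h9]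
    refine ⟨by omega, by omega, fun j hj => ?_⟩
    by_cases hjk : j = k
    · simp [hjk]
    · simpa [hjk] using inv j (by omega)
  · rintro s' - inv i hi; exact inv i (by omega)
  rintro s1 fr1 hb1 hz
  have hctx1 := hctx.frame fr1
  have same1 : SameOut base (base + g.f + 1) s s1 := SameOut.frame fr1
  refine Runs.forTo (h + 1) ((h + 1) * 200 + 300) _ (fun k s' => PrimInv g key cm X h base k s' ∧
      SameOut base (base + g.f + 1) s s') hctx1.r12 rfl rfl rfl le_rfl ?_ ?_ ?_
  · refine ⟨⟨⟨?_, ?_, ?_, ?_⟩, ?_, ?_, ?_⟩, ?_⟩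
    any_goals simp
    · intro i hi; exact (hz i hi).1
    · intro i hi _; exact .inl ⟨(hz i hi).2, by simp⟩
    · exact ⟨same1.a6, same1.a7, same1.a8, same1.a9, same1.a10, same1.r1⟩
  · rintro k s' hk h16 - fr hb ⟨inv, same⟩
    refine (primBody_spec hg hf (hctx1.frame fr) (by omega) h16 hB hBf inv).mono le_rfl ?_
    rintro s'' fr'' - ⟨h1, h2⟩
    have h3 := same.trans h2 le_rfl le_rfl le_rfl le_rfl
    refine ⟨h1.congr ?_ ?_ ?_ ?_ ?_ ?_ ?_ ?_ ?_, ?_⟩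
    any_goals rfl
    exact ⟨h3.a6, h3.a7, h3.a8, h3.a9, h3.a10, h3.r1⟩
  · rintro s' - ⟨inv, same⟩
    exact ⟨inv.grown, fun q hq => inv.tops q (by omega), same⟩

/-! ### The preprocessing -/

def blockBody : Program := setH ;; tops ;; comps ;; matrix ;; prim

structure BlockCtx (g : Inst) (ord par dep : ℕ → ℕ) (dist : ℕ → ℝ) (s : Store) : Prop where
  holds : Holds g s
  ord : s.arr .work 3 = ord
  par : s.arr .output 1 = par
  dep : s.arr .output 2 = dep
  r13 : s.reg 13 = g.f + 1
  r14 : s.reg 14 = (g.f + 1) * (g.f + 1)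
  key : ∃ key, s.rarr .work 2 = key ∧ ∀ e < g.m, key e = g.key dist e

/-- Needed because the key array of the machine agrees with the mathematical keys only at actual
edges. -/
theorem Grown.congr_key {g : Inst} {key key' : ℕ → ℝ} {cm : ℕ → ℕ} {h cnt : ℕ}
    {N PR EA EB : ℕ → ℕ} {K : ℕ → ℝ} (hG : Grown g key cm h cnt N PR EA EB K)
    (hk : ∀ e < g.m, key e = key' e) : Grown g key' cm h cnt N PR EA EB K := by
  refine ⟨hG.le, hG.inj, fun q hq h0 => ?_, fun q' hq' u hu i hi hb e he hl => ?_⟩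
  · obtain ⟨h1, e, he, h2, h3, h4, h5, h6⟩ := hG.edge q hq h0
    exact ⟨h1, e, he, h2, h3, h4, h5, h6.trans (hk e he)⟩
  · obtain ⟨h1, h2⟩ := hG.greedy q' hq' u hu i hi hb e he hl
    exact ⟨h1, (hk e he) ▸ h2⟩

structure BlockDone (g : Inst) (par : ℕ → ℕ) (dist : ℕ → ℝ) (v h : ℕ) (s s' : Store) :
    Prop where
  height : s'.arr .output 5 v = h
  other : ∀ y ≠ v, s'.arr .output 5 y = s.arr .output 5 y
  grown : GrownIn g (g.key dist) (cmp par v h) h (v * (g.f + 1)) (h + 1) s'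
  tops : ∀ q ≤ h, s'.arr .output 7 (v * (g.f + 1) + q) =
    top par g.r v h (s'.arr .output 6 (v * (g.f + 1) + q))
  same : SameOut (v * (g.f + 1)) (v * (g.f + 1) + g.f + 1) s s'

structure HeightSet (g : Inst) (v h : ℕ) (s s' : Store) : Prop where
  r8 : s'.reg 8 = v
  r11 : s'.reg 11 = h
  r12 : s'.reg 12 = h + 1
  r15 : s'.reg 15 = v * (g.f + 1)
  out : ∀ y, s'.arr .output 5 y = if y = v then h else s.arr .output 5 y

/-- Classes cost `O(n + h)`, the matrix `O(f² + m)` and Prim's algorithm `O(h²)`. Summed over all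
`v` this is the dominant cost of the preprocessing. -/
theorem blockBody_spec {B : ℕ} {g : Inst} (hg : g.Valid) {s : Store} {ord par dep : ℕ → ℕ}
    {dist : ℕ → ℝ} (ht : Rooted g ord par dep dist) (hctx : BlockCtx g ord par dep dist s)
    {v : ℕ} (hv : v < g.n) (h7 : s.reg 7 = v) (hBm : g.m ≤ B)
    (hBn : g.n * (g.f + 1) ≤ B) (hBf : (g.f + 1) * (g.f + 1) ≤ B) :
    Runs B blockBody s (g.n * 100 + g.m * 158 + (g.f + 1) * (g.f + 1) * 1000 + 300)
      (BlockDone g par dist v (min g.f (dep v)) s) := by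
  obtain ⟨hs, hord, hpar, hdep, h13, h14, key, hk, hkey⟩ := hctx
  set F := g.f + 1 with hF
  generalize hh : min g.f (dep v) = h
  have hhf : h ≤ g.f := by omega
  have hhd : h ≤ dep v := by omega
  have hFB : F ≤ B := by nlinarith
  have hvF : v * F + F ≤ B := by
    have : v + 1 ≤ g.n := hv
    nlinarith
  have hvB : v ≤ B := by nlinarith
  obtain ⟨FF, hFF⟩ : ∃ FF, FF = F * F := ⟨_, rfl⟩
  have hhFF : h + 1 ≤ FF := by
    have : h + 1 ≤ F := by omega
    nlinarith
  rw [← hFF]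
  refine .seq 60 (g.n * 100 + g.m * 158 + FF * 1000 + 240) (HeightSet g v h s) ?_
    (by omega) ?_
  · refine .straight rfl (by decide) ?_
    simp only [setH, wp_seq, wp_ite, wp_set, wp_st, holds_lt, eval_ld, eval_reg, eval_add,
      eval_mul, eval_ofNat, reg_setReg, reg_wr, h7, hs.f, h13, hdep, if_true,
      Nat.reduceEqDiff, if_false]
    refine ⟨fun hc => ?_, fun hc => ?_⟩
    · have : dep v = h := by omega
      rw [this]
      refine ⟨by omega, by omega, by omega, by omega, hvB, ?_⟩
      constructor <;> simp [hF]
    · have : g.f = h := by omega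
      rw [this]
      refine ⟨by omega, by omega, by omega, by omega, hvB, ?_⟩
      constructor <;> simp [hF]
  rintro s1 fr1 - hset
  have hs1 := hs.frame fr1
  have p1 := (fr1.arr .output 1).trans hpar
  refine .seq (h * 30 + 20) (g.n * 100 + g.m * 158 + FF * 900 + 200) _
    (tops_spec hs1 hset.r8 hset.r11) (by omega) ?_
  rintro s2 fr2 - htop
  have hs2 := hs1.frame fr2
  have p2 := (fr2.arr .output 1).trans p1
  have o2 := (fr2.arr .work 3).trans ((fr1.arr .work 3).trans hord)
  have h11 := (fr2.reg 11).trans hset.r11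
  have h12 := (fr2.reg 12).trans hset.r12
  have ht2 : Rooted g (s2.arr .work 3) (s2.arr .output 1) dep dist := by rw [p2, o2]; exact ht
  rw [p1, ← p2] at htop
  refine .seq (g.n * 100 + h * 20 + 50) (g.m * 158 + FF * 800 + 150) _
    (comps_spec hs2 ht2 hv hhd h11 h12 htop) (by omega) ?_
  rintro s3 fr3 - hcomp
  rw [p2] at hcomp htop
  have hs3 := hs2.frame fr3
  refine .seq (F * F * 20 + g.m * 158 + 20) (FF * 700 + 100) _
    (matrix_spec (cm := cmp par v h) (h := h) hg hs3 hBm hBf hhf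
      ((fr3.rarr .work 2).trans ((fr2.rarr .work 2).trans ((fr1.rarr .work 2).trans hk)))
      ((fr3.reg 13).trans ((fr2.reg 13).trans ((fr1.reg 13).trans h13)))
      ((fr3.reg 14).trans ((fr2.reg 14).trans ((fr1.reg 14).trans h14))) hcomp
      (cmp_le par v h)) (by omega) ?_
  rintro s4 fr4 - hmx
  have hctx4 : PrimCtx g key (cmp par v h) (top par g.r v h) h (v * F) s4 := by
    refine ⟨hs3.frame fr4, (fr4.reg 12).trans ((fr3.reg 12).trans h12),
      (fr4.reg 13).trans ((fr3.reg 13).trans ((fr2.reg 13).trans ((fr1.reg 13).trans h13))),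
      (fr4.reg 15).trans ((fr3.reg 15).trans ((fr2.reg 15).trans hset.r15)), ?_, ?_, hmx,
      (fr4.rarr .work 2).trans ((fr3.rarr .work 2).trans ((fr2.rarr .work 2).trans
        ((fr1.rarr .work 2).trans hk)))⟩
    · rw [fr4.arr .work 9, fr3.arr .work 9]; exact htop
    · rw [fr4.arr .work 10]; exact hcomp
  have hbound : (h + 1) * ((h + 1) * 200 + 350) ≤ FF * 550 := by
    have : h + 1 ≤ F := by omega
    have : (h + 1) * (h + 1) ≤ FF := hFF ▸ Nat.mul_le_mul this this
    nlinarith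
  refine (prim_spec hg hhf hctx4 (by omega) hBf).mono
    ((Nat.add_le_add_right hbound 30).trans (by omega)) ?_
  rintro s5 fr5 - ⟨hgr, htp, hsame⟩
  have e5 : s5.arr .output 5 = s1.arr .output 5 := (fr5.arr .output 5).trans
    ((fr4.arr .output 5).trans ((fr3.arr .output 5).trans (fr2.arr .output 5)))
  refine ⟨by rw [e5, hset.out, if_pos rfl], fun y hy => by rw [e5, hset.out, if_neg hy],
    hgr.congr_key hkey, htp, ?_⟩
  have q1 : SameOut (v * F) (v * F + g.f + 1) s s1 := SameOut.frame fr1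
  have q2 : SameOut (v * F) (v * F + g.f + 1) s1 s2 := SameOut.frame fr2
  have q3 : SameOut (v * F) (v * F + g.f + 1) s2 s3 := SameOut.frame fr3
  have q4 : SameOut (v * F) (v * F + g.f + 1) s3 s4 := SameOut.frame fr4
  exact (((q1.trans q2 le_rfl le_rfl le_rfl le_rfl).trans q3 le_rfl le_rfl le_rfl le_rfl).trans q4
    le_rfl le_rfl le_rfl le_rfl).trans hsame le_rfl le_rfl le_rfl le_rfl

/-- The arrays `A`, `R` form an oracle for the instance. -/
structure IsOracle (g : Inst) (A : ℕ → ℕ → ℕ) (R : ℕ → ℕ → ℝ) : Prop where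
  f : A 0 0 = g.f
  rooted : ∃ ord, Rooted g ord (A 1) (A 2) (R 0)
  label : ∀ x < g.n, ∀ y < g.n, (Anc (A 1) x y ↔ A 3 x ≤ A 3 y ∧ A 3 y < A 4 x)
  height : ∀ v < g.n, A 5 v = min g.f (A 2 v)
  grown : ∀ v < g.n, Grown g (g.key (R 0)) (cmp (A 1) v (A 5 v)) (A 5 v) (A 5 v + 1)
    (fun q => A 6 (v * (g.f + 1) + q)) (fun q => A 8 (v * (g.f + 1) + q))
    (fun q => A 9 (v * (g.f + 1) + q)) (fun q => A 10 (v * (g.f + 1) + q))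
    (fun q => R 1 (v * (g.f + 1) + q))
  tops : ∀ v < g.n, ∀ q ≤ A 5 v, A 7 (v * (g.f + 1) + q) =
    top (A 1) g.r v (A 5 v) (A 6 (v * (g.f + 1) + q))

def consts : Program :=
  .set 13 (rg 3 + 1) ;; .set 14 (rg 13 * rg 13) ;; st .output 0 0 (rg 3)

def keyBody : Program :=
  rst .work 2 (rg 9) (rld .output 0 (ld .work 0 (rg 9)) + rld .work 0 (rg 9) +
    rld .output 0 (ld .work 1 (rg 9)))

def build : Program :=
  copyInput ;; bfs ;; labels ;; consts ;; forTo 9 1 keyBody ;; forTo 7 0 blockBody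

theorem keys_spec {B : ℕ} {g : Inst} {s : Store} (hs : Holds g s) :
    Runs B (forTo 9 1 keyBody) s (g.m * 68 + 8) (fun s' =>
      ∀ e < g.m, s'.rarr .work 2 e = g.key (s.rarr .output 0) e) := by
  refine Runs.forTo g.m 60 _ (fun k s' => ∀ e < k, s'.rarr .work 2 e =
    g.key (s.rarr .output 0) e) hs.m rfl rfl rfl le_rfl ?_ ?_ ?_
  · simp
  · rintro k s' hk h9 - fr hb inv
    have hs' := hs.frame fr
    have e0 := fr.rarr .output 0
    refine .straight rfl (by decide) ?_
    simp only [keyBody, wp_rst, eval_reg, reval_add, reval_rld, eval_ld, h9, hs'.eu, hs'.ev,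
      hs'.wt, e0]
    intro e he
    simp only [rarr_setReg, rarr_rwr_same]
    split_ifs with hek
    · rw [hek]; rfl
    · exact inv e (by omega)
  · rintro s' - inv; exact inv

/-- The blocks of different vertices are disjoint intervals, so earlier results persist; the
remaining part of each statement only transports `Grown` across writes outside its block. -/
theorem blocks_spec {B : ℕ} {g : Inst} (hg : g.Valid) {s : Store} {ord par dep : ℕ → ℕ}
    {dist : ℕ → ℝ} (ht : Rooted g ord par dep dist) (hctx : BlockCtx g ord par dep dist s)
    (hBm : g.m ≤ B) (hBn : g.n * (g.f + 1) ≤ B) (hBf : (g.f + 1) * (g.f + 1) ≤ B) :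
    Runs B (forTo 7 0 blockBody) s
      (g.n * (g.n * 100 + g.m * 158 + (g.f + 1) * (g.f + 1) * 1000 + 308) + 8) (fun s' =>
        (∀ v < g.n, s'.arr .output 5 v = min g.f (dep v) ∧
          GrownIn g (g.key dist) (cmp par v (min g.f (dep v))) (min g.f (dep v))
            (v * (g.f + 1)) (min g.f (dep v) + 1) s' ∧
          ∀ q ≤ min g.f (dep v), s'.arr .output 7 (v * (g.f + 1) + q) =
            top par g.r v (min g.f (dep v)) (s'.arr .output 6 (v * (g.f + 1) + q))) ∧
        SameOut 0 (g.n * (g.f + 1)) s s' ∧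
        ∀ y, g.n ≤ y → s'.arr .output 5 y = s.arr .output 5 y) := by
  refine Runs.forTo g.n (g.n * 100 + g.m * 158 + (g.f + 1) * (g.f + 1) * 1000 + 300) _
    (fun k s' => (∀ v < k, s'.arr .output 5 v = min g.f (dep v) ∧
          GrownIn g (g.key dist) (cmp par v (min g.f (dep v))) (min g.f (dep v))
            (v * (g.f + 1)) (min g.f (dep v) + 1) s' ∧
          ∀ q ≤ min g.f (dep v), s'.arr .output 7 (v * (g.f + 1) + q) =
            top par g.r v (min g.f (dep v)) (s'.arr .output 6 (v * (g.f + 1) + q))) ∧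
        SameOut 0 (k * (g.f + 1)) s s' ∧
        ∀ y, k ≤ y → s'.arr .output 5 y = s.arr .output 5 y)
    hctx.holds.n rfl rfl rfl (by nlinarith) ?_ ?_ ?_
  · refine ⟨by simp, ?_, by simp⟩
    constructor <;> intros <;> rfl
  · rintro v s' hv h7 - fr hb ⟨i1, i2, i3⟩
    obtain ⟨key, hk, hkey⟩ := hctx.key
    have hctx' : BlockCtx g ord par dep dist s' :=
      ⟨hctx.holds.frame fr, (fr.arr .work 3).trans hctx.ord, (fr.arr .output 1).trans hctx.par,
        (fr.arr .output 2).trans hctx.dep, (fr.reg 13).trans hctx.r13,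
        (fr.reg 14).trans hctx.r14, key, (fr.rarr .work 2).trans hk, hkey⟩
    refine (blockBody_spec hg ht hctx' hv h7 hBm hBn hBf).mono le_rfl ?_
    rintro s'' - - ⟨d1, d2, d3, d4, d5⟩
    have hF : (v + 1) * (g.f + 1) = v * (g.f + 1) + g.f + 1 := by ring
    refine ⟨fun u hu => ?_, ?_, fun y hy => ?_⟩
    · rcases (by omega : u = v ∨ u < v) with rfl | hu
      · exact ⟨d1, d3, d4⟩
      · obtain ⟨c1, c2, c3⟩ := i1 u hu
        have hlt : ∀ q < g.f + 1, u * (g.f + 1) + q < v * (g.f + 1) := by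
          intro q hq
          have : u + 1 ≤ v := hu
          nlinarith
        simp only [arr_setReg, GrownIn, rarr_setReg]
        refine ⟨by rw [d2 u (by omega), c1], ?_, fun q hq => ?_⟩
        · refine ⟨fun q hq => ?_, fun q hq q' hq' he => ?_, fun q hq h0 => ?_,
            fun q' hq' w hw i hi hb e he hl => ?_⟩
          · rw [d5.a6 _ (.inl (hlt q (by omega)))]; exact c2.le q hq
          · rw [d5.a6 _ (.inl (hlt q (by omega))), d5.a6 _ (.inl (hlt q' (by omega)))] at he
            exact c2.inj q hq q' hq' he
          · rw [d5.a8 _ (.inl (hlt q (by omega)))] at h0 ⊢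
            have := c2.edge q hq h0
            rw [d5.a6 _ (.inl (hlt q (by omega))), d5.a6 _ (.inl (hlt _ (by omega))),
              d5.a9 _ (.inl (hlt q (by omega))), d5.a10 _ (.inl (hlt q (by omega))),
              d5.r1 _ (.inl (hlt q (by omega)))]
            exact this
          · rw [d5.a8 _ (.inl (hlt q' (by omega))), d5.r1 _ (.inl (hlt q' (by omega)))]
            rw [d5.a6 _ (.inl (hlt w (by omega)))] at hl
            refine c2.greedy q' hq' w hw i hi (fun b hbq => ?_) e he hl
            have := hb b hbq
            rwa [d5.a6 _ (.inl (hlt b (by omega)))] at this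
        · rw [d5.a7 _ (.inl (hlt q (by omega))), d5.a6 _ (.inl (hlt q (by omega)))]
          exact c3 q hq
    · rw [hF]
      have := i2.trans (lo := 0) (hi := v * (g.f + 1) + g.f + 1) d5 le_rfl (by omega) (by omega)
        le_rfl
      exact ⟨this.a6, this.a7, this.a8, this.a9, this.a10, this.r1⟩
    · simp only [arr_setReg]
      rw [d2 y (by omega), i3 y (by omega)]
  · rintro s' - h; exact h

-- All phases are measured against `Z = n (m + f²)`. The final clause, that cells from index `n (f +
-- 1)` on are still zero in each of the sixteen arrays, yields the size of the oracle.
set_option maxHeartbeats 800000 in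
theorem build_spec {B : ℕ} {g : Inst} (hg : g.Valid) {s : Store} (h0 : s.reg 0 = g.n)
    (h1 : s.reg 1 = g.m) (h2 : s.reg 2 = g.r) (h3 : s.reg 3 = g.f)
    (ha : ∀ k i, s.arr .work k i = 0) (hra : ∀ k i, s.rarr .work k i = 0)
    (hoa : ∀ k i, s.arr .output k i = 0) (hora : ∀ k i, s.rarr .output k i = 0)
    (heu : ∀ i, g.eu i = if i < g.m then s.mem .input (3 * i) else 0)
    (hev : ∀ i, g.ev i = if i < g.m then s.mem .input (3 * i + 1) else 0)
    (htr : ∀ i, g.tr i = if i < g.m then s.mem .input (3 * i + 2) else 0)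
    (hwt : ∀ i, g.wt i = if i < g.m then s.rmem .input i else 0)
    (hB : g.n + 2 ≤ B) (hBm : g.m ≤ B) (hBn : g.n * (g.f + 1) ≤ B)
    (hBf : (g.f + 1) * (g.f + 1) ≤ B) :
    Runs B build s (100000 * (g.n * (g.m + g.f ^ 2))) (fun s' =>
      IsOracle g (s'.arr .output) (s'.rarr .output) ∧ ∀ k < 16, ∀ i, g.n * (g.f + 1) ≤ i →
        s'.arr .output k i = 0 ∧ s'.rarr .output k i = 0) := by
  have hn1 : 1 ≤ g.n := by have := hg.r_lt; omega
  have hf1 := hg.f_pos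
  have hFB : g.f + 1 ≤ B := by nlinarith
  obtain ⟨Z, hZ⟩ : ∃ Z, Z = g.n * (g.m + g.f ^ 2) := ⟨_, rfl⟩
  rw [← hZ]
  have z1 : g.n * g.m ≤ Z := hZ ▸ Nat.mul_le_mul_left _ (Nat.le_add_right _ _)
  have hff : 1 ≤ g.f ^ 2 := Nat.one_le_pow _ _ hf1
  have z2 : g.n ≤ Z := by
    calc g.n = g.n * 1 := (mul_one _).symm
      _ ≤ Z := hZ ▸ Nat.mul_le_mul_left _ (by omega)
  have z3 : g.m ≤ Z := le_trans (by nlinarith) z1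
  -- From `n ≤ m + 1 ≤ m + f²`; this pays for the quadratic labelling and for the passes over all
  -- vertices for each `v`.
  have z4 : g.n * g.n ≤ Z := hZ ▸ Nat.mul_le_mul_left _ (by have := hg.n_le; omega)
  have z5 : g.n * ((g.f + 1) * (g.f + 1)) ≤ 4 * Z := by
    have : (g.f + 1) * (g.f + 1) ≤ 4 * g.f ^ 2 := by nlinarith
    calc g.n * ((g.f + 1) * (g.f + 1)) ≤ g.n * (4 * g.f ^ 2) := Nat.mul_le_mul_left _ this
      _ = 4 * (g.n * g.f ^ 2) := by ring
      _ ≤ 4 * Z := Nat.mul_le_mul_left _ (hZ ▸ Nat.mul_le_mul_left _ (Nat.le_add_left _ _))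
  have t2 : g.n * (g.m * 108 + 40) + 100 ≤ 300 * Z := by nlinarith
  have t3 : g.n * (g.n * 108 + 108) + 8 ≤ 300 * Z := by nlinarith
  have t6 : g.n * (g.n * 100 + g.m * 158 + (g.f + 1) * (g.f + 1) * 1000 + 308) + 8 ≤
      10000 * Z := by nlinarith
  refine .seq (g.m * 100 + 8) (99000 * Z) _
    (copyInput_spec h0 h1 h2 h3 ha hra heu hev htr hwt) (by omega) ?_
  intro s1 fr1 _ hs1
  refine .seq _ (98000 * Z) _ (bfs_spec hg (by omega) hs1
    (fun u => (congrFun (fr1.arr .work 4) u).trans (ha 4 u))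
    (fun u => (congrFun (fr1.arr .output 1) u).trans (hoa 1 u))
    (fun u => (congrFun (fr1.arr .output 2) u).trans (hoa 2 u))
    (fun u => (congrFun (fr1.rarr .output 0) u).trans (hora 0 u)))
    ((Nat.add_le_add_right t2 _).trans (by omega)) ?_
  intro s2 fr2 _ hfound
  have hs2 := hs1.frame fr2
  have ht := hfound.rooted
  have z : ∀ k, (k = 3 ∨ k = 4 ∨ k = 5) → ∀ x, s2.arr .output k x = 0 := by
    rintro k hk x
    rcases hk with rfl | rfl | rfl
    · rw [fr2.arr .output 3, fr1.arr .output 3, hoa]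
    · rw [fr2.arr .output 4, fr1.arr .output 4, hoa]
    · rw [fr2.arr .output 5, fr1.arr .output 5, hoa]
  refine .seq _ (97000 * Z) _ (labels_spec (by omega) hs2 ht (z 3 (by simp)) (z 4 (by simp)))
    ((Nat.add_le_add_right t3 _).trans (by omega)) ?_
  rintro s3 fr3 _ ⟨hlz, hlab⟩
  have hs3 := hs2.frame fr3
  refine .seq 30 (96000 * Z) (fun s' => s'.reg 13 = g.f + 1 ∧ s'.reg 14 = (g.f + 1) * (g.f + 1) ∧
      ∀ i, s'.arr .output 0 i = if i = 0 then g.f else s3.arr .output 0 i)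
      (.straight rfl (by decide) ?_) (by omega) ?_
  · simp [consts, hs3.f]
    omega
  rintro s4 fr4 - ⟨c13, c14, c0⟩
  have hs4 := hs3.frame fr4
  refine .seq _ (95000 * Z) _ (keys_spec hs4) (by omega) ?_
  intro s5 fr5 _ hkey
  have hs5 := hs4.frame fr5
  have e3 : s5.arr .work 3 = s2.arr .work 3 :=
    (fr5.arr .work 3).trans ((fr4.arr .work 3).trans (fr3.arr .work 3))
  have e1 : s5.arr .output 1 = s2.arr .output 1 :=
    (fr5.arr .output 1).trans ((fr4.arr .output 1).trans (fr3.arr .output 1))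
  have e2 : s5.arr .output 2 = s2.arr .output 2 :=
    (fr5.arr .output 2).trans ((fr4.arr .output 2).trans (fr3.arr .output 2))
  have ed : s4.rarr .output 0 = s2.rarr .output 0 := (fr4.rarr .output 0).trans (fr3.rarr .output 0)
  have hctx : BlockCtx g (s2.arr .work 3) (s2.arr .output 1) (s2.arr .output 2)
      (s2.rarr .output 0) s5 := by
    refine ⟨hs5, e3, e1, e2, (fr5.reg 13).trans c13,
      (fr5.reg 14).trans c14, _, rfl, ?_⟩
    rw [← ed]
    exact hkey
  refine (blocks_spec hg ht hctx hBm hBn hBf).mono (t6.trans (by omega)) ?_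
  rintro s6 fr6 - ⟨hblk, hsame, hht⟩
  have d1 := (fr6.arr .output 1).trans e1
  have d2 := (fr6.arr .output 2).trans e2
  have d0 := (fr6.rarr .output 0).trans ((fr5.rarr .output 0).trans ed)
  have d3 : s6.arr .output 3 = s3.arr .output 3 :=
    (fr6.arr .output 3).trans ((fr5.arr .output 3).trans (fr4.arr .output 3))
  have d4 : s6.arr .output 4 = s3.arr .output 4 :=
    (fr6.arr .output 4).trans ((fr5.arr .output 4).trans (fr4.arr .output 4))
  have df : ∀ i, s6.arr .output 0 i = if i = 0 then g.f else 0 := by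
    intro i
    have : s3.arr .output 0 i = 0 := by
      rw [fr3.arr .output 0, fr2.arr .output 0, fr1.arr .output 0, hoa]
    rw [fr6.arr .output 0, fr5.arr .output 0, c0, this]
  refine ⟨⟨?_, ⟨s2.arr .work 3, ?_⟩, ?_, fun v hv => ?_, fun v hv => ?_, fun v hv => ?_⟩, ?_⟩
  · rw [df, if_pos rfl]
  · rw [d1, d2, d0]; exact ht
  · rw [d1, d3, d4]; exact hlab
  · rw [(hblk v hv).1, d2]
  · rw [(hblk v hv).1, d1, d0]; exact (hblk v hv).2.1
  · rw [(hblk v hv).1, d1]; exact (hblk v hv).2.2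
  · have c : ∀ k, (5 ≤ k ∧ k < 16) → ∀ i, s5.arr .output k i = 0 := by
      rintro k ⟨hk, hk'⟩ i
      have q5 := fr5.arr .output k (by interval_cases k <;> rfl) hk'
      have q4 := fr4.arr .output k (by interval_cases k <;> rfl) hk'
      have q3 := fr3.arr .output k (by interval_cases k <;> rfl) hk'
      have q2 := fr2.arr .output k (by interval_cases k <;> rfl) hk'
      have q1 := fr1.arr .output k (by interval_cases k <;> rfl) hk'
      rw [q5, q4, q3, q2, q1, hoa]
    have cr : ∀ k, (1 ≤ k ∧ k < 16) → ∀ i, s5.rarr .output k i = 0 := by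
      rintro k ⟨hk, hk'⟩ i
      have q5 := fr5.rarr .output k (by interval_cases k <;> rfl) hk'
      have q4 := fr4.rarr .output k (by interval_cases k <;> rfl) hk'
      have q3 := fr3.rarr .output k (by interval_cases k <;> rfl) hk'
      have q2 := fr2.rarr .output k (by interval_cases k <;> rfl) hk'
      have q1 := fr1.rarr .output k (by interval_cases k <;> rfl) hk'
      rw [q5, q4, q3, q2, q1, hora]
    intro k hk i hi
    have hni : g.n ≤ i := le_trans (Nat.le_mul_of_pos_right _ (by omega)) hi
    constructor
    · rcases (by omega : k = 0 ∨ k = 1 ∨ k = 2 ∨ k = 3 ∨ k = 4 ∨ k = 5 ∨ k = 6 ∨ k = 7 ∨ k = 8 ∨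
        k = 9 ∨ k = 10 ∨ (11 ≤ k ∧ k < 16)) with rfl | rfl | rfl | rfl | rfl | rfl | rfl | rfl |
        rfl | rfl | rfl | hk
      · rw [df, if_neg (by omega)]
      · rw [d1]; exact (ht.out i hni).1
      · rw [d2]; exact (ht.out i hni).2.1
      · rw [d3]; exact (hlz i hni).1
      · rw [d4]; exact (hlz i hni).2
      · rw [hht i hni]; exact c 5 (by omega) i
      · rw [hsame.a6 i (.inr hi)]; exact c 6 (by omega) i
      · rw [hsame.a7 i (.inr hi)]; exact c 7 (by omega) i
      · rw [hsame.a8 i (.inr hi)]; exact c 8 (by omega) i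
      · rw [hsame.a9 i (.inr hi)]; exact c 9 (by omega) i
      · rw [hsame.a10 i (.inr hi)]; exact c 10 (by omega) i
      · rw [fr6.arr .output k (by obtain ⟨h1, h2⟩ := hk; interval_cases k <;> rfl) hk.2]
        exact c k (by omega) i
    · rcases (by omega : k = 0 ∨ k = 1 ∨ (2 ≤ k ∧ k < 16)) with rfl | rfl | hk
      · rw [d0]; exact (ht.out i hni).2.2
      · rw [hsame.r1 i (.inr hi)]; exact cr 1 (by omega) i
      · rw [fr6.rarr .output k (by obtain ⟨h1, h2⟩ := hk; interval_cases k <;> rfl) hk.2]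
        exact cr k (by omega) i

/-! ### Walks that avoid the failed edges -/

/-- The edge `e` is not one of the parent edges of the first `η` ancestors of `v`. -/
def Inst.Alive (g : Inst) (par : ℕ → ℕ) (v η e : ℕ) : Prop :=
  g.tr e = 1 → ∀ i < η, ¬ g.Joins e (par (par^[i] v)) (par^[i] v)

/-- `σ 0, …, σ P` is a walk of weight `W` from the root with edges in `Al`. -/
inductive IsWalk (g : Inst) (Al : ℕ → Prop) (σ : ℕ → ℕ) : ℕ → ℝ → Prop
  | zero (h : σ 0 = g.r) : IsWalk g Al σ 0 0
  | step {P : ℕ} {W : ℝ} (e : ℕ) (h : IsWalk g Al σ P W) (he : e < g.m) (ha : Al e)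
      (hj : g.Joins e (σ P) (σ (P + 1))) : IsWalk g Al σ (P + 1) (W + g.wt e)

theorem IsWalk.congr {g : Inst} {Al : ℕ → Prop} {σ σ' : ℕ → ℕ} {P : ℕ} {W : ℝ}
    (h : IsWalk g Al σ P W) (hσ : ∀ j ≤ P, σ' j = σ j) : IsWalk g Al σ' P W := by
  induction h with
  | zero h => exact .zero ((hσ 0 le_rfl).trans h)
  | @step P W e h he ha hj ih =>
    refine .step e (ih fun j hj => hσ j (by omega)) he ha ?_
    rw [hσ P (by omega), hσ (P + 1) le_rfl]
    exact hj

/-- The distances from the root are those of a shortest-path tree. -/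
structure Shortest (g : Inst) (par : ℕ → ℕ) (dist : ℕ → ℝ) : Prop where
  left : ∀ e < g.m, dist (g.eu e) ≤ dist (g.ev e) + g.wt e
  right : ∀ e < g.m, dist (g.ev e) ≤ dist (g.eu e) + g.wt e
  tree : ∀ e < g.m, g.tr e = 1 → ∃ u < g.n, u ≠ g.r ∧ g.Joins e (par u) u

section

variable {g : Inst} {ord par dep : ℕ → ℕ} {dist : ℕ → ℝ}

theorem Shortest.joins (hd : Shortest g par dist) {e x y : ℕ} (he : e < g.m)
    (h : g.Joins e x y) : dist y ≤ dist x + g.wt e := by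
  rcases h with ⟨rfl, rfl⟩ | ⟨rfl, rfl⟩
  · exact hd.right e he
  · exact hd.left e he

theorem Inst.key_joins {e x y : ℕ} (h : g.Joins e x y) :
    g.key dist e = dist x + g.wt e + dist y := by
  unfold Inst.key
  rcases h with ⟨rfl, rfl⟩ | ⟨rfl, rfl⟩
  · rfl
  · ring

/-- Along every edge `dist` grows by at most the weight, because it is the distance in the whole
graph. -/
theorem IsWalk.le (hg : g.Valid) (ht : Rooted g ord par dep dist) (hd : Shortest g par dist)
    {Al : ℕ → Prop} {σ : ℕ → ℕ} {P : ℕ} {W : ℝ} (h : IsWalk g Al σ P W) :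
    σ P < g.n ∧ dist (σ P) ≤ W := by
  induction h with
  | zero h => rw [h, ht.dist_root]; exact ⟨hg.r_lt, le_rfl⟩
  | @step P W e h he ha hj ih =>
    have := hd.joins he hj
    exact ⟨(hg.joins_lt he hj).2, by linarith [ih.2]⟩

namespace Rooted

/-- The only other possibility is that each vertex is the parent of the other, which the depths
exclude. -/
theorem child_unique (ht : Rooted g ord par dep dist) {e x y : ℕ} (hx : x < g.n) (hy : y < g.n)
    (hxr : x ≠ g.r) (hyr : y ≠ g.r) (h : g.Joins e (par x) x) (h' : g.Joins e (par y) y) :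
    x = y := by
  have h1 := (ht.spec hx hxr).2.1
  have h2 := (ht.spec hy hyr).2.1
  have key : (par x = par y ∧ x = y) ∨ (par x = y ∧ x = par y) := by
    rcases h with ⟨a, b⟩ | ⟨a, b⟩ <;> rcases h' with ⟨c, d⟩ | ⟨c, d⟩ <;> omega
  rcases key with ⟨-, h⟩ | ⟨ha, hb⟩
  · exact h
  · rw [ha] at h1; rw [← hb] at h2; omega

theorem alive_child (ht : Rooted g ord par dep dist) {v η e u : ℕ} (hv : v < g.n)
    (hη : η ≤ dep v) (hu : u < g.n) (hur : u ≠ g.r) (hj : g.Joins e (par u) u)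
    (hn : ∀ i < η, u ≠ par^[i] v) : g.Alive par v η e := fun _ i hi hj' =>
  hn i hi (ht.child_unique hu (ht.iter_lt hv i) hur (ht.iter_ne_root hv (hi.trans_le hη)).1 hj hj')

theorem iter_sub (ht : Rooted g ord par dep dist) {x a : ℕ} (ha : a < g.n) (hx : Anc par x a) :
    par^[dep a - dep x] a = x := by
  revert hx
  refine ht.induct (P := fun a => Anc par x a → par^[dep a - dep x] a = x) ?_ ?_ ha
  · intro hx
    rw [ht.anc_of_root hx]; simp
  · intro u hu hur ih hx
    rcases (anc_iff _ _ _).1 hx with rfl | hx'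
    · simp
    · have h1 := (ht.spec hu hur).2.1
      have h2 := ht.dep_anc (ht.par_lt hu) hx'
      have h3 : dep u - dep x = (dep (par u) - dep x) + 1 := by omega
      rw [h3, Function.iterate_succ_apply]
      exact ih hx'

end Rooted

/-- The tree path from `x` down to `a` does not use failed edges. -/
structure Down (par dep : ℕ → ℕ) (v η x a : ℕ) : Prop where
  anc : Anc par x a
  avoid : ∀ i < η, Anc par (par^[i] v) a → dep (par^[i] v) ≤ dep x

/-- A failed edge on the path would hang above some `i`-th ancestor of `v` lying on the path. The
class `c` of `a` is the least index of an ancestor of `v` above `a`, so `c ≤ i`, and that ancestor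
is not below the top of the class. -/
theorem down_top (ht : Rooted g ord par dep dist) {v h η a c : ℕ} (hv : v < g.n) (hh : h ≤ dep v)
    (hη : η ≤ h) (ha : a < g.n) (hc : cmp par v h a = c) :
    Down par dep v η (top par g.r v h c) a := by
  subst hc
  refine ⟨ht.anc_top_cmp ha, fun i hi hx => ?_⟩
  have h1 := cmp_le_of_anc (hi.trans_le hη) hx
  unfold top
  rw [if_pos (by omega)]
  have h2 := (ht.iter_ne_root hv (by omega : i < dep v)).2
  have h3 := (ht.iter_ne_root hv (by omega : cmp par v h a < dep v)).2
  omega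

/-- In a class of number at least `η`, no lower end of a failed edge is an ancestor of `a`, so even
the whole path from the root survives. This starts the routes. -/
theorem down_root (ht : Rooted g ord par dep dist) {v h η a : ℕ} (hη : η ≤ h) (ha : a < g.n)
    (hc : η ≤ cmp par v h a) : Down par dep v η g.r a := by
  refine ⟨ht.anc_root ha, fun i hi hx => ?_⟩
  have h1 := cmp_le_of_anc (hi.trans_le hη) hx
  omega

namespace Down

variable {v η x a : ℕ}

/-- The edges above the vertices of the path are alive. -/
theorem edge (ht : Rooted g ord par dep dist) (hv : v < g.n) (hη : η ≤ dep v)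
    (h : Down par dep v η x a) (ha : a < g.n) {j : ℕ} (hj : j < dep a - dep x) :
    ∃ e < g.m, g.Alive par v η e ∧ g.Joins e (par^[j + 1] a) (par^[j] a) ∧
      dist (par^[j] a) = dist (par^[j + 1] a) + g.wt e := by
  have hlt := ht.iter_lt ha j
  obtain ⟨hne, hdep⟩ := ht.iter_ne_root ha (by omega : j < dep a)
  obtain ⟨-, -, e, he, htr, hjn, hdi⟩ := ht.spec hlt hne
  rw [Function.iterate_succ_apply']
  refine ⟨e, he, ht.alive_child hv hη hlt hne hjn fun i hi hc => ?_, hjn, hdi⟩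
  have := h.avoid i hi (hc ▸ ⟨j, rfl⟩)
  rw [← hc] at this
  omega

/-- Parents can be followed only upwards, so a downward path is described backwards from its lower
end `a`. Its weight is the difference of distances. -/
theorem walk_down (ht : Rooted g ord par dep dist) (hv : v < g.n) (hη : η ≤ dep v)
    (h : Down par dep v η x a) (ha : a < g.n) {σ : ℕ → ℕ} {P : ℕ} {W : ℝ}
    (hw : IsWalk g (g.Alive par v η) σ P W)
    (hσ : ∀ j ≤ dep a - dep x, σ (P + (dep a - dep x) - j) = par^[j] a) :
    IsWalk g (g.Alive par v η) σ (P + (dep a - dep x)) (W + (dist a - dist x)) := by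
  have main : ∀ i ≤ dep a - dep x, IsWalk g (g.Alive par v η) σ (P + i)
      (W + (dist (par^[dep a - dep x - i] a) - dist x)) := by
    intro i hi
    induction i with
    | zero =>
      have : par^[dep a - dep x - 0] a = x := ht.iter_sub ha h.anc
      rw [this]; simpa using hw
    | succ i ih =>
      obtain ⟨e, he, hal, hj, hdi⟩ := h.edge ht hv hη ha
        (by omega : dep a - dep x - (i + 1) < dep a - dep x)
      have e1 : dep a - dep x - (i + 1) + 1 = dep a - dep x - i := by omega
      rw [e1] at hj hdi
      have := IsWalk.step e (ih (by omega)) he hal (by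
        have h1 := hσ (dep a - dep x - i) (by omega)
        have h2 := hσ (dep a - dep x - (i + 1)) (by omega)
        rw [show P + (dep a - dep x) - (dep a - dep x - i) = P + i by omega] at h1
        rw [show P + (dep a - dep x) - (dep a - dep x - (i + 1)) = P + i + 1 by omega] at h2
        rw [h1, h2]; exact hj)
      rw [hdi, show W + (dist (par^[dep a - dep x - i] a) + g.wt e - dist x) =
        W + (dist (par^[dep a - dep x - i] a) - dist x) + g.wt e by ring]
      exact this
  simpa using main _ le_rfl

theorem walk_up (ht : Rooted g ord par dep dist) (hv : v < g.n) (hη : η ≤ dep v)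
    (h : Down par dep v η x a) (ha : a < g.n) {σ : ℕ → ℕ} {P : ℕ} {W : ℝ}
    (hw : IsWalk g (g.Alive par v η) σ P W)
    (hσ : ∀ j ≤ dep a - dep x, σ (P + j) = par^[j] a) :
    IsWalk g (g.Alive par v η) σ (P + (dep a - dep x)) (W + (dist a - dist x)) := by
  have main : ∀ i ≤ dep a - dep x, IsWalk g (g.Alive par v η) σ (P + i)
      (W + (dist a - dist (par^[i] a))) := by
    intro i hi
    induction i with
    | zero => simpa using hw
    | succ i ih =>
      obtain ⟨e, he, hal, hj, hdi⟩ := h.edge ht hv hη ha (by omega : i < dep a - dep x)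
      have := IsWalk.step e (ih (by omega)) he hal (by
        rw [hσ i (by omega), add_assoc, hσ (i + 1) hi]; exact hj.symm)
      rw [show W + (dist a - dist (par^[i + 1] a)) =
        W + (dist a - dist (par^[i] a)) + g.wt e by rw [hdi]; ring]
      exact this
  have := main _ le_rfl
  rwa [ht.iter_sub ha h.anc] at this

end Down

end

/-! ### The forest seen from one of its positions -/

/-- The marked positions `q ≤ h` are those of the tree of the position `Q` in the forest given by
`PR`; `NXT q` is the next position on the way from `q` to `Q`, `LEV q` the number of links of that
way and `D q` its cost, where `x q` is the distance of the top of the position `q`. -/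
structure Linked (h Q : ℕ) (PR : ℕ → ℕ) (K x : ℕ → ℝ) (MK NXT LEV : ℕ → ℕ) (D : ℕ → ℝ) :
    Prop where
  le : Q ≤ h
  mark : MK Q = 1
  lev : LEV Q = 0
  cost : D Q = 0
  next : ∀ q ≤ h, MK q = 1 → q ≠ Q → NXT q ≤ h ∧ MK (NXT q) = 1 ∧ LEV q = LEV (NXT q) + 1 ∧
    ((NXT q < q ∧ PR q = NXT q + 1 ∧ D q = D (NXT q) + K q - 2 * x (NXT q)) ∨
      (q < NXT q ∧ PR (NXT q) = q + 1 ∧ D q = D (NXT q) + K (NXT q) - 2 * x (NXT q)))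
  up : ∀ q ≤ h, PR q ≠ 0 → MK q = 1 → MK (PR q - 1) = 1 ∧
    ((q ≠ Q ∧ NXT q = PR q - 1) ∨ (PR q - 1 ≠ Q ∧ NXT (PR q - 1) = q))
  lev_le : ∀ q ≤ h, MK q = 1 → LEV q ≤ h + q

/-- Kept apart from `Linked` because closure under children holds only after the final sweep,
whereas `Linked` is preserved by every step. -/
structure Rerooted (h Q : ℕ) (PR : ℕ → ℕ) (K x : ℕ → ℝ) (MK NXT LEV : ℕ → ℕ) (D : ℕ → ℝ) : Prop
    extends Linked h Q PR K x MK NXT LEV D where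
  down : ∀ q ≤ h, PR q ≠ 0 → MK (PR q - 1) = 1 → MK q = 1

/-- The positions whose way to `Q` has only links of key at most `b`. -/
inductive Near (h Q : ℕ) (K : ℕ → ℝ) (MK NXT : ℕ → ℕ) (b : ℝ) : ℕ → Prop
  | base : Near h Q K MK NXT b Q
  | step (q : ℕ) (hq : q ≤ h) (hm : MK q = 1) (hQ : q ≠ Q) (hk : K (max q (NXT q)) ≤ b)
      (hn : Near h Q K MK NXT b (NXT q)) : Near h Q K MK NXT b q

section

variable {h Q : ℕ} {PR : ℕ → ℕ} {K x : ℕ → ℝ} {MK NXT LEV : ℕ → ℕ} {D : ℕ → ℝ} {b : ℝ}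

theorem Near.marked (hR : Linked h Q PR K x MK NXT LEV D) {q : ℕ} (hq : Near h Q K MK NXT b q) :
    q ≤ h ∧ MK q = 1 := by
  cases hq with
  | base => exact ⟨hR.le, hR.mark⟩
  | step _ hq hm => exact ⟨hq, hm⟩

/-- After re-rooting, a forest edge is traversed either from `q` to its parent position or the other
way. In both cases `max q (NXT q)` is the later position, where the key of the edge is stored. -/
theorem Near.closed (hR : Rerooted h Q PR K x MK NXT LEV D) (hPR : ∀ q ≤ h, PR q ≠ 0 → PR q ≤ q)
    {q : ℕ} (hq : q ≤ h) (h0 : PR q ≠ 0) (hk : K q ≤ b) :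
    Near h Q K MK NXT b q ↔ Near h Q K MK NXT b (PR q - 1) := by
  have hle := hPR q hq h0
  have key : ∀ {q : ℕ}, q ≠ Q → Near h Q K MK NXT b q → Near h Q K MK NXT b (NXT q) := by
    intro q hne hn
    cases hn with
    | base => exact absurd rfl hne
    | step _ _ _ _ _ hn => exact hn
  constructor
  · intro hn
    obtain ⟨hm, ⟨hne, hx⟩ | ⟨hne, hx⟩⟩ := hR.up q hq h0 (hn.marked hR.toLinked).2
    · rw [← hx]; exact key hne hn
    · exact .step _ (by omega) hm hne (by rw [hx, max_eq_right (by omega)]; exact hk)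
        (by rw [hx]; exact hn)
  · intro hn
    have hmq := hR.down q hq h0 (hn.marked hR.toLinked).2
    obtain ⟨hm, ⟨hne, hx⟩ | ⟨hne, hx⟩⟩ := hR.up q hq h0 hmq
    · exact .step _ hq hmq hne (by rw [hx, max_eq_left (by omega)]; exact hk) (hx ▸ hn)
    · rw [← hx]; exact key hne hn

end

/-! ### Bottleneck optimality of the greedy forest -/

section

variable {g : Inst} {key : ℕ → ℝ} {cm : ℕ → ℕ} {h : ℕ} {N PR EA EB : ℕ → ℕ} {K : ℕ → ℝ}

/-- A set of positions that is closed under cheap forest edges is closed under all cheap edges. -/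
theorem Grown.closed (hG : Grown g key cm h (h + 1) N PR EA EB K) {S : ℕ → Prop} {b : ℝ}
    (hS : ∀ q ≤ h, PR q ≠ 0 → K q ≤ b → (S q ↔ S (PR q - 1))) {e u q : ℕ} (he : e < g.m)
    (hk : key e ≤ b) (hu : u ≤ h) (hq : q ≤ h) (hl : g.Links cm e (N u) (N q)) : S u ↔ S q := by
  -- Until class `N q` is listed, the edge `e` leaves the listed positions, so by the greedy choice
  -- every position after `u` up to `q` is attached by an edge no more expensive than `e`.
  have run : ∀ u q, q ≤ h → u < q → ∀ e < g.m, g.Links cm e (N u) (N q) → key e ≤ b →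
      ∀ q', u < q' → q' ≤ q → PR q' ≠ 0 ∧ K q' ≤ b := by
    intro u q hq huq e he hl hk q' h1 h2
    obtain ⟨k1, k2⟩ := hG.greedy q' (by omega) u h1 (N q) (hG.le q (by omega))
      (fun c hc heq => by have := hG.inj c (by omega) q (by omega) heq; omega) e he hl
    exact ⟨k1, k2.trans hk⟩
  have main : ∀ q, q ≤ h → ∀ u < q, (∀ q', u < q' → q' ≤ q → PR q' ≠ 0 ∧ K q' ≤ b) →
      (S u ↔ S q) := by
    intro q
    induction q using Nat.strong_induction_on with
    | _ q ih =>
      intro hq u hu hr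
      obtain ⟨h0, hKq⟩ := hr q hu le_rfl
      obtain ⟨hle, e', he', htr, hj, hb, ha, hK⟩ := hG.edge q (by omega) h0
      rw [hS q hq h0 hKq]
      rcases lt_trichotomy u (PR q - 1) with hlt | heq | hgt
      · exact ih _ (by omega) (by omega) u hlt fun q' h1 h2 => hr q' h1 (by omega)
      · rw [heq]
      -- If the parent of `q` stands before `u`, the edge attaching `q` plays the role of `e`: all
      -- positions between that parent and `u` are attached cheaply, and induction applies with `u`
      -- as the later position.
      · have hl' : g.Links cm e' (N (PR q - 1)) (N q) := by
          refine ⟨htr, ?_⟩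
          rcases hj with ⟨j1, j2⟩ | ⟨j1, j2⟩
          · left; rw [j1, j2]; exact ⟨ha, hb⟩
          · right; rw [j1, j2]; exact ⟨hb, ha⟩
        have := run (PR q - 1) q hq (by omega) e' he' hl' (hK ▸ hKq)
        exact (ih u hu (by omega) (PR q - 1) hgt fun q' h1 h2 => this q' h1 (by omega)).symm
  rcases lt_trichotomy u q with hlt | heq | hgt
  · exact main q hq u hlt (run u q hq hlt e he hl hk)
  · rw [heq]
  · exact (main u hu q hgt (run q u hu hgt e he hl.symm hk)).symm

theorem Grown.surj (hG : Grown g key cm h (h + 1) N PR EA EB K) {i : ℕ} (hi : i ≤ h) :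
    ∃ q ≤ h, N q = i := by
  have := Finset.surjOn_of_injOn_of_card_le (s := Finset.range (h + 1))
    (t := Finset.range (h + 1)) N
    (fun q hq => by
      have := hG.le q (by simpa using hq)
      simp only [Finset.coe_range, Set.mem_Iio]; omega)
    (fun q hq q' hq' => hG.inj q (by simpa using hq) q' (by simpa using hq')) (by simp)
  obtain ⟨q, hq, hqi⟩ := this (by simp only [Finset.coe_range, Set.mem_Iio]; omega : i ∈ _)
  simp only [Finset.coe_range, Set.mem_Iio] at hq
  exact ⟨q, by omega, hqi⟩

/-- A near position of a class at least `η` yields a cheap one. -/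
theorem Near.cheap (hG : Grown g key cm h (h + 1) N PR EA EB K) {Q η : ℕ} {x : ℕ → ℝ}
    {MK NXT LEV : ℕ → ℕ} {D : ℕ → ℝ} (hR : Linked h Q PR K x MK NXT LEV D)
    (hx : ∀ q ≤ h, 0 ≤ x q) {b : ℝ} (hb : 0 ≤ b) {c : ℕ} (hc : Near h Q K MK NXT b c)
    (hη : η ≤ N c) : ∃ c ≤ h, MK c = 1 ∧ η ≤ N c ∧ D c ≤ η * b := by
  by_contra hno
  -- If no cheap position exists, each near position has class below `η`. The set `A` collects the
  -- positions on its way to `Q`; levels are bounded along `A`, so a further position is new and the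
  -- cardinality counts the links.
  have main : ∀ q, Near h Q K MK NXT b q → N q < η ∧ D q ≤ LEV q * b ∧
      ∃ A : Finset ℕ, (∀ a ∈ A, a ≤ h ∧ N a < η ∧ LEV a ≤ LEV q) ∧ A.card = LEV q + 1 := by
    intro q hq
    induction hq with
    | base =>
      have h1 : N Q < η := by
        by_contra hc
        exact hno ⟨Q, hR.le, hR.mark, by omega, by rw [hR.cost]; positivity⟩
      exact ⟨h1, by rw [hR.cost]; positivity, {Q}, by simp [h1, hR.le], by simp [hR.lev]⟩
    | step q hq hm hQ hk hn ih =>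
      obtain ⟨i1, i2, A, i3, i4⟩ := ih
      obtain ⟨n1, n2, n3, n4⟩ := hR.next q hq hm hQ
      -- The classes of the positions after `q` on its way are distinct and below `η`.
      have hcard : LEV q ≤ η := by
        rw [n3, ← i4]
        have := Finset.card_le_card_of_injOn (s := A) (t := Finset.range η) N
          (fun a ha => by simpa using (i3 a ha).2.1)
          (fun a ha a' ha' => hG.inj a (by have := (i3 a ha).1; omega) a'
            (by have := (i3 a' ha').1; omega))
        simpa using this
      have hD : D q ≤ LEV q * b := by
        have := hx (NXT q) n1
        have e : (LEV q : ℝ) * b = LEV (NXT q) * b + b := by rw [n3]; push_cast; ring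
        rw [e]
        rcases n4 with ⟨l, -, hD⟩ | ⟨l, -, hD⟩
        · rw [max_eq_left l.le] at hk; linarith
        · rw [max_eq_right l.le] at hk; linarith
      have h1 : N q < η := by
        by_contra hc
        refine hno ⟨q, hq, hm, by omega, hD.trans ?_⟩
        exact mul_le_mul_of_nonneg_right (by exact_mod_cast hcard) hb
      refine ⟨h1, hD, insert q A, fun a ha => ?_, ?_⟩
      · rcases Finset.mem_insert.1 ha with rfl | ha
        · exact ⟨hq, h1, le_rfl⟩
        · have := i3 a ha
          exact ⟨this.1, this.2.1, by omega⟩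
      · rw [Finset.card_insert_of_notMem, i4, n3]
        intro ha
        have := (i3 q ha).2.2
        omega
  have := (main c hc).1
  omega

end

/-- Following a walk that avoids the failed edges one finds a cheap position. -/
theorem IsWalk.cheap {g : Inst} {ord par dep : ℕ → ℕ} {dist : ℕ → ℝ} (hg : g.Valid)
    (ht : Rooted g ord par dep dist) (hd : Shortest g par dist) {v h η : ℕ} (hv : v < g.n)
    (hh : h ≤ dep v) (hη : η ≤ h) {N PR EA EB : ℕ → ℕ} {K x : ℕ → ℝ}
    (hG : Grown g (g.key dist) (cmp par v h) h (h + 1) N PR EA EB K)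
    {Q : ℕ} {MK NXT LEV : ℕ → ℕ} {D : ℕ → ℝ} (hR : Rerooted h Q PR K x MK NXT LEV D)
    (hx : ∀ q ≤ h, 0 ≤ x q) {σ : ℕ → ℕ} {P : ℕ} {L : ℝ}
    (hw : IsWalk g (g.Alive par v η) σ P L) (hQ : N Q = cmp par v h (σ P)) :
    ∃ c ≤ h, MK c = 1 ∧ η ≤ N c ∧ D c ≤ η * (2 * L) := by
  have hL : 0 ≤ L := (ht.dist_nonneg hg (hw.le hg ht hd).1).trans (hw.le hg ht hd).2
  -- The bound is `2 * L` because both ends of an edge of the walk are within distance `L`.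
  -- Otherwise all near classes are below `η`, and induction along the walk, which starts in class
  -- `h ≥ η`, shows that no class on it is near; yet `Q` itself is near.
  suffices ∃ c, Near h Q K MK NXT (2 * L) c ∧ η ≤ N c by
    obtain ⟨c, h1, h2⟩ := this
    exact h1.cheap hG hR.toLinked hx (by linarith) h2
  by_contra hno
  have hPR : ∀ q ≤ h, PR q ≠ 0 → PR q ≤ q := fun q hq h0 => (hG.edge q (by omega) h0).1
  have main : ∀ P' L', IsWalk g (g.Alive par v η) σ P' L' → L' ≤ L →
      ∀ q ≤ h, N q = cmp par v h (σ P') → ¬ Near h Q K MK NXT (2 * L) q := by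
    intro P' L' hw'
    induction hw' with
    | zero h0 =>
      intro _ q _ hNq hn
      rw [h0, ht.cmp_root hv hh] at hNq
      exact hno ⟨q, hn, by omega⟩
    | @step P' L' e hw' he ha hj ih =>
      intro hle q hq hNq hn
      have hwt := hg.wt_nonneg e
      obtain ⟨hlt, hdl⟩ := hw'.le hg ht hd
      obtain ⟨q0, hq0, hN0⟩ := hG.surj (cmp_le par v h (σ P'))
      have hout := ih (by linarith) q0 hq0 hN0
      by_cases htr : g.tr e = 1
      · obtain ⟨u, hu, hur, hju⟩ := hd.tree e he htr
        have hux : ∀ i < η, u ≠ par^[i] v := fun i hi hc => ha htr i hi (hc ▸ hju)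
        have hcase : (σ P' = par u ∧ σ (P' + 1) = u) ∨ (σ P' = u ∧ σ (P' + 1) = par u) := by
          rcases hj with ⟨a, b⟩ | ⟨a, b⟩ <;> rcases hju with ⟨c, d⟩ | ⟨c, d⟩ <;> omega
        -- A surviving tree edge either stays in its class or is one of the deleted edges that did
        -- not fail, and then both of its ends lie in classes of number at least `η`.
        have hc : cmp par v h u = cmp par v h (par u) ∨
            (η ≤ cmp par v h u ∧ η ≤ cmp par v h (par u)) := by
          by_cases hi : ∃ i < h, u = par^[i] v
          · obtain ⟨i, hi, rfl⟩ := hi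
            have hiη : η ≤ i := by
              by_contra hc
              exact hux i (by omega) rfl
            refine .inr ⟨by rw [ht.cmp_iter hv hh hi]; exact hiη, ?_⟩
            by_contra hc
            have h1 := anc_cmp (by omega : cmp par v h (par (par^[i] v)) < h)
            have h2 := cmp_le_of_anc (by omega : cmp par v h (par (par^[i] v)) < h)
              ((anc_iff _ _ _).2 (.inr h1))
            rw [ht.cmp_iter hv hh hi] at h2
            omega
          · push Not at hi
            exact .inl (Rooted.cmp_par hi)
        rcases hc with hc | ⟨hc1, hc2⟩
        · have hq' : q = q0 := hG.inj q (by omega) q0 (by omega) (by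
            rw [hNq, hN0]
            rcases hcase with ⟨a, b⟩ | ⟨a, b⟩ <;> rw [a, b, hc])
          exact hout (hq' ▸ hn)
        · refine hno ⟨q, hn, ?_⟩
          rw [hNq]
          rcases hcase with ⟨a, b⟩ | ⟨a, b⟩ <;> rw [b] <;> assumption
      -- The prefix before the edge together with the edge has weight at most `L`; this bounds `dist
      -- x + weight` and also `dist y`.
      · have hkey : g.key dist e ≤ 2 * L := by
          rw [Inst.key_joins hj]
          have := hd.joins he hj
          linarith
        refine hout ((hG.closed (S := Near h Q K MK NXT (2 * L))
          (fun q hq h0 hk => Near.closed hR hPR hq h0 hk) he hkey hq0 hq ⟨htr, ?_⟩).2 hn)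
        rw [hN0, hNq]
        rcases hj with ⟨a, b⟩ | ⟨a, b⟩
        · left; rw [a, b]; exact ⟨rfl, rfl⟩
        · right; rw [a, b]; exact ⟨rfl, rfl⟩
  exact main P L hw le_rfl Q hR.le hQ .base

/-! ### Climbing and descending the forest -/

/-- The situation after the tree of `Q` has been climbed from `Q` up to the position `c`. -/
structure Climbed (h Q c : ℕ) (PR : ℕ → ℕ) (K x : ℕ → ℝ) (MK NXT LEV : ℕ → ℕ) (D : ℕ → ℝ) :
    Prop where
  le : Q ≤ h
  mark : MK Q = 1
  mark_c : MK c = 1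
  lev : LEV Q = 0
  cost : D Q = 0
  le_one : ∀ q, MK q ≤ 1
  rng : ∀ q, MK q = 1 → c ≤ q ∧ q ≤ Q
  next : ∀ q, MK q = 1 → q ≠ Q → NXT q ≤ Q ∧ MK (NXT q) = 1 ∧ LEV q = LEV (NXT q) + 1 ∧
    q < NXT q ∧ PR (NXT q) = q + 1 ∧ D q = D (NXT q) + K (NXT q) - 2 * x (NXT q)
  up : ∀ q, MK q = 1 → q ≠ c → MK (PR q - 1) = 1 ∧ PR q - 1 ≠ Q ∧ NXT (PR q - 1) = q
  lev_le : ∀ q, MK q = 1 → LEV q + q ≤ Q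

section

variable {h Q c : ℕ} {PR : ℕ → ℕ} {K x : ℕ → ℝ} {MK NXT LEV : ℕ → ℕ} {D : ℕ → ℝ}

theorem Climbed.init (hQ : Q ≤ h) (hMK : ∀ q, MK q = if q = Q then 1 else 0)
    (hL : LEV Q = 0) (hD : D Q = 0) : Climbed h Q Q PR K x MK NXT LEV D := by
  have h1 : ∀ q, MK q = 1 → q = Q := by
    intro q hq
    by_contra hne
    rw [hMK, if_neg hne] at hq
    omega
  have h2 : MK Q = 1 := by rw [hMK, if_pos rfl]
  refine ⟨hQ, h2, h2, hL, hD, fun q => ?_, fun q hq => ?_, fun q hq hne => absurd (h1 q hq) hne,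
    fun q hq hne => absurd (h1 q hq) hne, fun q hq => ?_⟩
  · rw [hMK]; split_ifs <;> omega
  · rw [h1 q hq]; exact ⟨le_rfl, le_rfl⟩
  · rw [h1 q hq, hL]; omega

/-- Going up from `Q` reverses the parent links: the parent `p` of `c` gets `c` as next position. A
parent precedes its child, so the marked positions stay in `[p, Q]`, `p` is new, and levels are
bounded. -/
theorem Climbed.push (hC : Climbed h Q c PR K x MK NXT LEV D) {p : ℕ} (hp : PR c = p + 1)
    (hpc : p < c) {MK' NXT' LEV' : ℕ → ℕ} {D' : ℕ → ℝ}
    (hMK : ∀ q, MK' q = if q = p then 1 else MK q)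
    (hNXT : ∀ q, NXT' q = if q = p then c else NXT q)
    (hLEV : ∀ q, LEV' q = if q = p then LEV c + 1 else LEV q)
    (hD : ∀ q, D' q = if q = p then D c + K c - x c - x c else D q) :
    Climbed h Q p PR K x MK' NXT' LEV' D' := by
  have hcQ := (hC.rng c hC.mark_c).2
  have old : ∀ q, q ≠ p → MK' q = MK q ∧ NXT' q = NXT q ∧ LEV' q = LEV q ∧ D' q = D q :=
    fun q hq => ⟨by rw [hMK, if_neg hq], by rw [hNXT, if_neg hq], by rw [hLEV, if_neg hq],
      by rw [hD, if_neg hq]⟩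
  have new : MK' p = 1 ∧ NXT' p = c ∧ LEV' p = LEV c + 1 ∧ D' p = D c + K c - x c - x c :=
    ⟨by rw [hMK, if_pos rfl], by rw [hNXT, if_pos rfl], by rw [hLEV, if_pos rfl],
      by rw [hD, if_pos rfl]⟩
  obtain ⟨o1, o2, o3, o4⟩ := old Q (by omega)
  obtain ⟨c1, c2, c3, c4⟩ := old c (by omega)
  have hge : ∀ q, MK q = 1 → q ≠ p := fun q hq => by have := hC.rng q hq; omega
  have hcase : ∀ q, MK' q = 1 → q = p ∨ q ≠ p ∧ MK q = 1 := fun q hq => by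
    by_cases hqp : q = p
    · exact .inl hqp
    · rw [(old q hqp).1] at hq; exact .inr ⟨hqp, hq⟩
  refine ⟨hC.le, o1.trans hC.mark, new.1, o3.trans hC.lev, o4.trans hC.cost, fun q => ?_,
    fun q hq => ?_, fun q hq hne => ?_, fun q hq hne => ?_, fun q hq => ?_⟩
  · rw [hMK]
    split_ifs
    · exact le_rfl
    · exact hC.le_one q
  · rcases hcase q hq with rfl | ⟨-, hq⟩
    · omega
    · have := hC.rng q hq; omega
  · rcases hcase q hq with rfl | ⟨hqp, hq⟩
    · rw [new.2.1, c1, c3, c4, new.2.2.1, new.2.2.2]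
      exact ⟨hcQ, hC.mark_c, rfl, hpc, hp, by ring⟩
    · obtain ⟨k1, k2, k3, k4, k5, k6⟩ := hC.next q hq hne
      obtain ⟨j1, j2, j3, j4⟩ := old q hqp
      obtain ⟨l1, l2, l3, l4⟩ := old (NXT q) (hge _ k2)
      rw [j2, j3, j4, l1, l3, l4]
      exact ⟨k1, k2, k3, k4, k5, k6⟩
  · rcases hcase q hq with rfl | ⟨hqp, hq⟩
    · exact absurd rfl hne
    · by_cases hqc : q = c
      · subst hqc
        rw [hp, Nat.add_sub_cancel]
        exact ⟨new.1, by omega, new.2.1⟩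
      · obtain ⟨k1, k2, k3⟩ := hC.up q hq hqc
        obtain ⟨l1, l2, -⟩ := old _ (hge _ k1)
        rw [l1, l2]
        exact ⟨k1, k2, k3⟩
  · rcases hcase q hq with rfl | ⟨hqp, hq⟩
    · have := hC.lev_le c hC.mark_c; omega
    · rw [(old q hqp).2.2.1]; exact hC.lev_le q hq

theorem Climbed.linked (hC : Climbed h Q c PR K x MK NXT LEV D) (hc : PR c = 0) :
    Linked h Q PR K x MK NXT LEV D := by
  have hle := hC.le
  refine ⟨hC.le, hC.mark, hC.lev, hC.cost, fun q _ hm hne => ?_, fun q _ h0 hm => ?_,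
    fun q _ hm => ?_⟩
  · obtain ⟨k1, k2, k3, k4, k5, k6⟩ := hC.next q hm hne
    exact ⟨by omega, k2, k3, .inr ⟨k4, k5, k6⟩⟩
  · obtain ⟨k1, k2, k3⟩ := hC.up q hm (fun hqc => h0 (hqc ▸ hc))
    exact ⟨k1, .inr ⟨k2, k3⟩⟩
  · have := hC.lev_le q hm; omega

/-- Here a position off the climbed path is attached, and its next position is its own parent in the
forest. An unmarked `a` is nobody's next position, so old data are unchanged. -/
theorem Linked.push (hR : Linked h Q PR K x MK NXT LEV D)
    (hPR : ∀ q ≤ h, PR q ≠ 0 → PR q ≤ q) {a p : ℕ} (ha : a ≤ h) (hma : MK a = 0)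
    (hp : PR a = p + 1) (hmp : MK p = 1) {MK' NXT' LEV' : ℕ → ℕ} {D' : ℕ → ℝ}
    (hMK : ∀ q, MK' q = if q = a then 1 else MK q)
    (hNXT : ∀ q, NXT' q = if q = a then p else NXT q)
    (hLEV : ∀ q, LEV' q = if q = a then LEV p + 1 else LEV q)
    (hD : ∀ q, D' q = if q = a then D p + K a - x p - x p else D q) :
    Linked h Q PR K x MK' NXT' LEV' D' := by
  have hpa : p < a := by have := hPR a ha (by omega); omega
  have old : ∀ q, q ≠ a → MK' q = MK q ∧ NXT' q = NXT q ∧ LEV' q = LEV q ∧ D' q = D q :=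
    fun q hq => ⟨by rw [hMK, if_neg hq], by rw [hNXT, if_neg hq], by rw [hLEV, if_neg hq],
      by rw [hD, if_neg hq]⟩
  have new : MK' a = 1 ∧ NXT' a = p ∧ LEV' a = LEV p + 1 ∧ D' a = D p + K a - x p - x p :=
    ⟨by rw [hMK, if_pos rfl], by rw [hNXT, if_pos rfl], by rw [hLEV, if_pos rfl],
      by rw [hD, if_pos rfl]⟩
  have hne : ∀ q, MK q = 1 → q ≠ a := fun q hq hqa => by rw [hqa, hma] at hq; omega
  have hcase : ∀ q, MK' q = 1 → q = a ∨ q ≠ a ∧ MK q = 1 := fun q hq => by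
    by_cases hqp : q = a
    · exact .inl hqp
    · rw [(old q hqp).1] at hq; exact .inr ⟨hqp, hq⟩
  obtain ⟨o1, o2, o3, o4⟩ := old Q (hne Q hR.mark)
  obtain ⟨p1, p2, p3, p4⟩ := old p (by omega)
  refine ⟨hR.le, o1.trans hR.mark, o3.trans hR.lev, o4.trans hR.cost, fun q hq hm hqQ => ?_,
    fun q hq h0 hm => ?_, fun q hq hm => ?_⟩
  · rcases hcase q hm with rfl | ⟨hqa, hm⟩
    · rw [new.2.1, p1, p3, p4, new.2.2.1, new.2.2.2]
      exact ⟨by omega, hmp, rfl, .inl ⟨hpa, hp, by ring⟩⟩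
    · have k := hR.next q hq hm hqQ
      obtain ⟨j1, j2, j3, j4⟩ := old q hqa
      obtain ⟨l1, l2, l3, l4⟩ := old (NXT q) (hne _ k.2.1)
      rw [j2, j3, j4, l1, l3, l4]
      exact k
  · rcases hcase q hm with rfl | ⟨hqa, hm⟩
    · rw [hp, Nat.add_sub_cancel]
      exact ⟨p1.trans hmp, .inl ⟨fun hc => hne Q hR.mark hc.symm, new.2.1⟩⟩
    · obtain ⟨k1, k2⟩ := hR.up q hq h0 hm
      obtain ⟨j1, j2, -⟩ := old q hqa
      obtain ⟨l1, l2, -⟩ := old _ (hne _ k1)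
      rw [l1, l2, j2]
      exact ⟨k1, k2⟩
  · rcases hcase q hm with rfl | ⟨hqa, hm⟩
    · have := hR.lev_le p (by omega) hmp
      rw [new.2.2.1]; omega
    · rw [(old q hqa).2.2.1]; exact hR.lev_le q hq hm

end

/-! ### Searching for a minimum -/

/-- `z` minimizes `val` on the numbers below `a` that satisfy `P`; it is `h + 1` if there are
none. -/
def Picked {α : Type} [LinearOrder α] (P : ℕ → Prop) (val : ℕ → α) (h a z : ℕ) : Prop :=
  (z = h + 1 ∧ ∀ q < a, ¬ P q) ∨ (z < a ∧ P z ∧ ∀ q < a, P q → val z ≤ val q)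

namespace Picked

variable {α : Type} [LinearOrder α] {P : ℕ → Prop} {val : ℕ → α} {h a z : ℕ}

theorem zero : Picked P val h 0 (h + 1) := .inl ⟨rfl, fun _ hq => by omega⟩

theorem skip (hz : Picked P val h a z) (hP : ¬ P a) : Picked P val h (a + 1) z := by
  have hcase : ∀ q, q < a + 1 → q = a ∨ q < a := by omega
  rcases hz with ⟨h1, h2⟩ | ⟨h1, h2, h3⟩
  · refine .inl ⟨h1, fun q hq => ?_⟩
    rcases hcase q hq with rfl | hq
    exacts [hP, h2 q hq]
  · refine .inr ⟨by omega, h2, fun q hq hPq => ?_⟩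
    rcases hcase q hq with rfl | hq
    exacts [absurd hPq hP, h3 q hq hPq]

theorem take (hz : Picked P val h a z) (hP : P a) (hlt : z = h + 1 ∨ val a < val z)
    (ha : a ≤ h) : Picked P val h (a + 1) a := by
  refine .inr ⟨by omega, hP, fun q hq hPq => ?_⟩
  rcases (by omega : q = a ∨ q < a) with rfl | hq
  · exact le_rfl
  · rcases hz with ⟨-, h2⟩ | ⟨h1, -, h3⟩
    · exact absurd hPq (h2 q hq)
    · rcases hlt with hlt | hlt
      · omega
      · exact hlt.le.trans (h3 q hq hPq)

theorem keep (hz : Picked P val h a z) (hzh : z ≠ h + 1) (hle : ¬ val a < val z) :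
    Picked P val h (a + 1) z := by
  rcases hz with ⟨h1, -⟩ | ⟨h1, h2, h3⟩
  · exact absurd h1 hzh
  · refine .inr ⟨by omega, h2, fun q hq hPq => ?_⟩
    rcases (by omega : q = a ∨ q < a) with rfl | hq
    exacts [not_lt.1 hle, h3 q hq hPq]

end Picked

/-! ### The common part of the queries -/

/-- Among the positions whose top is an ancestor of the target, the one with the least class number
is kept; the label interval decides ancestry in constant time. -/
def findBody : Program :=
  .ite (.lt (ld .input 3 (ld .input 7 (rg 5 + rg 8))) (ld .input 3 (rg 2) + 1))
    (.ite (.lt (ld .input 3 (rg 2)) (ld .input 4 (ld .input 7 (rg 5 + rg 8))))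
      (.ite (.eq (rg 7) (rg 6)) (.set 7 (rg 8))
        (.ite (.lt (ld .input 6 (rg 5 + rg 8)) (ld .input 6 (rg 5 + rg 7))) (.set 7 (rg 8)) .skip))
      .skip) .skip

def climbBody : Program :=
  .set 9 (ld .input 8 (rg 5 + rg 8) - 1) ;; st .work 0 (rg 9) 1 ;; st .work 1 (rg 9) (rg 8) ;;
  st .work 2 (rg 9) (ld .work 2 (rg 8) + 1) ;;
  rst .work 0 (rg 9) (rld .work 0 (rg 8) + rld .input 1 (rg 5 + rg 8) -
    rld .input 0 (ld .input 7 (rg 5 + rg 8)) - rld .input 0 (ld .input 7 (rg 5 + rg 8))) ;;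
  .set 8 (rg 9)

def climb : Program :=
  .set 8 (rg 7) ;; st .work 0 (rg 7) 1 ;;
  .loop (.lt 0 (ld .input 8 (rg 5 + rg 8))) climbBody

def sweepBody : Program :=
  .ite (.eq (ld .work 0 (rg 8)) 0)
    (.ite (.lt 0 (ld .input 8 (rg 5 + rg 8)))
      (.set 9 (ld .input 8 (rg 5 + rg 8) - 1) ;;
        .ite (.eq (ld .work 0 (rg 9)) 1)
          (st .work 0 (rg 8) 1 ;; st .work 1 (rg 8) (rg 9) ;;
            st .work 2 (rg 8) (ld .work 2 (rg 9) + 1) ;;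
            rst .work 0 (rg 8) (rld .work 0 (rg 9) + rld .input 1 (rg 5 + rg 8) -
              rld .input 0 (ld .input 7 (rg 5 + rg 9)) - rld .input 0 (ld .input 7 (rg 5 + rg 9))))
          .skip) .skip) .skip

def pickBody : Program :=
  .ite (.eq (ld .work 0 (rg 8)) 1)
    (.ite (.lt (ld .input 6 (rg 5 + rg 8)) (rg 1)) .skip
      (.ite (.eq (rg 12) (rg 6)) (.set 12 (rg 8))
        (.ite (.rlt (rld .work 0 (rg 8)) (rld .work 0 (rg 12))) (.set 12 (rg 8)) .skip))) .skip

/-- Registers 7 and 12 start at `h + 1`, the value that means "none" in both searches. -/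
def askInit : Program :=
  .set 3 (ld .input 0 0 + 1) ;; .set 4 (ld .input 5 (rg 0)) ;; .set 5 (rg 0 * rg 3) ;;
  .set 6 (rg 4 + 1) ;; .set 7 (rg 6) ;; .set 12 (rg 6)

def locate : Program :=
  askInit ;; forTo 8 6 findBody ;; climb ;; forTo 8 6 sweepBody ;; forTo 8 6 pickBody

/-- The oracle and the parameters of the query. -/
structure Asks (A : ℕ → ℕ → ℕ) (R : ℕ → ℕ → ℝ) (v η t base h : ℕ) (s : Store) : Prop where
  inp : ∀ k < 16, s.arr .input k = A k
  rinp : ∀ k < 16, s.rarr .input k = R k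
  r0 : s.reg 0 = v
  r1 : s.reg 1 = η
  r2 : s.reg 2 = t
  r5 : s.reg 5 = base
  r6 : s.reg 6 = h + 1

theorem Asks.frame {A : ℕ → ℕ → ℕ} {R : ℕ → ℕ → ℝ} {v η t base h : ℕ} {s s' : Store}
    {c : Program} (hs : Asks A R v η t base h s) (fr : Frame c s s')
    (hi : ∀ k, c.modArr .input k = false := by intro; rfl)
    (hr : ∀ k, c.modRArr .input k = false := by intro; rfl)
    (h0 : c.modReg 0 = false := by rfl) (h1 : c.modReg 1 = false := by rfl)
    (h2 : c.modReg 2 = false := by rfl) (h5 : c.modReg 5 = false := by rfl)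
    (h6 : c.modReg 6 = false := by rfl) : Asks A R v η t base h s' :=
  ⟨fun k hk => (fr.arr .input k (hi k) hk).trans (hs.inp k hk),
    fun k hk => (fr.rarr .input k (hr k) hk).trans (hs.rinp k hk),
    (fr.reg 0 h0).trans hs.r0, (fr.reg 1 h1).trans hs.r1, (fr.reg 2 h2).trans hs.r2,
    (fr.reg 5 h5).trans hs.r5, (fr.reg 6 h6).trans hs.r6⟩

/-! ### Finding the class of the target, re-rooting its tree and choosing a start -/

section

variable {A : ℕ → ℕ → ℕ} {R : ℕ → ℕ → ℝ} {v η t base h B : ℕ} {s : Store}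

theorem find_spec (hs : Asks A R v η t base h s) (h7 : s.reg 7 = h + 1) (hB : h + 1 ≤ B) :
    Runs B (forTo 8 6 findBody) s ((h + 1) * 88 + 8) (fun s' =>
      Picked (fun q => A 3 (A 7 (base + q)) ≤ A 3 t ∧ A 3 t < A 4 (A 7 (base + q)))
        (fun q => A 6 (base + q)) h (h + 1) (s'.reg 7)) := by
  refine Runs.forTo (h + 1) 80 _ (fun a s' =>
      Picked (fun q => A 3 (A 7 (base + q)) ≤ A 3 t ∧ A 3 t < A 4 (A 7 (base + q)))
        (fun q => A 6 (base + q)) h a (s'.reg 7)) hs.r6 rfl rfl rfl le_rfl ?_ ?_ ?_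
  · simp [h7, Picked.zero]
  · rintro a s' ha h8 - fr hb inv
    have hs' := hs.frame fr
    refine .straight rfl (by decide) ?_
    simp only [findBody, wp_ite, wp_set, wp_skip, holds_lt, holds_eq, eval_ld, eval_reg, eval_add,
      eval_ofNat, reg_setReg, h8, hs'.r2, hs'.r5, hs'.r6, hs'.inp 3 (by norm_num),
      hs'.inp 4 (by norm_num), hs'.inp 6 (by norm_num), hs'.inp 7 (by norm_num), if_true,
      Nat.reduceEqDiff, if_false]
    refine ⟨fun c1 => ⟨fun c2 => ⟨fun c3 => ⟨by omega, ?_⟩, fun c3 => ⟨fun c4 => ⟨by omega, ?_⟩,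
      fun c4 => ?_⟩⟩, fun c2 => ?_⟩, fun c1 => ?_⟩
    · exact inv.take ⟨by omega, c2⟩ (.inl c3) (by omega)
    · exact inv.take ⟨by omega, c2⟩ (.inr c4) (by omega)
    · exact inv.keep c3 c4
    · exact inv.skip fun hc => c2 hc.2
    · exact inv.skip fun hc => c1 (by omega)
  · rintro s' - inv; exact inv

structure ClimbStart (Q : ℕ) (s s' : Store) : Prop where
  r8 : s'.reg 8 = Q
  mark : ∀ q, s'.arr .work 0 q = if q = Q then 1 else s.arr .work 0 q

/-- The position strictly decreases on the way to the root of the forest tree, so it serves as time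
budget. At the end `PR c = 0`, which makes the climbed path a `Linked` structure. -/
theorem climb_spec (hs : Asks A R v η t base h s) {Q : ℕ} (h7 : s.reg 7 = Q) (hQ : Q ≤ h)
    (hB : h + 1 ≤ B) (hPR : ∀ q ≤ h, A 8 (base + q) ≤ q)
    (h0 : ∀ q, s.arr .work 0 q = 0) (h2 : ∀ q, s.arr .work 2 q = 0)
    (hr : ∀ q, s.rarr .work 0 q = 0) :
    Runs B climb s ((h + 1) * 200 + 50) (fun s' => (∀ q, s'.arr .work 0 q ≤ 1) ∧
      Linked h Q (fun q => A 8 (base + q)) (fun q => R 1 (base + q))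
        (fun q => R 0 (A 7 (base + q))) (s'.arr .work 0) (s'.arr .work 1) (s'.arr .work 2)
        (s'.rarr .work 0)) := by
  refine .seq 5 ((h + 1) * 200 + 40) (fun s' => s' = s.setReg 8 Q)
    (.straight rfl (by decide) ?_) (by omega) ?_
  · simp only [wp_set, eval_reg, h7]; exact ⟨by omega, trivial⟩
  rintro s0 fr0 - hs0
  have hs0' := hs.frame fr0
  refine .seq 10 ((h + 1) * 200 + 20) (ClimbStart Q s) (.straight rfl (by decide) ?_)
    (by omega) ?_
  · rw [hs0]
    simp only [wp_st, eval_reg, eval_ofNat, reg_setReg, h7, Nat.reduceEqDiff, if_false]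
    refine ⟨by omega, ?_⟩
    constructor <;> simp
  rintro s1 fr1 - ⟨k8, kmk⟩
  have hs1 := hs0'.frame fr1
  refine .loop (fun T s' => ∃ c, s'.reg 8 = c ∧ (c + 1) * 200 ≤ T ∧
    Climbed h Q c (fun q => A 8 (base + q)) (fun q => R 1 (base + q))
        (fun q => R 0 (A 7 (base + q))) (s'.arr .work 0) (s'.arr .work 1) (s'.arr .work 2)
        (s'.rarr .work 0)) (by simp [Test.deg, ld, NExp.deg]) ⟨Q, k8, by omega, ?_⟩ ?_
  · refine .init hQ (fun q => by rw [kmk, h0]) ?_ ?_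
    · rw [fr1.arr .work 2, fr0.arr .work 2, h2]
    · rw [fr1.rarr .work 0, fr0.rarr .work 0, hr]
  rintro T s' fr hb ⟨c, h8, hT, hC⟩
  have hs' := hs1.frame fr
  have hcQ := (hC.rng c hC.mark_c).2
  have hle := hPR c (by omega)
  simp only [holds_lt, eval_ld, eval_reg, eval_add, eval_ofNat, h8, hs'.r5,
    hs'.inp 8 (by norm_num)]
  have hcost : (Test.lt 0 (ld .input 8 (rg 5 + rg 8))).cost ≤ 10 := by decide
  refine ⟨fun hpos => ⟨150, c * 200, by omega, .straight rfl (by decide) ?_⟩,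
    fun hpos => ⟨by omega, hC.le_one, hC.linked (by omega)⟩⟩
  obtain ⟨p, hp⟩ : ∃ p, A 8 (base + c) = p + 1 := ⟨A 8 (base + c) - 1, by omega⟩
  have hlev := hC.lev_le c hC.mark_c
  simp only [climbBody, wp_seq, wp_set, wp_st, wp_rst, eval_ld, eval_reg, eval_add, eval_sub,
    eval_ofNat, reval_sub, reval_add, reval_rld, reg_setReg, reg_wr, reg_rwr, h8, hs'.r5,
    arr_setReg, rarr_setReg, rarr_wr, if_true, Nat.reduceEqDiff, if_false, hp,
    Nat.add_sub_cancel, hs'.inp 8 (by norm_num),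
    arr_wr_bank _ .work .input 0 7 _ _ (by norm_num) (by norm_num) (by simp),
    arr_wr_bank _ .work .input 1 7 _ _ (by norm_num) (by norm_num) (by simp),
    arr_wr_bank _ .work .input 2 7 _ _ (by norm_num) (by norm_num) (by simp),
    arr_wr_idx _ .work 0 2 _ _ (by norm_num) (by norm_num) (by norm_num),
    arr_wr_idx _ .work 1 2 _ _ (by norm_num) (by norm_num) (by norm_num),
    hs'.inp 7 (by norm_num), hs'.rinp 0 (by norm_num), hs'.rinp 1 (by norm_num)]
  refine ⟨by omega, by omega, by omega, by omega, by omega, p, rfl, by nlinarith, ?_⟩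
  refine hC.push (p := p) hp (by omega) (fun q => ?_) (fun q => ?_) (fun q => ?_) (fun q => ?_)
  all_goals simp

/-- Parents have smaller positions, so one pass in increasing order marks the whole tree of `Q`. -/
theorem sweep_spec (hs : Asks A R v η t base h s) {Q : ℕ} (hB : 2 * h + 2 ≤ B)
    (hPR : ∀ q ≤ h, A 8 (base + q) ≤ q) (h1 : ∀ q, s.arr .work 0 q ≤ 1)
    (hL : Linked h Q (fun q => A 8 (base + q)) (fun q => R 1 (base + q))
        (fun q => R 0 (A 7 (base + q))) (s.arr .work 0) (s.arr .work 1) (s.arr .work 2)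
        (s.rarr .work 0)) :
    Runs B (forTo 8 6 sweepBody) s ((h + 1) * 128 + 8) (fun s' =>
      Rerooted h Q (fun q => A 8 (base + q)) (fun q => R 1 (base + q))
        (fun q => R 0 (A 7 (base + q))) (s'.arr .work 0) (s'.arr .work 1) (s'.arr .work 2)
        (s'.rarr .work 0)) := by
  refine Runs.forTo (h + 1) 120 _ (fun a s' => (∀ q, s'.arr .work 0 q ≤ 1) ∧
      (∀ q < a, A 8 (base + q) ≠ 0 → s'.arr .work 0 (A 8 (base + q) - 1) = 1 →
        s'.arr .work 0 q = 1) ∧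
      Linked h Q (fun q => A 8 (base + q)) (fun q => R 1 (base + q))
        (fun q => R 0 (A 7 (base + q))) (s'.arr .work 0) (s'.arr .work 1) (s'.arr .work 2)
        (s'.rarr .work 0)) hs.r6 rfl rfl rfl le_rfl ?_ ?_ ?_
  · exact ⟨h1, by simp, hL⟩
  · rintro a s' ha h8 - fr hb ⟨i1, i2, i3⟩
    have hs' := hs.frame fr
    refine .straight rfl (by decide) ?_
    have keep : (A 8 (base + a) ≠ 0 → s'.arr .work 0 (A 8 (base + a) - 1) = 1 →
        s'.arr .work 0 a = 1) → (∀ q < a + 1, A 8 (base + q) ≠ 0 →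
          s'.arr .work 0 (A 8 (base + q) - 1) = 1 → s'.arr .work 0 q = 1) := by
      intro hk q hq
      rcases (by omega : q = a ∨ q < a) with rfl | hq
      exacts [hk, i2 q hq]
    simp only [sweepBody, wp_ite, wp_seq, wp_set, wp_skip, wp_st, wp_rst, holds_lt, holds_eq,
      eval_ld, eval_reg, eval_add, eval_sub,
      eval_ofNat, reval_sub, reval_add, reval_rld, reg_setReg, reg_wr, h8, hs'.r5,
      arr_setReg, rarr_setReg, rarr_wr, arr_rwr, if_true, Nat.reduceEqDiff, if_false,
      hs'.inp 8 (by norm_num),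
      arr_wr_bank _ .work .input 0 7 _ _ (by norm_num) (by norm_num) (by simp),
      arr_wr_bank _ .work .input 1 7 _ _ (by norm_num) (by norm_num) (by simp),
      arr_wr_bank _ .work .input 2 7 _ _ (by norm_num) (by norm_num) (by simp),
      arr_wr_idx _ .work 0 2 _ _ (by norm_num) (by norm_num) (by norm_num),
      arr_wr_idx _ .work 1 2 _ _ (by norm_num) (by norm_num) (by norm_num),
      hs'.inp 7 (by norm_num), hs'.rinp 0 (by norm_num), hs'.rinp 1 (by norm_num)]
    refine ⟨fun c1 => ⟨fun c2 => ?_, fun c2 => ⟨i1, keep fun hc => by omega, i3⟩⟩,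
      fun c1 => ⟨i1, keep fun _ _ => by have := i1 a; omega, i3⟩⟩
    obtain ⟨p, hp⟩ : ∃ p, A 8 (base + a) = p + 1 := ⟨A 8 (base + a) - 1, by omega⟩
    have hle := hPR a (by omega)
    simp only [hp, Nat.add_sub_cancel]
    refine ⟨by omega, fun c3 => ?_, fun c3 => ⟨i1, keep fun _ hc => absurd (by simpa [hp] using hc) c3, i3⟩⟩
    have hlev := i3.lev_le p (by omega) c3
    refine ⟨by omega, by omega, by omega, fun q => ?_, fun q hq h0 hm => ?_, ?_⟩
    · have := i1 q
      simp; split_ifs <;> omega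
    · have := i2 q
      have hq2 := hPR q (by omega)
      simp at hm ⊢
      rcases (by omega : q = a ∨ q < a) with rfl | hq
      · exact fun hne => absurd rfl hne
      · exact fun _ => this hq h0 (hm (by omega))
    · refine i3.push (p := p) (fun q hq _ => hPR q hq) (by omega) c1 hp c3 (fun q => ?_)
        (fun q => ?_) (fun q => ?_) (fun q => ?_)
      all_goals simp
  · rintro s' - ⟨i1, i2, i3⟩
    exact ⟨i3, fun q hq => i2 q (by omega)⟩

theorem pick_spec (hs : Asks A R v η t base h s) (h12 : s.reg 12 = h + 1) (hB : h + 1 ≤ B) :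
    Runs B (forTo 8 6 pickBody) s ((h + 1) * 58 + 8) (fun s' =>
      Picked (fun q => s.arr .work 0 q = 1 ∧ η ≤ A 6 (base + q)) (s.rarr .work 0) h (h + 1)
        (s'.reg 12)) := by
  refine Runs.forTo (h + 1) 50 _ (fun a s' =>
      Picked (fun q => s.arr .work 0 q = 1 ∧ η ≤ A 6 (base + q)) (s.rarr .work 0) h a
        (s'.reg 12)) hs.r6 rfl rfl rfl le_rfl ?_ ?_ ?_
  · simp [h12, Picked.zero]
  · rintro a s' ha h8 - fr hb inv
    have hs' := hs.frame fr
    refine .straight rfl (by decide) ?_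
    simp only [pickBody, wp_ite, wp_set, wp_skip, holds_lt, holds_eq, holds_rlt, eval_ld, eval_reg,
      eval_add, reval_rld,
      eval_ofNat, reg_setReg, h8, hs'.r1, hs'.r5, hs'.r6, hs'.inp 6 (by norm_num),
      fr.arr .work 0, fr.rarr .work 0, if_true, Nat.reduceEqDiff, if_false]
    refine ⟨fun c1 => ⟨fun c2 => ?_, fun c2 => ⟨fun c3 => ⟨by omega, ?_⟩, fun c3 =>
      ⟨fun c4 => ⟨by omega, ?_⟩, fun c4 => ?_⟩⟩⟩, fun c1 => ?_⟩
    · exact inv.skip fun hc => by omega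
    · exact inv.take ⟨c1, by omega⟩ (.inl c3) (by omega)
    · exact inv.take ⟨c1, by omega⟩ (.inr c4) (by omega)
    · exact inv.keep c3 c4
    · exact inv.skip fun hc => c1 hc.1
  · rintro s' - inv; exact inv

end

/-- The result of the common part of the queries: the forest is re-rooted at the position `Q` of
the target, and register `12` holds the best position of a class at least `η`. -/
structure Located (par : ℕ → ℕ) (A : ℕ → ℕ → ℕ) (R : ℕ → ℕ → ℝ) (v η t base h Q : ℕ)
    (s : Store) : Prop where
  asks : Asks A R v η t base h s
  class_eq : A 6 (base + Q) = cmp par v h t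
  rerooted : Rerooted h Q (fun q => A 8 (base + q)) (fun q => R 1 (base + q))
    (fun q => R 0 (A 7 (base + q))) (s.arr .work 0) (s.arr .work 1) (s.arr .work 2)
    (s.rarr .work 0)
  picked : Picked (fun q => s.arr .work 0 q = 1 ∧ η ≤ A 6 (base + q)) (s.rarr .work 0) h (h + 1)
    (s.reg 12)
  out : s.mem .output 0 = 0

structure AskStart (base h : ℕ) (s' : Store) : Prop where
  r5 : s'.reg 5 = base
  r6 : s'.reg 6 = h + 1
  r7 : s'.reg 7 = h + 1
  r12 : s'.reg 12 = h + 1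

theorem locate_spec {g : Inst} (hg : g.Valid) {A : ℕ → ℕ → ℕ} {R : ℕ → ℕ → ℝ}
    (hO : IsOracle g A R) {v η t B : ℕ} {s : Store} (hv : v < g.n) (htn : t < g.n)
    (hB : 2 * g.f + 2 ≤ B) (hBn : g.n * (g.f + 1) ≤ B)
    (hinp : ∀ k < 16, s.arr .input k = A k) (hrinp : ∀ k < 16, s.rarr .input k = R k)
    (h0 : s.reg 0 = v) (h1 : s.reg 1 = η) (h2 : s.reg 2 = t)
    (hw : ∀ k q, s.arr .work k q = 0) (hrw : ∀ q, s.rarr .work 0 q = 0)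
    (hout : ∀ k q, s.arr .output k q = 0) :
    Runs B locate s (1000 * (g.f + 1)) (fun s' =>
      ∃ Q, Located (A 1) A R v η t (v * (g.f + 1)) (A 5 v) Q s') := by
  obtain ⟨ord, ht⟩ := hO.rooted
  obtain ⟨base, hbase⟩ : ∃ base, base = v * (g.f + 1) := ⟨_, rfl⟩
  obtain ⟨h, hh⟩ : ∃ h, h = A 5 v := ⟨_, rfl⟩
  have hhv := hO.height v hv
  have hG := hO.grown v hv
  have hX := hO.tops v hv
  rw [← hh] at hhv hG hX ⊢
  rw [← hbase] at hG hX ⊢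
  have hhf : h ≤ g.f := by omega
  have hbB : base ≤ B := by
    rw [hbase]
    exact (Nat.mul_le_mul_right _ hv.le).trans hBn
  have hPR : ∀ q ≤ h, A 8 (base + q) ≤ q := by
    intro q hq
    by_cases h0 : A 8 (base + q) = 0
    · omega
    · exact (hG.edge q (by omega) h0).1
  refine .seq 40 (g.f * 500 + 900) (AskStart base h) (.straight rfl (by decide) ?_) (by omega) ?_
  · simp only [askInit, wp_seq, wp_set, eval_ld, eval_reg, eval_add, eval_mul, eval_ofNat,
      reg_setReg, arr_setReg, hinp 0 (by norm_num), hinp 5 (by norm_num), hO.f, h0, ← hh, ← hbase,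
      if_true, Nat.reduceEqDiff, if_false]
    refine ⟨by omega, by omega, hbB, by omega, by omega, by omega, ?_⟩
    constructor <;> simp
  rintro s1 fr1 - ⟨k5, k6, k7, k12⟩
  have hs1 : Asks A R v η t base h s1 :=
    ⟨fun k hk => (fr1.arr .input k (by rfl) hk).trans (hinp k hk),
      fun k hk => (fr1.rarr .input k (by rfl) hk).trans (hrinp k hk),
      (fr1.reg 0).trans h0, (fr1.reg 1).trans h1, (fr1.reg 2).trans h2, k5, k6⟩
  refine .seq _ (g.f * 400 + 700) _ (find_spec hs1 k7 (by omega)) (by omega) ?_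
  intro s2 fr2 _ hfind
  have hs2 := hs1.frame fr2
  obtain ⟨Q, hQ⟩ : ∃ Q, s2.reg 7 = Q := ⟨_, rfl⟩
  rw [hQ] at hfind
  have htop : ∀ q ≤ h, (A 3 (A 7 (base + q)) ≤ A 3 t ∧ A 3 t < A 4 (A 7 (base + q)) ↔
      Anc (A 1) (top (A 1) g.r v h (A 6 (base + q))) t) := by
    intro q hq
    rw [hX q hq, hO.label _ (ht.top_lt hg hv _ _) t htn]
  obtain ⟨q0, hq0, hN0⟩ := hG.surj (cmp_le (A 1) v h t)
  have hq0' := (htop q0 hq0).2 (by rw [hN0]; exact ht.anc_top_cmp htn)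
  -- Every class occurs in the forest, so the search succeeds; minimality over tops above `t` is
  -- exactly the definition of the class of `t`.
  have hQc : Q ≤ h ∧ A 6 (base + Q) = cmp (A 1) v h t := by
    rcases hfind with ⟨-, hno⟩ | ⟨c1, c2, c3⟩
    · exact absurd hq0' (hno q0 (by omega))
    · refine ⟨by omega, le_antisymm ((c3 q0 (by omega) hq0').trans hN0.le) ?_⟩
      exact Rooted.cmp_le_of_anc_top ((htop Q (by omega)).1 c2)
  refine .seq _ (g.f * 200 + 400) _ (climb_spec hs2 hQ hQc.1 (by omega) hPR
    (fun q => by rw [fr2.arr .work 0, fr1.arr .work 0, hw])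
    (fun q => by rw [fr2.arr .work 2, fr1.arr .work 2, hw])
    (fun q => by rw [fr2.rarr .work 0, fr1.rarr .work 0, hrw])) (by omega) ?_
  rintro s3 fr3 - ⟨hone, hlinked⟩
  have hs3 := hs2.frame fr3
  refine .seq _ (g.f * 60 + 100) _ (sweep_spec hs3 (by omega) hPR hone hlinked) (by omega) ?_
  intro s4 fr4 _ hre
  have hs4 := hs3.frame fr4
  refine (pick_spec hs4 ((fr4.reg 12).trans ((fr3.reg 12).trans ((fr2.reg 12).trans k12)))
    (by omega)).mono (by omega) ?_
  intro s5 fr5 _ hpick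
  refine ⟨Q, hs4.frame fr5, hQc.2, ?_, ?_, ?_⟩
  · rw [fr5.arr .work 0, fr5.arr .work 1, fr5.arr .work 2, fr5.rarr .work 0]; exact hre
  · rw [fr5.arr .work 0, fr5.rarr .work 0]; exact hpick
  · have : s5.arr .output 0 0 = 0 := by
      rw [fr5.arr .output 0, fr4.arr .output 0, fr3.arr .output 0, fr2.arr .output 0,
        fr1.arr .output 0, hout]
    exact this

/-! ### Single rounds of loops and branches on the first test -/

namespace Runs

variable {B T : ℕ} {c d : Program} {s : Store} {Q : Store → Prop} {t : Test}

theorem loop_true (ht : t.deg ≤ 8) (hs : t.Holds s) (T₁ T₂ : ℕ) (Q₁ : Store → Prop)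
    (hc : Runs B c s T₁ Q₁) (hT : t.cost + T₁ + T₂ ≤ T)
    (hl : ∀ s₁, Frame c s s₁ → Bdd B s₁ → Q₁ s₁ → Runs B (.loop t c) s₁ T₂ Q) :
    Runs B (.loop t c) s T Q := fun W hW hb =>
  let ⟨_, s₁, h1, h2, h3, h4⟩ := hc W hW hb
  let ⟨_, s₂, k1, k2, k3, k4⟩ := hl s₁ h1.frame h3 h4 W hW h3
  ⟨_, s₂, .loopTrue _ _ _ _ _ _ _ (t.fits hb hW ht) hs h1 k1, by omega, k3, k4⟩

theorem loop_false (ht : t.deg ≤ 8) (hs : ¬ t.Holds s) (hT : t.cost ≤ T) (hQ : Q s) :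
    Runs B (.loop t c) s T Q := fun _ hW hb =>
  ⟨_, s, .loopFalse _ _ _ (t.fits hb hW ht) hs, hT, hb, hQ⟩

theorem ite_true (ht : t.deg ≤ 8) (hs : t.Holds s) (T₁ : ℕ) (hc : Runs B c s T₁ Q)
    (hT : t.cost + T₁ ≤ T) : Runs B (.ite t c d) s T Q := fun W hW hb =>
  let ⟨_, s₁, h1, h2, h3, h4⟩ := hc W hW hb
  ⟨_, s₁, .iteTrue _ _ _ _ _ _ (t.fits hb hW ht) hs h1, by omega, h3, h4⟩

theorem ite_false (ht : t.deg ≤ 8) (hs : ¬ t.Holds s) (T₁ : ℕ) (hd : Runs B d s T₁ Q)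
    (hT : t.cost + T₁ ≤ T) : Runs B (.ite t c d) s T Q := fun W hW hb =>
  let ⟨_, s₁, h1, h2, h3, h4⟩ := hd W hW hb
  ⟨_, s₁, .iteFalse _ _ _ _ _ _ (t.fits hb hW ht) hs h1, by omega, h3, h4⟩

end Runs

theorem Frame.mem {c : Program} {s s' : Store} (fr : Frame c s s') (b : Bank)
    (hc : ∀ k, c.modArr b k = false := by intro; rfl) : s'.mem b = s.mem b := by
  funext a
  have := congrFun (fr.arr b (a % 16) (hc _) (Nat.mod_lt _ (by norm_num))) (a / 16)
  unfold Store.arr at this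
  rwa [Nat.div_add_mod] at this

/-! ### The distance query -/

def report : Program :=
  .ite (.lt (rg 12) (rg 6)) (.store .output 0 1 ;;
    .rstore .output 0 (rld .work 0 (rg 12) + rld .input 0 (rg 2))) .skip

def distQuery : Program := locate ;; report

theorem report_spec {B : ℕ} {par : ℕ → ℕ} {A : ℕ → ℕ → ℕ} {R : ℕ → ℕ → ℝ} {v η t base h Q : ℕ}
    {s : Store} (hs : Located par A R v η t base h Q s) (hB : 1 ≤ B) :
    Runs B report s 40 (fun s' => (s.reg 12 = h + 1 → s'.mem .output 0 = 0) ∧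
      (s.reg 12 ≤ h → s'.mem .output 0 = 1 ∧
        s'.rmem .output 0 = s.rarr .work 0 (s.reg 12) + R 0 t)) := by
  have hA := hs.asks
  refine .straight rfl (by decide) ?_
  simp only [report, wp_ite, wp_seq, wp_store, wp_rstore, wp_skip, holds_lt, eval_reg, hA.r6,
    eval_ofNat, reval_add, reval_rld, rarr_write, reg_write, hA.r2, hA.rinp 0 (by norm_num)]
  refine ⟨fun c => ⟨hB, fun hc => by omega, fun _ => ?_⟩,
    fun c => ⟨fun _ => hs.out, fun hc => by omega⟩⟩
  simp

/-! ### The path query -/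

def goDownBody : Program :=
  .store .output (rg 13 + 2 - rg 8) (rg 15) ;; .set 15 (ld .input 1 (rg 15))

/-- Write the tree path down to the vertex in register `15`, which starts at depth `reg 14`. -/
def goDown : Program :=
  .set 18 (ld .input 2 (rg 15) + 1 - rg 14) ;; .set 13 (rg 13 + rg 18 - 1) ;;
  forTo 8 18 goDownBody

def goUpBody : Program :=
  .store .output (rg 13 + 3 + rg 8) (rg 15) ;; .set 15 (ld .input 1 (rg 15))

/-- Write the tree path from the vertex in register `15` up to the depth `reg 14`. -/
def goUp : Program :=
  .set 18 (ld .input 2 (rg 15) + 1 - rg 14) ;; forTo 8 18 goUpBody ;; .set 13 (rg 13 + rg 18)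

/-- A forest edge is stored at the later of its two positions. Register 15 receives the end in the
current class and register 19 the end in the next one, so the stored orientation is swapped when the
next position is the earlier one. -/
def chooseLink : Program :=
  .set 9 (ld .work 1 (rg 12)) ;;
  .ite (.lt (rg 9) (rg 12))
    (.set 15 (ld .input 10 (rg 5 + rg 12)) ;; .set 19 (ld .input 9 (rg 5 + rg 12)))
    (.set 15 (ld .input 9 (rg 5 + rg 9)) ;; .set 19 (ld .input 10 (rg 5 + rg 9)))

def turn : Program :=
  .set 15 (rg 19) ;; .set 14 (ld .input 2 (ld .input 7 (rg 5 + rg 9)))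

def linkBody : Program := chooseLink ;; goDown ;; turn ;; goUp ;; .set 12 (rg 9)

def links : Program := .loop (.lt 0 (ld .work 2 (rg 12))) linkBody

def emit : Program :=
  (.set 13 0 ;; .set 14 0) ;; links ;; .set 15 (rg 2) ;; goDown ;;
  .store .output 1 (rg 13) ;; .store .output 0 1

def pathQuery : Program := locate ;; .ite (.lt (rg 12) (rg 6)) emit .skip

/-! ### Writing tree paths downwards and upwards -/

section

variable {A : ℕ → ℕ → ℕ} {R : ℕ → ℕ → ℝ} {v η t base h B : ℕ} {s : Store}

structure WentDown (par : ℕ → ℕ) (a P len : ℕ) (s s' : Store) : Prop where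
  r13 : s'.reg 13 = P + len
  out : ∀ c, s'.mem .output c = if P + 2 ≤ c ∧ c ≤ P + 2 + len then par^[P + 2 + len - c] a
    else s.mem .output c

theorem goDown_spec (hs : Asks A R v η t base h s) {a P x : ℕ} (h15 : s.reg 15 = a)
    (h13 : s.reg 13 = P) (h14 : s.reg 14 = A 2 x) (hd : A 2 x ≤ A 2 a)
    (hB : P + (A 2 a - A 2 x) + 3 ≤ B) :
    Runs B goDown s ((A 2 a - A 2 x) * 40 + 100)
      (WentDown (A 1) a P (A 2 a - A 2 x) s) := by
  obtain ⟨len, hlen⟩ : ∃ len, len = A 2 a - A 2 x := ⟨_, rfl⟩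
  rw [← hlen] at hB ⊢
  have hl1 : A 2 a + 1 - A 2 x = len + 1 := by omega
  refine .seq 20 (len * 40 + 75) (fun s' => s' = s.setReg 18 (len + 1))
    (.straight rfl (by decide) ?_) (by omega) ?_
  · simp only [wp_set, eval_sub, eval_add, eval_ld, eval_reg, eval_ofNat, h15, h14,
      hs.inp 2 (by norm_num), hl1]
    exact ⟨by omega, trivial⟩
  rintro s0 fr0 - hs0
  refine .seq 10 (len * 40 + 60) (fun s' => s' = (s.setReg 18 (len + 1)).setReg 13 (P + len))
    (.straight rfl (by decide) ?_) (by omega) ?_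
  · rw [hs0]
    simp only [wp_set, eval_sub, eval_add, eval_reg, eval_ofNat, reg_setReg, h13, if_true,
      Nat.reduceEqDiff, if_false]
    rw [show P + (len + 1) - 1 = P + len by omega]
    exact ⟨by omega, rfl⟩
  rintro s1 fr1 - hs1
  have hA1 : Asks A R v η t base h s1 := (hs.frame fr0).frame fr1
  have k18 : s1.reg 18 = len + 1 := by rw [hs1]; simp
  have k13 : s1.reg 13 = P + len := by rw [hs1]; simp
  have k15 : s1.reg 15 = a := by rw [hs1]; simp [h15]
  have kout : s1.mem = s.mem := by rw [hs1]; simp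
  refine (Runs.forTo (Q := fun s' => ∀ c, s'.mem .output c =
      if P + 2 ≤ c ∧ c ≤ P + 2 + len then (A 1)^[P + 2 + len - c] a else s.mem .output c)
      (len + 1) 30 _ (fun i s' => s'.reg 15 = (A 1)^[i] a ∧ ∀ c, s'.mem .output c =
      if P + 2 + len < c + i ∧ c ≤ P + 2 + len then (A 1)^[P + 2 + len - c] a
      else s.mem .output c) k18 rfl rfl rfl (by omega) ?_ ?_ ?_).mono le_rfl ?_
  · refine ⟨by simp [k15], fun c => ?_⟩
    rw [if_neg (by omega), mem_setReg, kout]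
  · rintro i s' hi h8 - fr hb ⟨i1, i2⟩
    have hs' := hA1.frame fr
    refine .straight rfl (by decide) ?_
    have b15 := hb.reg 15
    rw [i1] at b15
    have barr := hb.arr .input 1 ((A 1)^[i] a)
    rw [hs'.inp 1 (by norm_num)] at barr
    simp only [goDownBody, wp_seq, wp_store, wp_set, eval_sub, eval_add, eval_reg, eval_ld,
      eval_ofNat, h8, i1, (fr.reg 13).trans k13, reg_write, arr_write_output_input,
      hs'.inp 1 (by norm_num), reg_setReg, mem_setReg, mem_write_same, if_true, Nat.reduceEqDiff,
      if_false]
    refine ⟨b15, barr, (Function.iterate_succ_apply' _ _ _).symm, fun c => ?_⟩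
    rw [i2]
    by_cases hc : c = P + len + 2 - i
    · rw [if_pos hc, if_pos (by omega)]
      congr 2; omega
    · rw [if_neg hc]
      by_cases hc2 : P + 2 + len < c + i ∧ c ≤ P + 2 + len
      · rw [if_pos hc2, if_pos (by omega)]
      · rw [if_neg hc2, if_neg (by omega)]
  · rintro s' - ⟨-, i2⟩ c
    rw [i2]
    by_cases hc : P + 2 ≤ c ∧ c ≤ P + 2 + len
    · rw [if_pos hc, if_pos (by omega)]
    · rw [if_neg hc, if_neg (by omega)]
  · rintro s' fr - ho
    exact ⟨(fr.reg 13).trans k13, ho⟩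

structure WentUp (par : ℕ → ℕ) (b P len : ℕ) (s s' : Store) : Prop where
  r13 : s'.reg 13 = P + 1 + len
  out : ∀ c, s'.mem .output c = if P + 3 ≤ c ∧ c ≤ P + 3 + len then par^[c - (P + 3)] b
    else s.mem .output c

theorem goUp_spec (hs : Asks A R v η t base h s) {b P x : ℕ} (h15 : s.reg 15 = b)
    (h13 : s.reg 13 = P) (h14 : s.reg 14 = A 2 x) (hd : A 2 x ≤ A 2 b)
    (hB : P + (A 2 b - A 2 x) + 3 ≤ B) :
    Runs B goUp s ((A 2 b - A 2 x) * 40 + 100)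
      (WentUp (A 1) b P (A 2 b - A 2 x) s) := by
  obtain ⟨len, hlen⟩ : ∃ len, len = A 2 b - A 2 x := ⟨_, rfl⟩
  rw [← hlen] at hB ⊢
  have hl1 : A 2 b + 1 - A 2 x = len + 1 := by omega
  refine .seq 20 (len * 40 + 75) (fun s' => s' = s.setReg 18 (len + 1))
    (.straight rfl (by decide) ?_) (by omega) ?_
  · simp only [wp_set, eval_sub, eval_add, eval_ld, eval_reg, eval_ofNat, h15, h14,
      hs.inp 2 (by norm_num), hl1]
    exact ⟨by omega, trivial⟩
  rintro s1 fr1 - hs1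
  have hA1 : Asks A R v η t base h s1 := hs.frame fr1
  have k18 : s1.reg 18 = len + 1 := by rw [hs1]; simp
  have k13 : s1.reg 13 = P := by rw [hs1]; simp [h13]
  have k15 : s1.reg 15 = b := by rw [hs1]; simp [h15]
  have kout : s1.mem = s.mem := by rw [hs1]; simp
  refine .seq (len * 40 + 60) 10 _ (Runs.forTo (Q := fun s' => ∀ c, s'.mem .output c =
      if P + 3 ≤ c ∧ c ≤ P + 3 + len then (A 1)^[c - (P + 3)] b else s.mem .output c)
      (len + 1) 30 _ (fun i s' => s'.reg 15 = (A 1)^[i] b ∧ ∀ c, s'.mem .output c =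
      if P + 3 ≤ c ∧ c < P + 3 + i then (A 1)^[c - (P + 3)] b
      else s.mem .output c) k18 rfl rfl rfl (by omega) ?_ ?_ ?_) (by omega) ?_
  · refine ⟨by simp [k15], fun c => ?_⟩
    rw [if_neg (by omega), mem_setReg, kout]
  · rintro i s' hi h8 - fr hb ⟨i1, i2⟩
    have hs' := hA1.frame fr
    refine .straight rfl (by decide) ?_
    have b15 := hb.reg 15
    rw [i1] at b15
    have barr := hb.arr .input 1 ((A 1)^[i] b)
    rw [hs'.inp 1 (by norm_num)] at barr
    simp only [goUpBody, wp_seq, wp_store, wp_set, eval_add, eval_reg, eval_ld,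
      eval_ofNat, h8, i1, (fr.reg 13).trans k13, reg_write, arr_write_output_input,
      hs'.inp 1 (by norm_num), reg_setReg, mem_setReg, mem_write_same, if_true, Nat.reduceEqDiff,
      if_false]
    refine ⟨b15, barr, (Function.iterate_succ_apply' _ _ _).symm, fun c => ?_⟩
    rw [i2]
    by_cases hc : c = P + 3 + i
    · rw [if_pos hc, if_pos (by omega)]
      congr 2; omega
    · rw [if_neg hc]
      by_cases hc2 : P + 3 ≤ c ∧ c < P + 3 + i
      · rw [if_pos hc2, if_pos (by omega)]
      · rw [if_neg hc2, if_neg (by omega)]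
  · rintro s' - ⟨-, i2⟩ c
    rw [i2]
    by_cases hc : P + 3 ≤ c ∧ c ≤ P + 3 + len
    · rw [if_pos hc, if_pos (by omega)]
    · rw [if_neg hc, if_neg (by omega)]
  · rintro s2 fr2 - ho
    refine .straight rfl (by decide) ?_
    simp only [wp_set, eval_add, eval_reg, (fr2.reg 18).trans k18, (fr2.reg 13).trans k13]
    refine ⟨by omega, ?_, ho⟩
    simp; omega

end

/-- A walk of weight `W` to `x` is described by the first `P` cells (starting with cell `2`) of
`out`, if the next cell is set to `x`. -/
def Prefix (g : Inst) (Al : ℕ → Prop) (out : ℕ → ℕ) (P x : ℕ) (W : ℝ) : Prop :=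
  ∀ σ : ℕ → ℕ, (∀ j < P, σ j = out (j + 2)) → σ P = x → IsWalk g Al σ P W

section

variable {g : Inst} {ord par dep : ℕ → ℕ} {dist : ℕ → ℝ} {v η : ℕ}

/-- The cell `P + 2` reserved for the top `x` is rewritten together with the path, with `x` itself
as the last ancestor reached from `a`. -/
theorem Prefix.down (ht : Rooted g ord par dep dist) (hv : v < g.n) (hη : η ≤ dep v) {x a P : ℕ}
    {W : ℝ} {out out' : ℕ → ℕ} (hp : Prefix g (g.Alive par v η) out P x W)
    (hd : Down par dep v η x a) (ha : a < g.n)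
    (ho : ∀ c, out' c = if P + 2 ≤ c ∧ c ≤ P + 2 + (dep a - dep x) then
      par^[P + 2 + (dep a - dep x) - c] a else out c) :
    IsWalk g (g.Alive par v η) (fun j => out' (j + 2)) (P + (dep a - dep x))
      (W + (dist a - dist x)) := by
  refine hd.walk_down ht hv hη ha (hp _ (fun j hj => ?_) ?_) (fun j hj => ?_)
  · rw [ho, if_neg (by omega)]
  · rw [ho, if_pos (by omega)]
    exact (congrArg (fun k => par^[k] a) (by omega)).trans (ht.iter_sub ha hd.anc)
  · rw [ho, if_pos (by omega)]
    congr 2; omega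

/-- After the climb to the top `x` the result is weakened to a `Prefix`, so that the next descent
may write `x` again. -/
theorem Prefix.link (ht : Rooted g ord par dep dist) (hv : v < g.n) (hη : η ≤ dep v)
    {x b P e : ℕ} {W : ℝ} {out out' : ℕ → ℕ}
    (hw : IsWalk g (g.Alive par v η) (fun j => out (j + 2)) P W)
    (hd : Down par dep v η x b) (hb : b < g.n) (he : e < g.m) (hal : g.Alive par v η e)
    (hj : g.Joins e (out (P + 2)) b)
    (ho : ∀ c, out' c = if P + 3 ≤ c ∧ c ≤ P + 3 + (dep b - dep x) then
      par^[c - (P + 3)] b else out c) :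
    Prefix g (g.Alive par v η) out' (P + 1 + (dep b - dep x)) x
      (W + g.wt e + (dist b - dist x)) := by
  have hw' : IsWalk g (g.Alive par v η) (fun j => out' (j + 2)) P W :=
    hw.congr fun j hj => by rw [ho, if_neg (by omega)]
  have hstep := IsWalk.step e hw' he hal (by
    rw [ho, if_neg (by omega), ho, if_pos (by omega)]
    rw [show P + 1 + 2 - (P + 3) = 0 by omega]
    exact hj)
  have hup := hd.walk_up ht hv hη hb hstep fun j hj => by
    rw [ho, if_pos (by omega)]
    congr 2; omega
  intro σ hσ hx
  refine hup.congr fun j hj => ?_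
  rcases hj.lt_or_eq with hj | rfl
  · exact hσ j hj
  · rw [hx, ho, if_pos (by omega)]
    exact ((congrArg (fun k => par^[k] b) (by omega)).trans (ht.iter_sub hb hd.anc)).symm

end

/-- The data of a query with a re-rooted forest. -/
structure Plan (g : Inst) (A : ℕ → ℕ → ℕ) (R : ℕ → ℕ → ℝ) (v η t base h Q : ℕ)
    (mk nxt lev : ℕ → ℕ) (D : ℕ → ℝ) : Prop where
  valid : g.Valid
  rooted : ∃ ord, Rooted g ord (A 1) (A 2) (R 0)
  v_lt : v < g.n
  t_lt : t < g.n
  le_h : η ≤ h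
  h_le : h ≤ A 2 v
  grown : Grown g (g.key (R 0)) (cmp (A 1) v h) h (h + 1) (fun q => A 6 (base + q))
    (fun q => A 8 (base + q)) (fun q => A 9 (base + q)) (fun q => A 10 (base + q))
    (fun q => R 1 (base + q))
  tops : ∀ q ≤ h, A 7 (base + q) = top (A 1) g.r v h (A 6 (base + q))
  linked : Linked h Q (fun q => A 8 (base + q)) (fun q => R 1 (base + q))
    (fun q => R 0 (A 7 (base + q))) mk nxt lev D
  class_eq : A 6 (base + Q) = cmp (A 1) v h t

structure LinkEnds (g : Inst) (A : ℕ → ℕ → ℕ) (R : ℕ → ℕ → ℝ) (v η base h : ℕ)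
    (D : ℕ → ℝ) (q p a b e : ℕ) : Prop where
  a_lt : a < g.n
  b_lt : b < g.n
  a_cmp : cmp (A 1) v h a = A 6 (base + q)
  b_cmp : cmp (A 1) v h b = A 6 (base + p)
  e_lt : e < g.m
  alive : g.Alive (A 1) v η e
  joins : g.Joins e a b
  cost : D q = D p + (R 0 a + g.wt e + R 0 b) - 2 * R 0 (A 7 (base + p))
  back : p < q → A 10 (base + q) = a ∧ A 9 (base + q) = b
  forth : ¬ p < q → A 9 (base + p) = a ∧ A 10 (base + p) = b

structure EmitAt (g : Inst) (A : ℕ → ℕ → ℕ) (R : ℕ → ℕ → ℝ) (v η t base h : ℕ)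
    (nxt lev : ℕ → ℕ) (q x P : ℕ) (W : ℝ) (s : Store) : Prop where
  asks : Asks A R v η t base h s
  nxt : s.arr .work 1 = nxt
  lev : s.arr .work 2 = lev
  r12 : s.reg 12 = q
  r13 : s.reg 13 = P
  r14 : s.reg 14 = A 2 x
  walk : Prefix g (g.Alive (A 1) v η) (s.mem .output) P x W

structure LinkChosen (q p a b : ℕ) (s : Store) : Prop where
  r9 : s.reg 9 = p
  r15 : s.reg 15 = a
  r19 : s.reg 19 = b

structure WalkOut (g : Inst) (par : ℕ → ℕ) (v η t P : ℕ) (W : ℝ) (s : Store) : Prop where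
  zero : s.mem .output 0 = 1
  one : s.mem .output 1 = P
  last : s.mem .output (P + 2) = t
  walk : IsWalk g (g.Alive par v η) (fun j => s.mem .output (j + 2)) P W

namespace Plan

variable {g : Inst} {A : ℕ → ℕ → ℕ} {R : ℕ → ℕ → ℝ} {v η t base h Q : ℕ} {mk nxt lev : ℕ → ℕ}
  {D : ℕ → ℝ}

/-- The two directions of a forest link are reduced to one description with `a` in the current and
`b` in the next class. Non-tree edges never fail. -/
theorem ends (hP : Plan g A R v η t base h Q mk nxt lev D) {q : ℕ} (hq : q ≤ h)
    (hm : mk q = 1) (hQ : q ≠ Q) : ∃ a b e, LinkEnds g A R v η base h D q (nxt q) a b e := by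
  obtain ⟨n1, n2, n3, n4⟩ := hP.linked.next q hq hm hQ
  rcases n4 with ⟨k1, k2, k3⟩ | ⟨k1, k2, k3⟩
  · obtain ⟨-, e, he, htr, hj, hb, ha, hK⟩ := hP.grown.edge q (by omega) (by omega)
    rw [k2, Nat.add_sub_cancel] at ha
    obtain ⟨l1, l2⟩ := hP.valid.joins_lt he hj
    refine ⟨_, _, e, l2, l1, hb, ha, he, fun h => absurd h htr, hj.symm, ?_, fun _ => ⟨rfl, rfl⟩,
      fun hc => absurd k1 hc⟩
    rw [k3, hK, Inst.key_joins hj]; ring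
  · obtain ⟨-, e, he, htr, hj, hb, ha, hK⟩ := hP.grown.edge (nxt q) (by omega) (by omega)
    rw [k2, Nat.add_sub_cancel] at ha
    obtain ⟨l1, l2⟩ := hP.valid.joins_lt he hj
    refine ⟨_, _, e, l1, l2, ha, hb, he, fun h => absurd h htr, hj, ?_, fun hc => by omega,
      fun _ => ⟨rfl, rfl⟩⟩
    rw [k3, hK, Inst.key_joins hj]

/-- The link is itself an edge of the walk and pays for the constant overhead, so the time is
proportional to the number of edges written. The weight grows by `D q - D (nxt q)` up to the
distances of the two tops, which telescope. -/
theorem link_spec (hP : Plan g A R v η t base h Q mk nxt lev D) {q x P a b e : ℕ} {W : ℝ}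
    (hx : x < g.n) (hd : Down (A 1) (A 2) v η x a) (hq : nxt q ≤ h)
    (hL : LinkEnds g A R v η base h D q (nxt q) a b e) {B : ℕ} {s : Store}
    (hB : P + 2 * g.n + 4 ≤ B)
    (hs : EmitAt g A R v η t base h nxt lev q x P W s) :
    Runs B linkBody s ((A 2 a - A 2 x + 1 + (A 2 b - A 2 (A 7 (base + nxt q)))) * 290)
      (EmitAt g A R v η t base h nxt lev (nxt q) (A 7 (base + nxt q))
        (P + (A 2 a - A 2 x + 1 + (A 2 b - A 2 (A 7 (base + nxt q)))))
        (W + D q - D (nxt q) + R 0 (A 7 (base + nxt q)) - R 0 x)) := by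
  obtain ⟨ord, ht⟩ := hP.rooted
  have hη : η ≤ A 2 v := hP.le_h.trans hP.h_le
  obtain ⟨p, hp⟩ : ∃ p, nxt q = p := ⟨_, rfl⟩
  rw [hp] at hL hq ⊢
  obtain ⟨y, hy⟩ : ∃ y, A 7 (base + p) = y := ⟨_, rfl⟩
  have hdb : Down (A 1) (A 2) v η y b := by
    rw [← hy, hP.tops p hq]
    exact down_top ht hP.v_lt hP.h_le hP.le_h hL.b_lt hL.b_cmp
  have hcost := hL.cost
  rw [hy] at hcost ⊢
  have da := ht.dep_anc hL.a_lt hd.anc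
  have db := ht.dep_anc hL.b_lt hdb.anc
  have la := ht.dep_lt hL.a_lt
  have lb := ht.dep_lt hL.b_lt
  have lh := ht.dep_lt hx
  obtain ⟨l1, hl1⟩ : ∃ l1, l1 = A 2 a - A 2 x := ⟨_, rfl⟩
  obtain ⟨l2, hl2⟩ : ∃ l2, l2 = A 2 b - A 2 y := ⟨_, rfl⟩
  rw [← hl1, ← hl2]
  have hA := hs.asks
  refine .seq 30 (l1 * 40 + l2 * 40 + 255) (LinkChosen q p a b) ?_ (by omega) ?_
  · apply Runs.bdd
    intro hb
    have b1 := hb.arr .work 1 q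
    have b9 := fun k => hb.arr .input 9 k
    have b10 := fun k => hb.arr .input 10 k
    rw [hs.nxt, hp] at b1
    rw [hA.inp 9 (by norm_num)] at b9
    rw [hA.inp 10 (by norm_num)] at b10
    refine .straight rfl (by decide) ?_
    simp only [chooseLink, wp_seq, wp_ite, wp_set, holds_lt, eval_ld, eval_reg, eval_add,
      reg_setReg, arr_setReg, hs.nxt, hs.r12, hp, hA.r5, hA.inp 9 (by norm_num),
      hA.inp 10 (by norm_num), if_true, Nat.reduceEqDiff, if_false]
    refine ⟨b1, fun c => ⟨b10 _, b9 _, ?_⟩, fun c => ⟨b9 _, b10 _, ?_⟩⟩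
    · obtain ⟨e1, e2⟩ := hL.back c
      rw [e1, e2]
      constructor <;> simp
    · obtain ⟨e1, e2⟩ := hL.forth c
      rw [e1, e2]
      constructor <;> simp
  rintro s1 fr1 hb1 ⟨c9, c15, c19⟩
  have hA1 := hA.frame fr1
  have hout1 : s1.mem .output = s.mem .output := fr1.mem .output
  refine .seq _ (l2 * 40 + 150) _ (goDown_spec hA1 c15 ((fr1.reg 13).trans hs.r13)
    ((fr1.reg 14).trans hs.r14) da (by omega)) (by omega) ?_
  rintro s2 fr2 - ⟨d13, dout⟩
  have hA2 := hA1.frame fr2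
  have hw2 := hs.walk.down ht hP.v_lt hη hd hL.a_lt
    (out' := s2.mem .output) (by rw [← hout1]; exact dout)
  refine .seq 20 (l2 * 40 + 120) (fun s' => s' = (s2.setReg 15 b).setReg 14 (A 2 y))
    (.straight rfl (by decide) ?_) (by omega) ?_
  · simp only [turn, wp_seq, wp_set, eval_reg, eval_ld, eval_add, reg_setReg, arr_setReg,
      (fr2.reg 19).trans c19, (fr2.reg 9).trans c9, hA2.r5, hA2.inp 2 (by norm_num),
      hA2.inp 7 (by norm_num), hy, Nat.reduceEqDiff, if_false]
    have := hL.b_lt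
    exact ⟨by omega, by omega, trivial⟩
  rintro s3 fr3 - hs3
  have hA3 := hA2.frame fr3
  refine .seq _ 10 _ (goUp_spec (x := y) (b := b) (P := P + l1) hA3 (by rw [hs3]; simp)
    (by rw [hs3, hl1]; simp [d13]) (by rw [hs3]; simp) db (by omega)) (by omega) ?_
  rintro s4 fr4 - ⟨u13, uout⟩
  have hA4 := hA3.frame fr4
  have hw4 := Prefix.link ht hP.v_lt hη hw2 hdb hL.b_lt hL.e_lt hL.alive
    (out' := s4.mem .output) (by
      rw [dout, if_pos (by omega)]
      rw [show P + 2 + (A 2 a - A 2 x) - (P + (A 2 a - A 2 x) + 2) = 0 by omega]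
      exact hL.joins) (by
      intro c
      rw [uout, hs3, ← hl1]
      rfl)
  refine .straight rfl (by decide) ?_
  simp only [wp_set, eval_reg, (fr4.reg 9).trans ((fr3.reg 9).trans ((fr2.reg 9).trans c9))]
  have hpB : p ≤ B := c9 ▸ hb1.reg 9
  refine ⟨hpB, ⟨hA4.inp, hA4.rinp, ?_, ?_, ?_, ?_, ?_⟩, ?_, ?_, by simp, ?_, ?_, ?_⟩
  · simp [hA4.r0]
  · simp [hA4.r1]
  · simp [hA4.r2]
  · simp [hA4.r5]
  · simp [hA4.r6]
  · rw [arr_setReg, fr4.arr .work 1, fr3.arr .work 1, fr2.arr .work 1, fr1.arr .work 1, hs.nxt]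
  · rw [arr_setReg, fr4.arr .work 2, fr3.arr .work 2, fr2.arr .work 2, fr1.arr .work 2, hs.lev]
  · simp [u13, hl2]; omega
  · rw [reg_setReg, if_neg (by norm_num), fr4.reg 14, hs3]; simp
  · rw [mem_setReg]
    convert hw4 using 1
    · omega
    · rw [hcost]; ring

/-- Induction on the level. The hypothesis on descents from `x` covers both the first piece, where
`x` is the root, and later pieces, where `x` is the top of the class. The final length `P'` is fixed
before the store, so that the integer bound can refer to it; each link adds at most `2n` edges. -/
theorem links_spec (hP : Plan g A R v η t base h Q mk nxt lev D) : ∀ l q x P W, lev q = l →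
    mk q = 1 → q ≤ h → x < g.n →
    (∀ a < g.n, cmp (A 1) v h a = A 6 (base + q) → Down (A 1) (A 2) v η x a) →
    ∃ P' x', P ≤ P' ∧ P' ≤ P + l * (2 * g.n) ∧ x' < g.n ∧ Down (A 1) (A 2) v η x' t ∧
      ∀ B s, P' + 2 * g.n + 4 ≤ B → EmitAt g A R v η t base h nxt lev q x P W s →
        Runs B links s ((P' - P) * 300 + 10)
          (EmitAt g A R v η t base h nxt lev Q x' P' (W + D q + R 0 x' - R 0 x)) := by
  have hdeg : (Test.lt 0 (ld .work 2 (rg 12))).deg ≤ 8 := by decide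
  have hcost : (Test.lt 0 (ld .work 2 (rg 12))).cost ≤ 10 := by decide
  intro l
  induction l with
  | zero =>
    intro q x P W hl hm hq hx hd
    have hqQ : q = Q := by
      by_contra hne
      have := (hP.linked.next q hq hm hne).2.2.1
      omega
    subst hqQ
    refine ⟨P, x, le_rfl, by omega, hx, hd t hP.t_lt hP.class_eq.symm, fun B s hB hs => ?_⟩
    refine .loop_false hdeg ?_ (hcost.trans (by omega)) ?_
    · simp only [holds_lt, eval_ld, eval_reg, eval_ofNat, hs.r12, hs.lev]; omega
    · rw [hP.linked.cost, show W + 0 + R 0 x - R 0 x = W by ring]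
      exact hs
  | succ l ih =>
    intro q x P W hl hm hq hx hd
    have hqQ : q ≠ Q := by
      rintro rfl
      have := hP.linked.lev
      omega
    obtain ⟨n1, n2, n3, -⟩ := hP.linked.next q hq hm hqQ
    obtain ⟨a, b, e, hL⟩ := hP.ends hq hm hqQ
    obtain ⟨ord, ht⟩ := hP.rooted
    have hX := hP.tops (nxt q) n1
    obtain ⟨k, hk⟩ : ∃ k, k = A 2 a - A 2 x + 1 + (A 2 b - A 2 (A 7 (base + nxt q))) := ⟨_, rfl⟩
    have la := ht.dep_lt hL.a_lt
    have lb := ht.dep_lt hL.b_lt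
    have hk1 : 1 ≤ k ∧ k ≤ 2 * g.n := by omega
    have hxn : A 7 (base + nxt q) < g.n := by rw [hX]; exact ht.top_lt hP.valid hP.v_lt _ _
    obtain ⟨P', x', i1, i2, i3, i4, i5⟩ := ih (nxt q) (A 7 (base + nxt q)) (P + k)
      (W + D q - D (nxt q) + R 0 (A 7 (base + nxt q)) - R 0 x) (by omega) n2 n1 hxn
      (fun a ha hc => by
        rw [hX]
        exact down_top ht hP.v_lt hP.h_le hP.le_h ha hc)
    refine ⟨P', x', by omega, ?_, i3, i4, fun B s hB hs => ?_⟩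
    · rw [Nat.succ_mul]; omega
    have hrun := hP.link_spec hx (hd a hL.a_lt hL.a_cmp) n1 hL (by omega : P + 2 * g.n + 4 ≤ B) hs
    rw [← hk] at hrun
    refine .loop_true hdeg ?_ (k * 290) ((P' - (P + k)) * 300 + 10) _ hrun (by omega) ?_
    · simp only [holds_lt, eval_ld, eval_reg, eval_ofNat, hs.r12, hs.lev]; omega
    · intro s1 _ _ hs1
      refine (i5 B s1 hB hs1).mono le_rfl fun s2 _ _ hs2 => ?_
      convert hs2 using 1
      ring

/-- The start is legitimate because a class of number at least `η` is reached from the root inside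
the tree. Levels are at most `2h`, which gives the bound required of `B`. -/
theorem emit_spec (hP : Plan g A R v η t base h Q mk nxt lev D) {q : ℕ} (hq : q ≤ h)
    (hm : mk q = 1) (hη : η ≤ A 6 (base + q)) : ∃ P, ∀ B s, 2 * h * (2 * g.n) + 3 * g.n + 9 ≤ B →
      Asks A R v η t base h s → s.arr .work 1 = nxt → s.arr .work 2 = lev → s.reg 12 = q →
      Runs B emit s (P * 300 + 200) (WalkOut g (A 1) v η t P (D q + R 0 t)) := by
  obtain ⟨ord, ht⟩ := hP.rooted
  obtain ⟨P, x, i1, i2, i3, i4, i5⟩ := hP.links_spec (lev q) q g.r 0 0 rfl hm hq hP.valid.r_lt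
    (fun a ha hc => down_root ht hP.le_h ha (hc ▸ hη))
  have hlt := ht.dep_lt hP.t_lt
  have hdt := ht.dep_anc hP.t_lt i4.anc
  refine ⟨P + (A 2 t - A 2 x), fun B s hB hA hn hl h12 => ?_⟩
  have hlev := hP.linked.lev_le q hq hm
  have hPB : P ≤ 2 * h * (2 * g.n) := by
    refine i2.trans ?_
    rw [zero_add]
    exact Nat.mul_le_mul_right _ (by omega)
  obtain ⟨len, hlen⟩ : ∃ len, len = A 2 t - A 2 x := ⟨_, rfl⟩
  rw [← hlen]
  refine .seq 10 ((P + len) * 300 + 190) (fun s' => s' = (s.setReg 13 0).setReg 14 0)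
    (.straight rfl (by decide) ?_) (by omega) ?_
  · simp
  rintro s1 fr1 - hs1
  have hA1 := hA.frame fr1
  have hE1 : EmitAt g A R v η t base h nxt lev q g.r 0 0 s1 := by
    refine ⟨hA1, (fr1.arr .work 1).trans hn, (fr1.arr .work 2).trans hl, (fr1.reg 12).trans h12,
      by rw [hs1]; simp, by rw [hs1, ht.dep_root]; simp, fun σ _ hσ => .zero hσ⟩
  refine .seq _ (len * 300 + 180) _ (i5 B s1 (by omega) hE1) (by omega) ?_
  intro s2 fr2 _ hE2
  refine .seq 5 (len * 300 + 170) (fun s' => s' = s2.setReg 15 t) (.straight rfl (by decide) ?_)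
    (by omega) ?_
  · simp only [wp_set, eval_reg, hE2.asks.r2]
    have := hP.t_lt
    exact ⟨by omega, trivial⟩
  rintro s3 fr3 - hs3
  have hA3 := hE2.asks.frame fr3
  refine .seq _ 30 _ (goDown_spec (x := x) (a := t) (P := P) hA3 (by rw [hs3]; simp)
    ((fr3.reg 13).trans hE2.r13) ((fr3.reg 14).trans hE2.r14) hdt (by omega)) (by omega) ?_
  rintro s4 fr4 - ⟨d13, dout⟩
  have hw4 := hE2.walk.down ht hP.v_lt (hP.le_h.trans hP.h_le) i4 hP.t_lt
    (out' := s4.mem .output) (by rw [← fr3.mem .output]; exact dout)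
  refine .straight rfl (by decide) ?_
  simp only [wp_seq, wp_store, eval_reg, eval_ofNat, d13, ← hlen]
  refine ⟨by omega, by omega, ?_, ?_, ?_, ?_⟩
  · simp
  · simp
  · simp only [mem_write_same]
    rw [if_neg (by omega), if_neg (by omega), dout, if_pos (by omega)]
    rw [show P + 2 + (A 2 t - A 2 x) - (P + len + 2) = 0 by omega]
    rfl
  · rw [hlen]
    have e : (0 : ℝ) + D q + R 0 x - R 0 g.r + (R 0 t - R 0 x) = D q + R 0 t := by
      rw [ht.dist_root]; ring
    rw [e] at hw4
    refine hw4.congr fun j _ => ?_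
    simp

end Plan

/-! ### The queries -/

/-- The queries report correctly that there is no walk. -/
structure AnswersNo (W f : ℕ) (s : Store) : Prop where
  dist : ∃ s' τ, Exec W distQuery s τ s' ∧ τ ≤ 2000 * (f + 1) ∧ s'.mem .output 0 = 0
  path : ∃ s' τ, Exec W pathQuery s τ s' ∧ τ ≤ 2000 * (f + 1) ∧ s'.mem .output 0 = 0

/-- The queries report the number `d` and a walk of that weight. -/
structure Answers (g : Inst) (par : ℕ → ℕ) (v η t W : ℕ) (s : Store) (d : ℝ) : Prop where
  dist : ∃ s' τ, Exec W distQuery s τ s' ∧ τ ≤ 2000 * (g.f + 1) ∧ s'.mem .output 0 = 1 ∧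
    s'.rmem .output 0 = d
  path : ∃ P s' τ, Exec W pathQuery s τ s' ∧ τ ≤ P * 300 + 2000 * (g.f + 1) ∧
    WalkOut g par v η t P d s'

/-- If no marked class has number at least `η`, `IsWalk.cheap` excludes every surviving walk to `t`.
Otherwise the picked cost is at most that of the cheap class supplied by any such walk, and `dist t
≤ L` completes the factor `2η + 1`. -/
theorem query_spec {g : Inst} (hg : g.Valid) {A : ℕ → ℕ → ℕ} {R : ℕ → ℕ → ℝ}
    (hO : IsOracle g A R) (hd : Shortest g (A 1) (R 0)) {v η t B W : ℕ} {s : Store}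
    (hv : v < g.n) (htn : t < g.n) (hη : η ≤ g.f) (hηv : η ≤ A 2 v)
    (hB : 2 * g.f + 2 ≤ B) (hBn : g.n * (g.f + 1) ≤ B)
    (hBf : 2 * g.f * (2 * g.n) + 3 * g.n + 9 ≤ B) (hW : (B + 100) ^ 8 ≤ W) (hb : Bdd B s)
    (hinp : ∀ k < 16, s.arr .input k = A k) (hrinp : ∀ k < 16, s.rarr .input k = R k)
    (h0 : s.reg 0 = v) (h1 : s.reg 1 = η) (h2 : s.reg 2 = t)
    (hw : ∀ k q, s.arr .work k q = 0) (hrw : ∀ q, s.rarr .work 0 q = 0)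
    (hout : ∀ k q, s.arr .output k q = 0) :
    ((∀ σ P L, IsWalk g (g.Alive (A 1) v η) σ P L → σ P ≠ t) ∧ AnswersNo W g.f s) ∨
    ∃ d, (∀ σ P L, IsWalk g (g.Alive (A 1) v η) σ P L → σ P = t → d ≤ (2 * η + 1) * L) ∧
      Answers g (A 1) v η t W s d := by
  obtain ⟨τ, s1, hex, hτ, hb1, Q, hL⟩ := locate_spec hg hO hv htn hB hBn hinp hrinp h0 h1 h2 hw
    hrw hout W hW hb
  obtain ⟨base, hbase⟩ : ∃ base, base = v * (g.f + 1) := ⟨_, rfl⟩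
  obtain ⟨h, hh⟩ : ∃ h, h = A 5 v := ⟨_, rfl⟩
  have hhv := hO.height v hv
  have hG := hO.grown v hv
  have hX := hO.tops v hv
  rw [← hh] at hhv hG hX hL
  rw [← hbase] at hG hX hL
  have hhf : h ≤ g.f := by omega
  have hplan : Plan g A R v η t base h Q (s1.arr .work 0) (s1.arr .work 1) (s1.arr .work 2)
      (s1.rarr .work 0) :=
    ⟨hg, hO.rooted, hv, htn, by omega, by omega, hG, hX, hL.rerooted.toLinked, hL.class_eq⟩
  obtain ⟨ord, ht⟩ := hO.rooted
  have hx : ∀ q ≤ h, 0 ≤ R 0 (A 7 (base + q)) := fun q hq => by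
    rw [hX q hq]
    exact ht.dist_nonneg hg (ht.top_lt hg hv _ _)
  have hcheap : ∀ σ P L, IsWalk g (g.Alive (A 1) v η) σ P L → σ P = t →
      ∃ c ≤ h, s1.arr .work 0 c = 1 ∧ η ≤ A 6 (base + c) ∧
        s1.rarr .work 0 c ≤ η * (2 * L) := fun σ P L hw hσ =>
    hw.cheap hg ht hd hv hplan.h_le hplan.le_h hG hL.rerooted hx
      (by rw [hσ]; exact hL.class_eq)
  have hA := hL.asks
  have hdeg : (Test.lt (rg 12) (rg 6)).deg ≤ 8 := by decide
  have hcost : (Test.lt (rg 12) (rg 6)).cost ≤ 10 := by decide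
  obtain ⟨τ₁, s2, hex2, hτ2, -, r1, r2⟩ := report_spec hL (by omega) W hW hb1
  have hdist : ∀ {P : Store → Prop}, P s2 →
      ∃ s' τ, Exec W distQuery s τ s' ∧ τ ≤ 2000 * (g.f + 1) ∧ P s' := fun hP =>
    ⟨s2, _, .seq _ _ _ _ _ _ _ hex hex2, by omega, hP⟩
  rcases hL.picked with ⟨hz, hno⟩ | ⟨hz, ⟨hm, hN⟩, hmin⟩
  · refine .inl ⟨fun σ P L hw hσ => ?_, hdist (P := fun s' => s'.mem .output 0 = 0) (r1 hz), ?_⟩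
    · obtain ⟨c, c1, c2, c3, -⟩ := hcheap σ P L hw hσ
      exact hno c (by omega) ⟨c2, c3⟩
    · obtain ⟨τ₂, s3, k1, k2, -, k3⟩ := Runs.ite_false (B := B) (c := emit) (d := .skip) (s := s1)
        (Q := fun s' => s'.mem .output 0 = 0) hdeg
        (by simp only [holds_lt, eval_reg, hA.r6]; omega) 5
        (.straight rfl (by decide) hL.out) le_rfl W hW hb1
      exact ⟨s3, _, .seq _ _ _ _ _ _ _ hex k1, by omega, k3⟩
  · obtain ⟨c, hc⟩ : ∃ c, s1.reg 12 = c := ⟨_, rfl⟩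
    rw [hc] at hz hm hN hmin r2
    refine .inr ⟨s1.rarr .work 0 c + R 0 t, fun σ P L hw hσ => ?_,
      hdist (P := fun s' => s'.mem .output 0 = 1 ∧ s'.rmem .output 0 = _) (r2 (by omega)), ?_⟩
    · obtain ⟨c', c1, c2, c3, c4⟩ := hcheap σ P L hw hσ
      have h3 := hmin c' (by omega) ⟨c2, c3⟩
      have h4 := (hw.le hg ht hd).2
      rw [hσ] at h4
      linarith
    · obtain ⟨P, hP⟩ := hplan.emit_spec (by omega) hm hN
      have hBh : 2 * h * (2 * g.n) + 3 * g.n + 9 ≤ B := by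
        have : 2 * h * (2 * g.n) ≤ 2 * g.f * (2 * g.n) := Nat.mul_le_mul_right _ (by omega)
        omega
      obtain ⟨τ₂, s3, k1, k2, -, k3⟩ := Runs.ite_true (d := .skip) hdeg
        (by simp only [holds_lt, eval_reg, hA.r6]; omega) _
        (hP B s1 hBh hA rfl rfl hc) le_rfl W hW hb1
      exact ⟨P, s3, _, .seq _ _ _ _ _ _ _ hex k1, by omega, k3⟩

/-! ### Weighted graphs as instances -/

section

variable {n m : ℕ} {G T : SimpleGraph (Fin n)} {w : Sym2 (Fin n) → ℝ≥0} {r : Fin n}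
  {ends : Fin m → Fin n × Fin n} {f : ℕ}

/-- The instance given by the input of the preprocessing. -/
noncomputable def toInst (w : Sym2 (Fin n) → ℝ≥0) (r : Fin n) (T : SimpleGraph (Fin n))
    (ends : Fin m → Fin n × Fin n) (f : ℕ) : Inst where
  n := n
  m := m
  r := r
  f := f
  eu i := if i < m then graphInput T ends (3 * i) else 0
  ev i := if i < m then graphInput T ends (3 * i + 1) else 0
  tr i := if i < m then graphInput T ends (3 * i + 2) else 0
  wt i := if i < m then weightInput w ends i else 0

theorem toInst_eu (e : Fin m) : (toInst w r T ends f).eu e = (ends e).1 := by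
  have h1 : 3 * (e : ℕ) / 3 = e := by omega
  have h2 : 3 * (e : ℕ) % 3 = 0 := by omega
  simp [toInst, graphInput]

theorem toInst_ev (e : Fin m) : (toInst w r T ends f).ev e = (ends e).2 := by
  have h1 : (3 * (e : ℕ) + 1) / 3 = e := by omega
  have h2 : (3 * (e : ℕ) + 1) % 3 = 1 := by omega
  simp [toInst, graphInput, h1]

open Classical in
theorem toInst_tr (e : Fin m) :
    (toInst w r T ends f).tr e = if edgeAt ends e ∈ T.edgeSet then 1 else 0 := by
  have h1 : (3 * (e : ℕ) + 2) / 3 = e := by omega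
  have h2 : (3 * (e : ℕ) + 2) % 3 = 2 := by omega
  simp [toInst, graphInput, h1]

theorem toInst_tr_eq (e : Fin m) :
    (toInst w r T ends f).tr e = 1 ↔ edgeAt ends e ∈ T.edgeSet := by
  rw [toInst_tr]
  split_ifs with h <;> simp [h]

theorem toInst_wt (e : Fin m) : (toInst w r T ends f).wt e = w (edgeAt ends e) := by
  simp [toInst, weightInput]

theorem toInst_joins (e : Fin m) (x y : Fin n) :
    (toInst w r T ends f).Joins e x y ↔ edgeAt ends e = s(x, y) := by
  unfold Inst.Joins edgeAt
  rw [toInst_eu, toInst_ev, Sym2.eq_iff]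
  simp only [Fin.val_inj]

theorem exists_edge (hE : IsEdgeListing G ends) {x y : Fin n} (h : G.Adj x y) :
    ∃ e : Fin m, edgeAt ends e = s(x, y) := by
  have : s(x, y) ∈ Set.range (edgeAt ends) := by rw [hE.2]; exact h
  exact this

theorem edge_mem (hE : IsEdgeListing G ends) (e : Fin m) : edgeAt ends e ∈ G.edgeSet := by
  rw [← hE.2]; exact ⟨e, rfl⟩

theorem card_le (hE : IsEdgeListing G ends) (hT : IsSPT G w r T) : n ≤ m + 1 := by
  classical
  have h1 := hT.2.1.card_edgeFinset
  have h2 : T.edgeFinset ⊆ Finset.univ.image (edgeAt ends) := by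
    intro e he
    have : e ∈ Set.range (edgeAt ends) := by
      rw [hE.2]
      exact SimpleGraph.edgeSet_mono hT.1 (by simpa using he)
    simpa using this
  have h3 := (Finset.card_le_card h2).trans Finset.card_image_le
  simp only [Finset.card_univ, Fintype.card_fin] at h1 h3
  omega

theorem edges_le (hE : IsEdgeListing G ends) : m ≤ n * n := by
  have : Function.Injective ends := fun i j hij => hE.1 (by simp [edgeAt, hij])
  simpa using Fintype.card_le_of_injective _ this

theorem toInst_valid (hE : IsEdgeListing G ends) (hT : IsSPT G w r T) (hf : 1 ≤ f) :
    (toInst w r T ends f).Valid where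
  r_lt := r.2
  f_pos := hf
  eu_lt e he := by
    have := toInst_eu (w := w) (r := r) (T := T) (ends := ends) (f := f) ⟨e, he⟩
    rw [show (toInst w r T ends f).eu e = _ from this]
    exact Fin.is_lt _
  ev_lt e he := by
    have := toInst_ev (w := w) (r := r) (T := T) (ends := ends) (f := f) ⟨e, he⟩
    rw [show (toInst w r T ends f).ev e = _ from this]
    exact Fin.is_lt _
  ne e he := by
    have h1 := toInst_eu (w := w) (r := r) (T := T) (ends := ends) (f := f) ⟨e, he⟩
    have h2 := toInst_ev (w := w) (r := r) (T := T) (ends := ends) (f := f) ⟨e, he⟩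
    rw [show (toInst w r T ends f).eu e = _ from h1, show (toInst w r T ends f).ev e = _ from h2]
    have h3 : G.Adj (ends ⟨e, he⟩).1 (ends ⟨e, he⟩).2 := edge_mem hE ⟨e, he⟩
    exact fun hc => h3.ne (Fin.ext hc)
  wt_nonneg e := by
    by_cases he : e < m
    · rw [show (toInst w r T ends f).wt e = _ from toInst_wt (⟨e, he⟩ : Fin m)]
      exact NNReal.coe_nonneg _
    · simp [toInst, he]
  n_le := card_le hE hT
  conn S h0 hS u hu := by
    obtain ⟨p⟩ := hT.2.1.connected r ⟨u, hu⟩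
    suffices ∀ {x y : Fin n} (p : T.Walk x y), S x → S y from this p h0
    intro x y p
    induction p with
    | nil => exact id
    | @cons x z y hxz p ih =>
      intro hx
      refine ih ?_
      obtain ⟨e, he⟩ := exists_edge hE (hT.1 hxz)
      have h1 := hS e e.2 ((toInst_tr_eq e).2 (by rw [he]; exact hxz))
      rcases (toInst_joins (w := w) (r := r) (T := T) (f := f) e x z).2 he with ⟨a, b⟩ | ⟨a, b⟩
      · rw [a, b] at h1; exact h1.1 hx
      · rw [a, b] at h1; exact h1.2 hx

end

/-! ### Tree edges, distances, failures and walks in terms of the arrays -/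

section

variable {n m : ℕ} {G T : SimpleGraph (Fin n)} {w : Sym2 (Fin n) → ℝ≥0} {r : Fin n}
  {ends : Fin m → Fin n × Fin n} {f : ℕ} {ord par dep : ℕ → ℕ} {dist : ℕ → ℝ}

/-- The parent edges alone connect everything to the root. A tree edge that is not a parent edge
could therefore be deleted without disconnecting the tree, but every edge of an acyclic graph is a
bridge. -/
theorem tree_edge (hT : IsSPT G w r T)
    (ht : Rooted (toInst w r T ends f) ord par dep dist) {x y : Fin n} (h : T.Adj x y) :
    (x ≠ r ∧ par x = y) ∨ (y ≠ r ∧ par y = x) := by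
  by_contra hno
  have hbr := SimpleGraph.isAcyclic_iff_forall_adj_isBridge.1 hT.2.1.isAcyclic h
  rw [SimpleGraph.isBridge_iff] at hbr
  have key : ∀ u (hu : u < n), (T.deleteEdges {s(x, y)}).Reachable r ⟨u, hu⟩ := by
    intro u hu
    refine ht.induct (P := fun u => ∀ hu : u < n, (T.deleteEdges {s(x, y)}).Reachable r ⟨u, hu⟩)
      (fun _ => .refl _) (fun u hu hur ih hu' => ?_) (u := u) hu hu
    obtain ⟨hp, -, e, he, htr, hj, -⟩ := ht.spec hu hur
    replace hp : par u < n := hp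
    refine (ih hp).trans (SimpleGraph.Adj.reachable ?_)
    have hj' := (toInst_joins (⟨e, he⟩ : Fin m) ⟨par u, hp⟩ ⟨u, hu'⟩).1 hj
    have htr' := (toInst_tr_eq (⟨e, he⟩ : Fin m)).1 htr
    rw [hj'] at htr'
    rw [SimpleGraph.deleteEdges_adj]
    refine ⟨htr', fun hc => hno ?_⟩
    rcases Sym2.eq_iff.1 (Set.mem_singleton_iff.1 hc) with ⟨rfl, rfl⟩ | ⟨rfl, rfl⟩
    · exact .inr ⟨fun hc => hur (congrArg Fin.val hc), rfl⟩
    · exact .inl ⟨fun hc => hur (congrArg Fin.val hc), rfl⟩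
  exact hbr ((key x x.2).symm.trans (key y y.2))

theorem tree_dist (hT : IsSPT G w r T)
    (ht : Rooted (toInst w r T ends f) ord par dep dist) {x y : Fin n} (h : T.Adj x y) :
    dist y ≤ dist x + w s(x, y) := by
  have main : ∀ u : Fin n, u ≠ r → ∀ z : Fin n, par u = z → dist u = dist z + w s(z, u) := by
    intro u hur z hz
    obtain ⟨hp, -, e, he, htr, hj, hd⟩ := ht.spec u.2 (fun hc => hur (Fin.ext hc))
    rw [hz] at hj hd
    have hj' := (toInst_joins (⟨e, he⟩ : Fin m) z u).1 hj
    rw [hd, ← hj', show (toInst w r T ends f).wt e = _ from toInst_wt (⟨e, he⟩ : Fin m)]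
  rcases tree_edge hT ht h with ⟨h1, h2⟩ | ⟨h1, h2⟩
  · have := main x h1 y h2
    have h0 := NNReal.coe_nonneg (w s(x, y))
    rw [Sym2.eq_swap] at this
    linarith
  · exact (main y h1 x h2).le

/-- One inequality comes from the walk along parents. For the other, `dist` changes by at most the
weight along each tree edge, so no tree walk from the root is shorter. -/
theorem dist_eq (hT : IsSPT G w r T)
    (ht : Rooted (toInst w r T ends f) ord par dep dist) (u : Fin n) :
    wdist G w r u = ENNReal.ofReal (dist u) := by
  rw [← hT.2.2]
  apply le_antisymm
  · have : ∀ u (hu : u < n), ∃ p : T.Walk r ⟨u, hu⟩, (walkWeight w p : ℝ) = dist u := by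
      intro u hu
      refine ht.induct (P := fun u => ∀ hu : u < n,
        ∃ p : T.Walk r ⟨u, hu⟩, (walkWeight w p : ℝ) = dist u)
        (fun _ => ⟨.nil, by simp [walkWeight]; exact ht.dist_root.symm⟩)
        (fun u hu hur ih hu' => ?_) (u := u) hu hu
      obtain ⟨hp, -, e, he, htr, hj, hd⟩ := ht.spec hu hur
      replace hp : par u < n := hp
      obtain ⟨p, hpw⟩ := ih hp
      have hj' := (toInst_joins (⟨e, he⟩ : Fin m) ⟨par u, hp⟩ ⟨u, hu'⟩).1 hj
      have htr' := (toInst_tr_eq (⟨e, he⟩ : Fin m)).1 htr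
      rw [hj'] at htr'
      have hadj : T.Adj ⟨par u, hp⟩ ⟨u, hu'⟩ := htr'
      refine ⟨p.concat hadj, ?_⟩
      rw [hd, ← hpw, show (toInst w r T ends f).wt e = _ from toInst_wt (⟨e, he⟩ : Fin m), hj']
      simp [walkWeight, SimpleGraph.Walk.edges_concat]
    obtain ⟨p, hp⟩ := this u u.2
    refine (iInf_le _ p).trans ?_
    rw [← hp, ENNReal.ofReal_coe_nnreal]
  · refine le_iInf fun p => ?_
    suffices ∀ {x y : Fin n} (p : T.Walk x y), dist y ≤ dist x + walkWeight w p by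
      have h1 := this p
      rw [show dist r = 0 from ht.dist_root, zero_add] at h1
      rw [← ENNReal.ofReal_coe_nnreal]
      exact ENNReal.ofReal_le_ofReal h1
    intro x y p
    induction p with
    | nil => simp [walkWeight]
    | cons h p ih =>
      have := tree_dist hT ht h
      simp only [walkWeight, SimpleGraph.Walk.edges_cons, List.map_cons, List.sum_cons,
        NNReal.coe_add] at ih ⊢
      linarith

/-- This is where the shortest-path property enters: `dist` is the distance in `G`, which satisfies
the triangle inequality along edges outside the tree as well. -/
theorem graph_dist (hE : IsEdgeListing G ends) (hT : IsSPT G w r T) (hf : 1 ≤ f)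
    (ht : Rooted (toInst w r T ends f) ord par dep dist) {x y : Fin n} (h : G.Adj x y) :
    dist y ≤ dist x + w s(x, y) := by
  have h0 : 0 ≤ dist x := ht.dist_nonneg (toInst_valid hE hT hf) x.2
  have h1 : wdist G w r y ≤ wdist G w r x + w s(x, y) := by
    unfold wdist
    rw [ENNReal.iInf_add]
    refine le_iInf fun p => (iInf_le _ (p.concat h)).trans (le_of_eq ?_)
    simp [walkWeight, SimpleGraph.Walk.edges_concat]
  rw [dist_eq hT ht, dist_eq hT ht, ← ENNReal.ofReal_coe_nnreal,
    ← ENNReal.ofReal_add h0 (NNReal.coe_nonneg _)] at h1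
  exact (ENNReal.ofReal_le_ofReal_iff (by positivity)).1 h1

theorem toInst_shortest (hE : IsEdgeListing G ends) (hT : IsSPT G w r T) (hf : 1 ≤ f)
    (ht : Rooted (toInst w r T ends f) ord par dep dist) :
    Shortest (toInst w r T ends f) par dist where
  left e he := by
    have h : G.Adj (ends ⟨e, he⟩).1 (ends ⟨e, he⟩).2 := edge_mem hE ⟨e, he⟩
    have := graph_dist hE hT hf ht h.symm
    rw [show (toInst w r T ends f).eu e = _ from toInst_eu (⟨e, he⟩ : Fin m),
      show (toInst w r T ends f).ev e = _ from toInst_ev (⟨e, he⟩ : Fin m),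
      show (toInst w r T ends f).wt e = _ from toInst_wt (⟨e, he⟩ : Fin m), edgeAt, Sym2.eq_swap]
    exact this
  right e he := by
    have h : G.Adj (ends ⟨e, he⟩).1 (ends ⟨e, he⟩).2 := edge_mem hE ⟨e, he⟩
    have := graph_dist hE hT hf ht h
    rw [show (toInst w r T ends f).eu e = _ from toInst_eu (⟨e, he⟩ : Fin m),
      show (toInst w r T ends f).ev e = _ from toInst_ev (⟨e, he⟩ : Fin m),
      show (toInst w r T ends f).wt e = _ from toInst_wt (⟨e, he⟩ : Fin m), edgeAt]
    exact this
  tree e he htr := by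
    have h : T.Adj (ends ⟨e, he⟩).1 (ends ⟨e, he⟩).2 := (toInst_tr_eq (⟨e, he⟩ : Fin m)).1 htr
    rcases tree_edge hT ht h with ⟨h1, h2⟩ | ⟨h1, h2⟩
    · refine ⟨_, Fin.is_lt _, fun hc => h1 (Fin.ext hc), ?_⟩
      rw [h2]
      exact (toInst_joins (⟨e, he⟩ : Fin m) _ _).2 Sym2.eq_swap
    · refine ⟨_, Fin.is_lt _, fun hc => h1 (Fin.ext hc), ?_⟩
      rw [h2]
      exact (toInst_joins (⟨e, he⟩ : Fin m) _ _).2 rfl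

/-- A path of the tree that ends in the root goes through the ancestors. -/
theorem path_to_root (hT : IsSPT G w r T)
    (ht : Rooted (toInst w r T ends f) ord par dep dist) {u z : Fin n} (p : T.Walk u z)
    (hp : p.IsPath) (hz : z = r) :
    p.length = dep u ∧ ∀ i ≤ p.length, (p.getVert i : ℕ) = par^[i] u := by
  induction p with
  | nil =>
    subst hz
    refine ⟨ht.dep_root.symm, fun i hi => ?_⟩
    have : i = 0 := by simpa using hi
    subst this; rfl
  | @cons u y z huy p ih =>
    rw [SimpleGraph.Walk.cons_isPath_iff] at hp
    obtain ⟨i1, i2⟩ := ih hp.1 hz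
    have hpar : u ≠ r ∧ par u = y := by
      rcases tree_edge hT ht huy with h | ⟨h1, h2⟩
      · exact h
      · exfalso
        apply hp.2
        have hlen : 1 ≤ p.length := by
          have : 0 < dep y := Nat.pos_of_ne_zero fun hc =>
            h1 (Fin.ext (ht.dep_eq_zero y.2 hc))
          omega
        have := i2 1 hlen
        rw [show par^[1] (y : ℕ) = par y from rfl, h2] at this
        rw [← Fin.ext this]
        exact p.getVert_mem_support 1
    have hdep := (ht.spec u.2 (fun hc => hpar.1 (Fin.ext hc))).2.1
    rw [hpar.2] at hdep
    refine ⟨by rw [SimpleGraph.Walk.length_cons, i1, hdep], fun i hi => ?_⟩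
    cases i with
    | zero => rfl
    | succ i =>
      rw [SimpleGraph.Walk.getVert_cons_succ, i2 i (by simpa using hi),
        Function.iterate_succ_apply, hpar.2]

/-- Reversing the path from the root to `v` turns it into the sequence of ancestors of `v`; the
failed final part becomes its first `F.card` parent edges. -/
theorem failure_spec (hT : IsSPT G w r T)
    (ht : Rooted (toInst w r T ends f) ord par dep dist) {v : Fin n} {F : Finset (Sym2 (Fin n))}
    (hF : IsPathFailure T r v F) : F.card ≤ dep v ∧ ∀ x y : Fin n, s(x, y) ∈ F ↔
      ∃ i < F.card, (par (par^[i] v) = x ∧ par^[i] v = y) ∨ (par (par^[i] v) = y ∧ par^[i] v = x) := by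
  classical
  obtain ⟨x, p, q, hpq, hF⟩ := hF
  have hq : q.IsPath := hpq.of_append_right
  have hcard : F.card = q.length := by
    have : F = q.edges.toFinset := by ext e; simp [hF]
    rw [this, List.toFinset_card_of_nodup hq.isTrail.edges_nodup, SimpleGraph.Walk.length_edges]
  obtain ⟨h1, h2⟩ := path_to_root hT ht (p.append q).reverse hpq.reverse rfl
  rw [SimpleGraph.Walk.reverse_append] at h1 h2
  have h3 : ∀ i ≤ q.length, (q.reverse.getVert i : ℕ) = par^[i] v := by
    intro i hi
    rw [← h2 i (by simp; omega), SimpleGraph.Walk.getVert_append', if_pos (by simpa using hi)]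
  refine ⟨by rw [hcard, ← h1]; simp, fun a b => ?_⟩
  have h4 : s(a, b) ∈ F ↔ s(a, b) ∈ q.reverse.edges := by
    rw [hF, SimpleGraph.Walk.edges_reverse, List.mem_reverse]
  rw [h4, SimpleGraph.Walk.mk_mem_edges_iff_exists, hcard, SimpleGraph.Walk.length_reverse]
  refine exists_congr fun i => and_congr_right fun hi => ?_
  rw [Sym2.eq_iff, ← Function.iterate_succ_apply' par, ← h3 i hi.le, ← h3 (i + 1) hi,
    Fin.val_inj, Fin.val_inj, Fin.val_inj, Fin.val_inj]
  tauto

theorem alive_iff (hT : IsSPT G w r T)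
    (ht : Rooted (toInst w r T ends f) ord par dep dist) {v : Fin n} {F : Finset (Sym2 (Fin n))}
    (hF : IsPathFailure T r v F) (e : Fin m) :
    (toInst w r T ends f).Alive par v F.card e ↔ edgeAt ends e ∉ F := by
  obtain ⟨-, h2⟩ := failure_spec hT ht hF
  have hFT : ∀ e ∈ F, e ∈ T.edgeSet := by
    obtain ⟨x, p, q, -, h⟩ := hF
    exact fun e he => q.edges_subset_edgeSet ((h e).1 he)
  have key : edgeAt ends e ∈ F ↔ ∃ i < F.card,
      (toInst w r T ends f).Joins e (par (par^[i] v)) (par^[i] v) := by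
    unfold edgeAt
    rw [h2]
    refine exists_congr fun i => and_congr_right fun hi => ?_
    unfold Inst.Joins
    rw [toInst_eu, toInst_ev]
    constructor
    · rintro (⟨a, b⟩ | ⟨a, b⟩)
      exacts [.inl ⟨a.symm, b.symm⟩, .inr ⟨b.symm, a.symm⟩]
    · rintro (⟨a, b⟩ | ⟨a, b⟩)
      exacts [.inl ⟨a.symm, b.symm⟩, .inr ⟨b.symm, a.symm⟩]
  unfold Inst.Alive
  rw [toInst_tr_eq, key]
  constructor
  · rintro h ⟨i, hi, hj⟩
    exact h (hFT _ (key.2 ⟨i, hi, hj⟩)) i hi hj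
  · intro h _ i hi hj
    exact h ⟨i, hi, hj⟩

theorem IsWalk.to_walk (hE : IsEdgeListing G ends) (hT : IsSPT G w r T)
    (ht : Rooted (toInst w r T ends f) ord par dep dist) {v : Fin n} {F : Finset (Sym2 (Fin n))}
    (hF : IsPathFailure T r v F) {σ : ℕ → ℕ} {P : ℕ} {L : ℝ}
    (hw : IsWalk (toInst w r T ends f) ((toInst w r T ends f).Alive par v F.card) σ P L) :
    ∀ y : Fin n, σ P = y → ∃ p : (removeEdges G F).Walk r y, p.length = P ∧
      (walkWeight w p : ℝ) = L ∧ ∀ i ≤ P, (p.getVert i : ℕ) = σ i := by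
  induction hw with
  | zero h =>
    intro y hy
    obtain rfl : r = y := Fin.ext (h.symm.trans hy)
    refine ⟨.nil, rfl, by simp [walkWeight], fun i hi => ?_⟩
    obtain rfl : i = 0 := by omega
    exact h.symm
  | @step P L e hw he ha hj ih =>
    intro y hy
    obtain ⟨z, hz⟩ : ∃ z : Fin n, σ P = z := by
      rcases hj with ⟨a, -⟩ | ⟨-, a⟩
      · exact ⟨(ends ⟨e, he⟩).1, a.symm.trans (toInst_eu (⟨e, he⟩ : Fin m))⟩
      · exact ⟨(ends ⟨e, he⟩).2, a.symm.trans (toInst_ev (⟨e, he⟩ : Fin m))⟩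
    obtain ⟨p, h1, h2, h3⟩ := ih z hz
    rw [hy, hz] at hj
    have hj' := (toInst_joins (⟨e, he⟩ : Fin m) z y).1 hj
    have hadj : (removeEdges G F).Adj z y := by
      rw [removeEdges, SimpleGraph.deleteEdges_adj]
      refine ⟨?_, ?_⟩
      · have := edge_mem hE ⟨e, he⟩
        rwa [hj'] at this
      · have := (alive_iff hT ht hF ⟨e, he⟩).1 ha
        rwa [hj'] at this
    refine ⟨p.concat hadj, by rw [SimpleGraph.Walk.length_concat, h1], ?_, fun i hi => ?_⟩
    · rw [← h2, show (toInst w r T ends f).wt e = _ from toInst_wt (⟨e, he⟩ : Fin m), hj']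
      simp [walkWeight, SimpleGraph.Walk.edges_concat]
    · rw [SimpleGraph.Walk.concat_eq_append, SimpleGraph.Walk.getVert_append']
      split_ifs with hc
      · exact h3 i (by omega)
      · obtain rfl : i = P + 1 := by omega
        rw [h1, Nat.add_sub_cancel_left, hy]
        rfl

/-- Stated as an extension of a given prefix, since graph walks are built from the front and
`IsWalk` grows at the end. -/
theorem IsWalk.of_walk (hE : IsEdgeListing G ends) (hT : IsSPT G w r T)
    (ht : Rooted (toInst w r T ends f) ord par dep dist) {v : Fin n} {F : Finset (Sym2 (Fin n))}
    (hF : IsPathFailure T r v F) {x y : Fin n} (p : (removeEdges G F).Walk x y) :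
    ∀ σ P L, IsWalk (toInst w r T ends f) ((toInst w r T ends f).Alive par v F.card) σ P L →
      σ P = x → ∃ σ' P', IsWalk (toInst w r T ends f)
        ((toInst w r T ends f).Alive par v F.card) σ' P' (L + walkWeight w p) ∧ σ' P' = y := by
  induction p with
  | nil => intro σ P L hw hx; exact ⟨σ, P, by simpa [walkWeight] using hw, hx⟩
  | @cons x z y hxz p ih =>
    intro σ P L hw hx
    rw [removeEdges, SimpleGraph.deleteEdges_adj] at hxz
    obtain ⟨e, he⟩ := exists_edge hE hxz.1
    have hw' := IsWalk.step (σ := fun j => if j ≤ P then σ j else z) e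
      (hw.congr fun j hj => if_pos hj) e.2
      ((alive_iff hT ht hF e).2 (by rw [he]; exact hxz.2)) (by
        rw [if_pos le_rfl, if_neg (by omega), hx]
        exact (toInst_joins e x z).2 he)
    obtain ⟨σ', P', h1, h2⟩ := ih _ _ _ hw' (if_neg (by omega))
    refine ⟨σ', P', ?_, h2⟩
    rw [toInst_wt, he] at h1
    convert h1 using 1
    simp [walkWeight, add_assoc]

end

/-! ### The oracle -/

section

variable {n m : ℕ} {G T : SimpleGraph (Fin n)} {w : Sym2 (Fin n) → ℝ≥0} {r : Fin n}
  {ends : Fin m → Fin n × Fin n} {f k : ℕ}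

theorem graphInput_le (a : ℕ) (hn : 1 ≤ n) : graphInput T ends a ≤ n := by
  unfold graphInput
  split_ifs
  · exact (Fin.is_lt _).le
  · exact (Fin.is_lt _).le
  · exact hn
  · exact Nat.zero_le _
  · exact Nat.zero_le _

theorem args_le {B : ℕ} {l : List ℕ} (h : ∀ x ∈ l, x ≤ B) (i : ℕ) : l.getD i 0 ≤ B := by
  rw [List.getD_eq_getElem?_getD]
  cases hx : l[i]? with
  | none => exact Nat.zero_le _
  | some x => exact h x (List.mem_of_getElem? hx)

/-- All stored integers are at most `N ^ 4`. For `N ≥ 4` one has `N ^ 4 + 100 ≤ N ^ 5`, and the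
eighth power required by the degree bound gives the exponent 40. -/
theorem wordBound {N n m f : ℕ} (hN : 4 ≤ N) (hn : n + f + 2 ≤ N) (hn1 : 1 ≤ n)
    (hm : m ≤ n * n) : n + 2 ≤ N ^ 4 ∧ m ≤ N ^ 4 ∧ n * (f + 1) ≤ N ^ 4 ∧
      (f + 1) * (f + 1) ≤ N ^ 4 ∧ 2 * f + 2 ≤ N ^ 4 ∧ 2 * f * (2 * n) + 3 * n + 9 ≤ N ^ 4 ∧
      N ≤ N ^ 4 ∧ (N ^ 4 + 100) ^ 8 ≤ N ^ 40 := by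
  have h2 : 16 ≤ N * N := by nlinarith
  have h4 : 16 * (N * N) ≤ N ^ 4 := by nlinarith
  have hNN : N ≤ N * N := by nlinarith
  have a1 : n * n ≤ N * N := Nat.mul_le_mul (by omega) (by omega)
  have a2 : n * (f + 1) ≤ N * N := Nat.mul_le_mul (by omega) (by omega)
  have a3 : (f + 1) * (f + 1) ≤ N * N := Nat.mul_le_mul (by omega) (by omega)
  have a4 : f * n ≤ N * N := Nat.mul_le_mul (by omega) (by omega)
  have a5 : 2 * f * (2 * n) = 4 * (f * n) := by ring
  refine ⟨by omega, by omega, by omega, by omega, by omega, by omega, by omega, ?_⟩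
  have h5 : N ^ 4 + 100 ≤ N ^ 5 := by
    have : 4 * N ^ 4 ≤ N ^ 5 := by
      calc 4 * N ^ 4 ≤ N * N ^ 4 := Nat.mul_le_mul_right _ hN
        _ = N ^ 5 := by ring
    omega
  calc (N ^ 4 + 100) ^ 8 ≤ (N ^ 5) ^ 8 := Nat.pow_le_pow_left h5 8
    _ = N ^ 40 := by ring

theorem build_init {W : ℕ} (hT : IsSPT G w r T) (hE : IsEdgeListing G ends) (hf : 1 ≤ f)
    (hk : 1 ≤ k) (hW : (n + f + k + 1) ^ 40 ≤ W) : ∃ (oracle : Store) (τ : ℕ),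
      Exec W build (Store.init [n, m, (r : ℕ), f, k] (graphInput T ends) (weightInput w ends)) τ
        oracle ∧ τ ≤ 100000 * (n * (m + f ^ 2)) ∧ Bdd ((n + f + k + 1) ^ 4) oracle ∧
      IsOracle (toInst w r T ends f) (oracle.arr .output) (oracle.rarr .output) ∧
      OutputSizeLE oracle (16 * (n * (f + 1))) := by
  have hn1 : 1 ≤ n := by have := r.2; omega
  have hm := edges_le hE
  obtain ⟨b1, b2, b3, b4, b5, b6, b7, b8⟩ := wordBound (N := n + f + k + 1) (n := n) (f := f)
    (by omega) (by omega) hn1 hm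
  have hb : Bdd ((n + f + k + 1) ^ 4)
      (Store.init [n, m, (r : ℕ), f, k] (graphInput T ends) (weightInput w ends)) := by
    refine ⟨fun i => args_le ?_ i, fun b a => ?_⟩
    · have := r.2
      simp only [List.mem_cons, List.not_mem_nil, or_false]
      rintro x (rfl | rfl | rfl | rfl | rfl) <;> omega
    · cases b
      · exact (graphInput_le a hn1).trans (by omega)
      · exact Nat.zero_le _
      · exact Nat.zero_le _
  obtain ⟨τ, s', h1, h2, h3, h4, h5⟩ := build_spec (B := (n + f + k + 1) ^ 4)
    (toInst_valid hE hT hf)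
    (s := Store.init [n, m, (r : ℕ), f, k] (graphInput T ends) (weightInput w ends))
    rfl rfl rfl rfl (fun _ _ => rfl) (fun _ _ => rfl) (fun _ _ => rfl) (fun _ _ => rfl)
    (fun _ => rfl) (fun _ => rfl) (fun _ => rfl) (fun _ => rfl) b1 b2 b3 b4 W (b8.trans hW) hb
  refine ⟨s', τ, h1, h2, h3, h4, fun a ha => ?_⟩
  have h := h5 (a % 16) (Nat.mod_lt _ (by norm_num)) (a / 16)
    ((Nat.le_div_iff_mul_le (by norm_num)).2 (by rw [mul_comm]; exact ha))
  unfold Store.arr Store.rarr at h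
  rwa [Nat.div_add_mod] at h

/-- Since `f ≥ 1`, both `f + 1 ≤ 2 f` and `f ≤ k f ^ (1 + 1 / k)` hold; the constant is 16
interleaved arrays times 2. -/
theorem oracle_size (hf : 1 ≤ f) (hk : 1 ≤ k) {C : ℕ} (hC : 32 ≤ C) :
    ((16 * (n * (f + 1)) : ℕ) : ℝ) ≤ C * (n * k * (f : ℝ) ^ (1 + 1 / (k : ℝ))) := by
  have hf' : (1 : ℝ) ≤ f := by exact_mod_cast hf
  have hk' : (1 : ℝ) ≤ k := by exact_mod_cast hk
  have hC' : (32 : ℝ) ≤ C := by exact_mod_cast hC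
  have h1 : (f : ℝ) ≤ (f : ℝ) ^ (1 + 1 / (k : ℝ)) := by
    conv_lhs => rw [← Real.rpow_one (f : ℝ)]
    exact Real.rpow_le_rpow_of_exponent_le hf' (by
      have : (0 : ℝ) ≤ 1 / (k : ℝ) := by positivity
      linarith)
  have h2 : (f : ℝ) ≤ k * (f : ℝ) ^ (1 + 1 / (k : ℝ)) := by nlinarith
  have hn : (0 : ℝ) ≤ n := Nat.cast_nonneg n
  push_cast
  calc (16 : ℝ) * (n * (f + 1)) ≤ 32 * (n * f) := by nlinarith
    _ ≤ 32 * (n * (k * (f : ℝ) ^ (1 + 1 / (k : ℝ)))) := by gcongr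
    _ ≤ C * (n * (k * (f : ℝ) ^ (1 + 1 / (k : ℝ)))) := by
      gcongr
    _ = C * (n * k * (f : ℝ) ^ (1 + 1 / (k : ℝ))) := by ring

theorem le_mul_wdist {H : SimpleGraph (Fin n)} {x y : Fin n} {d c : ℝ} (hc : 0 < c)
    (h : ∀ p : H.Walk x y, d ≤ c * walkWeight w p) :
    ENNReal.ofReal d ≤ ENNReal.ofReal c * wdist H w x y := by
  unfold wdist
  rw [ENNReal.mul_iInf_of_ne (by simpa using hc) ENNReal.ofReal_ne_top]
  refine le_iInf fun p => ?_
  rw [← ENNReal.ofReal_coe_nnreal, ← ENNReal.ofReal_mul hc.le]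
  exact ENNReal.ofReal_le_ofReal (h p)

/-- The number reported by the distance query is the weight of the walk reported by the path query,
so it cannot be smaller than the distance. The upper bound holds for every walk and passes to the
infimum. -/
theorem query_init {W : ℕ} (hT : IsSPT G w r T) (hE : IsEdgeListing G ends) (hf : 1 ≤ f)
    (hk : 1 ≤ k) (hW : (n + f + k + 1) ^ 40 ≤ W) {oracle : Store}
    (hb : Bdd ((n + f + k + 1) ^ 4) oracle)
    (hO : IsOracle (toInst w r T ends f) (oracle.arr .output) (oracle.rarr .output))
    {F : Finset (Sym2 (Fin n))} {v : Fin n} (t : Fin n) (hF : IsPathFailure T r v F)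
    (hFf : F.card ≤ f) :
    (wdist (removeEdges G F) w r t = ⊤ ∧ AnswersNo W f (queryInit oracle v F.card t)) ∨
    ∃ d : ℝ, wdist (removeEdges G F) w r t ≤ ENNReal.ofReal d ∧
      ENNReal.ofReal d ≤ (2 * F.card + 1 : ℕ) * wdist (removeEdges G F) w r t ∧
      (∃ s τ, Exec W distQuery (queryInit oracle v F.card t) τ s ∧ τ ≤ 2000 * (f + 1) ∧
        ReportsDist s (ENNReal.ofReal d)) ∧
      ∃ (p : (removeEdges G F).Walk r t) (s : Store) (τ : ℕ),
        (walkWeight w p : ℝ≥0∞) = ENNReal.ofReal d ∧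
        Exec W pathQuery (queryInit oracle v F.card t) τ s ∧
        τ ≤ p.length * 300 + 2000 * (f + 1) ∧ ReportsWalk s p := by
  have hn1 : 1 ≤ n := by have := r.2; omega
  obtain ⟨b1, b2, b3, b4, b5, b6, b7, b8⟩ := wordBound (N := n + f + k + 1) (n := n) (f := f)
    (by omega) (by omega) hn1 (edges_le hE)
  obtain ⟨ord, ht⟩ := hO.rooted
  have hbq : Bdd ((n + f + k + 1) ^ 4) (queryInit oracle v F.card t) := by
    refine ⟨fun i => args_le ?_ i, fun b a => ?_⟩
    · have := v.2
      have := t.2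
      simp only [List.mem_cons, List.not_mem_nil, or_false]
      rintro x (rfl | rfl | rfl) <;> omega
    · cases b
      · exact hb.2 .output a
      · exact Nat.zero_le _
      · exact Nat.zero_le _
  have hwalk : ∀ p : (removeEdges G F).Walk r t, ∃ σ P, IsWalk (toInst w r T ends f)
      ((toInst w r T ends f).Alive (oracle.arr .output 1) v F.card) σ P (walkWeight w p) ∧
      σ P = t := fun p => by
    obtain ⟨σ, P, h1, h2⟩ := IsWalk.of_walk hE hT ht hF p (fun _ => r) 0 0 (.zero rfl) rfl
    rw [zero_add] at h1
    exact ⟨σ, P, h1, h2⟩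
  have hη := (failure_spec hT ht hF).1
  have hW' := b8.trans hW
  generalize (n + f + k + 1) ^ 4 = B at *
  have c1 : 2 * (toInst w r T ends f).f + 2 ≤ B := b5
  have c2 : (toInst w r T ends f).n * ((toInst w r T ends f).f + 1) ≤ B := b3
  have c3 : 2 * (toInst w r T ends f).f * (2 * (toInst w r T ends f).n) +
    3 * (toInst w r T ends f).n + 9 ≤ B := b6
  have i1 : ∀ k < 16, (queryInit oracle v F.card t).arr .input k = oracle.arr .output k :=
    fun _ _ => rfl
  have i2 : ∀ k < 16, (queryInit oracle v F.card t).rarr .input k = oracle.rarr .output k :=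
    fun _ _ => rfl
  have i3 : ∀ k q, (queryInit oracle v F.card t).arr .work k q = 0 := fun _ _ => rfl
  have i4 : ∀ q, (queryInit oracle v F.card t).rarr .work 0 q = 0 := fun _ => rfl
  have i5 : ∀ k q, (queryInit oracle v F.card t).arr .output k q = 0 := fun _ _ => rfl
  have j0 : (queryInit oracle v F.card t).reg 0 = v := rfl
  have j1 : (queryInit oracle v F.card t).reg 1 = F.card := rfl
  have j2 : (queryInit oracle v F.card t).reg 2 = t := rfl
  have hvn : (v : ℕ) < (toInst w r T ends f).n := v.2
  have htn : (t : ℕ) < (toInst w r T ends f).n := t.2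
  have hFg : F.card ≤ (toInst w r T ends f).f := hFf
  rcases query_spec (toInst_valid hE hT hf) hO (toInst_shortest hE hT hf ht) hvn htn hFg hη
    c1 c2 c3 hW' hbq i1 i2 j0 j1 j2 i3 i4 i5
    with ⟨hno, hans⟩ | ⟨d, hd, ⟨s, τ, e1, e2, e3, e4⟩, P, s', τ', k1, k2, k3⟩
  · refine .inl ⟨?_, hans⟩
    unfold wdist
    rw [iInf_eq_top]
    intro p
    obtain ⟨σ, P, h1, h2⟩ := hwalk p
    exact absurd h2 (hno σ P _ h1)
  · obtain ⟨p, p1, p2, p3⟩ := k3.walk.to_walk hE hT ht hF t k3.last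
    have hpd : (walkWeight w p : ℝ≥0∞) = ENNReal.ofReal d := by
      rw [← p2, ENNReal.ofReal_coe_nnreal]
    refine .inr ⟨d, hpd ▸ iInf_le _ p, ?_, ⟨s, τ, e1, e2, .inr ⟨ENNReal.ofReal_ne_top, e3, ?_⟩⟩,
      p, s', τ', hpd, k1, by rw [p1]; exact k2, k3.zero, by rw [k3.one, p1], fun i hi => ?_⟩
    · have hc : (0 : ℝ) < 2 * F.card + 1 := by linarith [(F.card.cast_nonneg : (0 : ℝ) ≤ F.card)]
      have hle : ∀ p : (removeEdges G F).Walk r t, d ≤ (2 * F.card + 1) * walkWeight w p :=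
        fun p => by
          obtain ⟨σ, P, h1, h2⟩ := hwalk p
          exact hd σ P _ h1 h2
      have hcast : ENNReal.ofReal (2 * F.card + 1) = (2 * F.card + 1 : ℕ) := by
        rw [← ENNReal.ofReal_natCast]
        push_cast
        rfl
      rw [← hcast]
      exact le_mul_wdist hc hle
    · rw [e4, ENNReal.toReal_ofReal]
      rw [← p2]; positivity
    · exact (p3 i (by omega)).symm

end

end PathOracle

open PathOracle in
theorem mainTheorem4 :
    ∃ (build distQuery pathQuery : Program) (C : ℕ),
      ∀ (n : ℕ) (G : SimpleGraph (Fin n)) (w : Sym2 (Fin n) → ℝ≥0) (r : Fin n)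
        (T : SimpleGraph (Fin n)) (m : ℕ) (ends : Fin m → Fin n × Fin n) (f k : ℕ),
        IsSPT G w r T → IsEdgeListing G ends → 1 ≤ f → 1 ≤ k →
        ∃ (oracle : Store) (τ S : ℕ),
          -- preprocessing
          Exec ((n + f + k + 1) ^ C) build
            (Store.init [n, m, (r : ℕ), f, k] (graphInput T ends) (weightInput w ends)) τ oracle ∧
          τ ≤ C * (n * (m + f ^ 2)) ∧
          -- size of the oracle
          OutputSizeLE oracle S ∧
          (S : ℝ) ≤ C * (n * k * (f : ℝ) ^ (1 + 1 / (k : ℝ))) ∧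
          -- queries
          ∀ (F : Finset (Sym2 (Fin n))) (v t : Fin n),
            IsPathFailure T r v F → 0 < F.card → F.card ≤ f →
            ∃ d : ℝ≥0∞,
              wdist (removeEdges G F) w r t ≤ d ∧
              d ≤ (2 * k - 1 : ℕ) * (2 * F.card + 1 : ℕ) * wdist (removeEdges G F) w r t ∧
              -- distance query
              (∃ (s : Store) (τ₁ : ℕ),
                Exec ((n + f + k + 1) ^ C) distQuery (queryInit oracle v F.card t) τ₁ s ∧
                τ₁ ≤ C * (f + k) ∧ ReportsDist s d) ∧
              -- path query, when the target is reachable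
              (d ≠ ⊤ → ∃ (p : (removeEdges G F).Walk r t) (s : Store) (τ₂ : ℕ),
                (walkWeight w p : ℝ≥0∞) = d ∧
                Exec ((n + f + k + 1) ^ C) pathQuery (queryInit oracle v F.card t) τ₂ s ∧
                τ₂ ≤ C * (p.length + k + f) ∧ ReportsWalk s p) ∧
              -- path query, when the target is not reachable
              (d = ⊤ → ∃ (s : Store) (τ₂ : ℕ),
                Exec ((n + f + k + 1) ^ C) pathQuery (queryInit oracle v F.card t) τ₂ s ∧
                τ₂ ≤ C * (k + f) ∧ ReportsNoWalk s) := by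
  -- The constant comes from the preprocessing time; it also exceeds the exponent 40, the size
  -- constant 32 and the factors 300 and 2000 of the queries.
  refine ⟨build, distQuery, pathQuery, 100000, ?_⟩
  obtain ⟨C, hC⟩ : ∃ C : ℕ, C = 100000 := ⟨_, rfl⟩
  rw [← hC]
  intro n G w r T m ends f k hT hE hf hk
  have hW : (n + f + k + 1) ^ 40 ≤ (n + f + k + 1) ^ C := Nat.pow_le_pow_right (by omega) (by omega)
  obtain ⟨oracle, τ, h1, h2, h3, h4, h5⟩ := build_init hT hE hf hk hW
  refine ⟨oracle, τ, _, h1, by rw [hC]; exact h2, h5, oracle_size hf hk (by omega),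
    fun F v t hF _ hFf => ?_⟩
  -- The oracle already has stretch `2 * F.card + 1`; the further factor only weakens the bound.
  have hk1 : (1 : ℝ≥0∞) ≤ (2 * k - 1 : ℕ) := by exact_mod_cast (by omega : 1 ≤ 2 * k - 1)
  have time : 2000 * (f + 1) ≤ C * (k + f) := by
    have : C * (k + f) = C * k + C * f := Nat.mul_add _ _ _
    have : C ≤ C * k := Nat.le_mul_of_pos_right _ (by omega)
    have : 100000 * f ≤ C * f := by rw [hC]
    omega
  rcases query_init hT hE hf hk hW h3 h4 t hF hFf with ⟨hd, ⟨s, τ₁, a1, a2, a3⟩, s', τ₂, c1, c2, c3⟩ |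
    ⟨d, d1, d2, ⟨s, τ₁, a1, a2, a3⟩, p, s', τ₂, c0, c1, c2, c3⟩
  · refine ⟨⊤, le_top, ?_, ⟨s, τ₁, a1, by rw [add_comm]; exact a2.trans time, .inl ⟨rfl, a3⟩⟩,
      fun h => absurd rfl h, fun _ => ⟨s', τ₂, c1, c2.trans time, c3⟩⟩
    rw [hd, ENNReal.mul_top]
    refine mul_ne_zero (by positivity) ?_
    simp
  · refine ⟨ENNReal.ofReal d, d1, ?_, ⟨s, τ₁, a1, by rw [add_comm]; exact a2.trans time, a3⟩,
      fun _ => ⟨p, s', τ₂, c0, c1, ?_, c3⟩, fun h => absurd h ENNReal.ofReal_ne_top⟩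
    · refine d2.trans ?_
      rw [mul_assoc]
      exact le_mul_of_one_le_left zero_le hk1
    · have h300 : p.length * 300 ≤ C * p.length := by
        rw [mul_comm]
        exact Nat.mul_le_mul_right _ (by omega)
      rw [add_assoc, Nat.mul_add]
      exact c2.trans (Nat.add_le_add h300 time)
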